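/- A closed $(S^2\times\mathbb R)$-space is a compact topological space homeomorphic to a quotient $(S^2\times\mathbb R)/\Gamma$, where $\Gamma$ is a subgroup of the isometry group $O(3)\times\mathrm{Isom}(\mathbb R)$ of $S^2\times\mathbb R$ acting properly discontinuously and without fixed points (no element of $\Gamma$ other than the identity fixes a point). A triangulation of a space $X$ with $n$ vertices is a finite simplicial complex with exactly $n$ vertices whose underlying polyhedron is homeomorphic to $X$. Let $S^2\,\tilde\times\,S^1$ denote the nonorientable $S^2$-bundle over $S^1$, i.e. the mapping torus of a reflection of $S^2$, and let $\mathbb{RP}^3\#\mathbb{RP}^3$ be the connected sum of two copies of real projective $3$-space. Theorem. Every closed $(S^2\times\mathbb R)$-space has a triangulation with at most $15$ vertices. More precisely, a topological space is a closed $(S^2\times\mathbb R)$-space if and only if it is homeomorphic to one of the four manifolds $S^2\,\tilde\times\,S^1$, $S^2\times S^1$, $\mathbb{RP}^2\times S^1$, $\mathbb{RP}^3\#\mathbb{RP}^3$, and these four manifolds have triangulations with $9$, $10$, $14$ and $15$ vertices, respectively. -/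

import Mathlib

/-- Euclidean `n`-space. -/
abbrev Euc (n : ℕ) : Type := EuclideanSpace ℝ (Fin n)

/-- The standard unit sphere `Sⁿ ⊆ ℝⁿ⁺¹`. -/
abbrev StdSphere (n : ℕ) : Type := Metric.sphere (0 : Euc (n + 1)) 1

/-- `X` has a triangulation with exactly `n` vertices: it is homeomorphic to the underlying
space (polyhedron) of a finite geometric simplicial complex with `n` vertices. -/
def HasTriangulation (X : Type*) [TopologicalSpace X] (n : ℕ) : Prop :=
  ∃ (d : ℕ) (K : Geometry.SimplicialComplex ℝ (Euc d)),
    K.vertices.Finite ∧ K.vertices.ncard = n ∧ Nonempty (K.space ≃ₜ X)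

/-- An orthogonal transformation restricted to the unit sphere. -/
noncomputable def sphereMap {n : ℕ} (A : Euc (n + 1) ≃ₗᵢ[ℝ] Euc (n + 1)) (x : StdSphere n) : StdSphere n :=
  ⟨A x, by simp⟩

/-- The isometry group `O(3) × Isom(ℝ)` of the Riemannian product `S² × ℝ`. -/
abbrev IsomS2R : Type := (Euc 3 ≃ₗᵢ[ℝ] Euc 3) × (ℝ ≃ᵢ ℝ)

/-- The componentwise action of `O(3) × Isom(ℝ)` on `S² × ℝ`. -/
noncomputable instance instMulActionIsomS2R : MulAction IsomS2R (StdSphere 2 × ℝ) where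
  smul g p := (sphereMap g.1 p.1, g.2 p.2)
  one_smul _ := rfl
  mul_smul _ _ _ := rfl

/-- Closed `(S² × ℝ)`-spaces: compact spaces homeomorphic to a quotient of `S² × ℝ` by a group of
isometries that acts properly discontinuously and without fixed points. -/
def IsS2RSpace (M : Type*) [TopologicalSpace M] : Prop :=
  CompactSpace M ∧ ∃ Γ : Subgroup IsomS2R,
    ProperlyDiscontinuousSMul Γ (StdSphere 2 × ℝ) ∧
    (∀ (γ : Γ) (p : StdSphere 2 × ℝ), γ • p = p → γ = 1) ∧
    Nonempty (M ≃ₜ MulAction.orbitRel.Quotient Γ (StdSphere 2 × ℝ))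

/-- The gluing relation `(x, 1) ∼ (f x, 0)` on `X × [0, 1]`. -/
inductive MappingTorusRel {X : Type*} (f : X → X) :
    X × unitInterval → X × unitInterval → Prop
  | glue (x : X) : MappingTorusRel f (x, 1) (f x, 0)

/-- The mapping torus of `f`. -/
abbrev MappingTorus {X : Type*} (f : X → X) : Type _ := Quot (MappingTorusRel f)

/-- The reflection of `ℝ³` in the plane orthogonal to the first coordinate axis. -/
noncomputable def reflectionR3 : Euc 3 ≃ₗᵢ[ℝ] Euc 3 :=
  (ℝ ∙ (EuclideanSpace.single 0 1 : Euc 3))ᗮ.reflection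

/-- The twisted product of `S²` and `S¹` (the nonorientable `S²`-bundle over `S¹`): the mapping
torus of an orientation-reversing reflection of `S²`. -/
abbrev TwistedS2S1 : Type := MappingTorus (sphereMap reflectionR3)

/-- Antipodal points of the sphere are identified. -/
def antipodalSetoid (n : ℕ) : Setoid (StdSphere n) where
  r x y := x = y ∨ x = -y
  iseqv :=
    { refl := fun _ => Or.inl rfl
      symm := by
        rintro x y (rfl | rfl)
        · exact Or.inl rfl
        · exact Or.inr (neg_neg y).symm
      trans := by
        rintro x y z (rfl | rfl) (rfl | rfl)
        · exact Or.inl rfl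
        · exact Or.inr rfl
        · exact Or.inr rfl
        · exact Or.inl (neg_neg z) }

/-- Real projective `n`-space, as the quotient of `Sⁿ` by the antipodal map. -/
abbrev RP (n : ℕ) : Type := Quotient (antipodalSetoid n)

/-- The vector `(1, y₁, …, yₙ)`. -/
noncomputable def oneCons {n : ℕ} (y : Euc n) : Euc (n + 1) :=
  WithLp.toLp 2 (Fin.cons 1 (fun i => y i))

theorem oneCons_ne_zero {n : ℕ} (y : Euc n) : oneCons y ≠ 0 := fun h => by
  simpa [oneCons] using congrArg (fun v : Euc (n + 1) => v 0) h

/-- The standard affine chart `y ↦ [1 : y₁ : … : yₙ]` of `ℝPⁿ`. -/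
noncomputable def affineChart {n : ℕ} (y : Euc n) : RP n :=
  Quotient.mk (antipodalSetoid n)
    ⟨(‖oneCons y‖)⁻¹ • oneCons y, by
      simp [norm_smul, norm_ne_zero_iff.mpr (oneCons_ne_zero y)]⟩

/-- Gluing relation for the connected sum: `i x ∼ j x` for the points `x` of the unit sphere. -/
inductive ConnectedSumRel {n : ℕ} {M N : Type*} (i : Euc n → M) (j : Euc n → N) :
    ↥(i '' Metric.ball 0 1)ᶜ ⊕ ↥(j '' Metric.ball 0 1)ᶜ →
    ↥(i '' Metric.ball 0 1)ᶜ ⊕ ↥(j '' Metric.ball 0 1)ᶜ → Prop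
  | glue (x : Euc n) (hx : ‖x‖ = 1) (a : ↥(i '' Metric.ball 0 1)ᶜ)
      (b : ↥(j '' Metric.ball 0 1)ᶜ) (ha : a.1 = i x) (hb : b.1 = j x) :
      ConnectedSumRel i j (Sum.inl a) (Sum.inr b)

/-- The connected sum of two `n`-manifolds along open embeddings `i : ℝⁿ → M` and `j : ℝⁿ → N`:
the images of the open unit ball are removed and the resulting boundary spheres are identified. -/
abbrev ConnectedSum {n : ℕ} {M N : Type*} (i : Euc n → M) (j : Euc n → N) : Type _ :=
  Quot (ConnectedSumRel i j)

/-- `ℝP³ # ℝP³`. As `ℝP³` has an orientation-reversing self-homeomorphism, the connected sum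
does not depend on orientations. -/
abbrev RP3SumRP3 : Type := ConnectedSum (affineChart (n := 3)) (affineChart (n := 3))

/-! Everything passes through one normal form. A space is described as a quotient of `S² × [0, 1]`
with a prescribed fiber relation (`IsQuotientBy`). Such a relation determines the space up to
homeomorphism, and four relations suffice: the mapping torus relations of a reflection and of the
identity, `ProjectiveFiber` (antipodes identified at every height, ends glued) and `DoubleFiber`
(antipodes identified at the two ends only).

Classification (`orbitSpace_isQuotientBy`). Cocompactness and proper discontinuity make the
translation parts of `Γ` an infinite cyclic group generated by some `T > 0`. An element that fixes a
height has a square with a fixed point, because the square of every orthogonal map of `ℝ³` fixes a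
unit vector. Freeness then makes the element an involution, and its spherical part a
fixed-point-free involution, hence the antipodal map, unless the element is trivial. If `Γ` reflects
`ℝ`, it is infinite dihedral and gives `DoubleFiber`. Otherwise it is generated by one screw motion
`(A, T)`, possibly together with `(antipode, 1)`. Every element of `O(3)` can be joined to the
identity or to a fixed reflection, and such a path straightens `A` without changing the quotient.
The four model manifolds satisfy the same relations, and explicit groups realize them all.

Triangulation. The braid arrangement cuts `S²` into the barycentric subdivision of the boundary of a
tetrahedron: vertices are proper nonempty subsets of a four-element set, simplices are chains.
Antipodes become complements, and the reflection becomes a transposition. Prisms over this complex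
are cut into staircases of tetrahedra, and identifying vertices in the outer layers, or in all of
them, yields a finite complex for each relation. That the complex realizes the quotient is checked
in barycentric coordinates: `stairPoint` is a continuous surjection whose fibers are the required
ones. The complexes so obtained have too many vertices. Explicit sequences of bistellar flips, which
preserve the realization up to homeomorphism (`flipHomeomorph`), reduce them to 9, 10, 14 and 15
vertices, and the kernel checks every flip. -/

/-! ### Bistellar flips as piecewise linear homeomorphisms -/

/-- The geometric realization, in barycentric coordinates, of the simplicial complex on the vertex
set `ι` generated by a family `𝓚` of finite sets. -/
def Realization {ι : Type*} [Fintype ι] (𝓚 : Set (Finset ι)) : Set (ι → ℝ) :=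
  {y | (∀ i, 0 ≤ y i) ∧ ∑ i, y i = 1 ∧ ∃ F ∈ 𝓚, ∀ i, y i ≠ 0 → i ∈ F}

/-- The piecewise linear map that underlies the bistellar flip exchanging `S * ∂T` and `∂S * T`. -/
noncomputable def flipMap {ι : Type*} [DecidableEq ι] (S T : Finset ι) (hS : S.Nonempty)
    (y : ι → ℝ) (i : ι) : ℝ :=
  y i - (if i ∈ S then S.inf' hS y else 0) + if i ∈ T then S.card / T.card * S.inf' hS y else 0

section Flip

theorem continuous_flipMap {ι : Type*} [DecidableEq ι] {S T : Finset ι} (hS : S.Nonempty) : Continuous (flipMap S T hS) := by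
  have h : Continuous fun y : ι → ℝ => S.inf' hS y := by
    have := Continuous.finset_inf'_apply (f := fun i (y : ι → ℝ) => y i) hS
      (fun i _ => continuous_apply i)
    exact this
  refine continuous_pi fun i => ?_
  unfold flipMap
  split_ifs <;> fun_prop

theorem inf'_eq_zero_of_support_subset {ι : Type*} {S : Finset ι} (hS : S.Nonempty) {F : Finset ι} {y : ι → ℝ}
    (h0 : ∀ i, 0 ≤ y i) (hF : ∀ i, y i ≠ 0 → i ∈ F) (hSF : ¬ S ⊆ F) : S.inf' hS y = 0 := by
  obtain ⟨a, haS, haF⟩ := Finset.not_subset.1 hSF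
  refine le_antisymm ?_ (Finset.le_inf' _ _ fun i _ => h0 i)
  have : y a = 0 := by_contra fun h => haF (hF a h)
  exact (Finset.inf'_le y haS).trans this.le

variable {ι : Type*} [Fintype ι] [DecidableEq ι] {S T : Finset ι} {𝓚 𝓚' : Set (Finset ι)}

/-- Subtracting the minimum over `S` empties some coordinate `a ∈ S`, so a point of the star of `S`
lands in the new facet without `a`. The mass `S.card` times the minimum lost on `S` is regained on
`T`. Off the star of `S` the minimum is zero and the point does not move. -/
theorem flipMap_mem (hS : S.Nonempty) (hT : T.Nonempty) (hST : Disjoint S T)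
    (h2 : ∀ F ∈ 𝓚, S ⊆ F → F ⊆ S ∪ T) (h3 : ∀ a ∈ S, (S ∪ T).erase a ∈ 𝓚')
    (h4 : ∀ F ∈ 𝓚, ¬ S ⊆ F → F ∈ 𝓚') {y : ι → ℝ} (hy : y ∈ Realization 𝓚) :
    flipMap S T hS y ∈ Realization 𝓚' := by
  obtain ⟨h0, h1, F, hF, hsupp⟩ := hy
  have hm : 0 ≤ S.inf' hS y := Finset.le_inf' _ _ fun i _ => h0 i
  refine ⟨fun i => ?_, ?_, ?_⟩
  · have h5 : 0 ≤ y i - if i ∈ S then S.inf' hS y else 0 := by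
      split_ifs with h
      · exact sub_nonneg.2 (Finset.inf'_le y h)
      · simpa using h0 i
    have h6 : 0 ≤ if i ∈ T then (S.card / T.card * S.inf' hS y : ℝ) else 0 := by
      split_ifs <;> positivity
    exact add_nonneg h5 h6
  · have hc : (T.card : ℝ) ≠ 0 := by simpa using hT.ne_empty
    simp only [flipMap, Finset.sum_add_distrib, Finset.sum_sub_distrib, h1, Finset.sum_ite_mem,
      Finset.univ_inter, Finset.sum_const, nsmul_eq_mul]
    field_simp
    ring
  · by_cases hSF : S ⊆ F
    · obtain ⟨a, ha, hma⟩ := Finset.exists_mem_eq_inf' hS y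
      refine ⟨_, h3 a ha, fun i hi => ?_⟩
      rw [Finset.mem_erase]
      constructor
      · rintro rfl
        have : i ∉ T := Finset.disjoint_left.1 hST ha
        simp [flipMap, ha, this, hma] at hi
      · by_contra hn
        simp only [Finset.mem_union, not_or] at hn
        have : y i = 0 := by_contra fun h => by
          have := h2 F hF hSF (hsupp i h)
          simp only [Finset.mem_union] at this
          tauto
        simp [flipMap, hn.1, hn.2, this] at hi
    · refine ⟨F, h4 F hF hSF, fun i hi => hsupp i ?_⟩
      simpa [flipMap, inf'_eq_zero_of_support_subset hS h0 hsupp hSF] using hi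

/-- Since no face contains `T`, some coordinate in `T` is zero beforehand. Every coordinate in `T`
grows by the same amount, so the new minimum over `T` is exactly that amount and the opposite flip
returns what was moved. -/
theorem flipMap_flipMap (hS : S.Nonempty) (hT : T.Nonempty) (hST : Disjoint S T)
    (h1 : ∀ F ∈ 𝓚, ¬ T ⊆ F) {y : ι → ℝ} (hy : y ∈ Realization 𝓚) :
    flipMap T S hT (flipMap S T hS y) = y := by
  obtain ⟨h0, -, F, hF, hsupp⟩ := hy
  have hT0 := inf'_eq_zero_of_support_subset hT h0 hsupp (h1 F hF)
  have key : T.inf' hT (flipMap S T hS y) = S.card / T.card * S.inf' hS y := by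
    obtain ⟨b, hb, hmb⟩ := Finset.exists_mem_eq_inf' hT y
    have hv : ∀ i ∈ T, flipMap S T hS y i = y i + S.card / T.card * S.inf' hS y := fun i hi => by
      have : i ∉ S := Finset.disjoint_right.1 hST hi
      simp [flipMap, hi, this]
    refine le_antisymm ?_ (Finset.le_inf' _ _ fun i hi => ?_)
    · refine (Finset.inf'_le _ hb).trans ?_
      rw [hv b hb, ← hmb, hT0, zero_add]
    · rw [hv i hi]
      linarith [h0 i]
  have hcT : (T.card : ℝ) ≠ 0 := by simpa using hT.ne_empty
  have hcS : (S.card : ℝ) ≠ 0 := by simpa using hS.ne_empty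
  funext i
  rw [flipMap, key]
  by_cases hiS : i ∈ S
  · have : i ∉ T := Finset.disjoint_left.1 hST hiS
    simp only [flipMap, hiS, this, if_true, if_false]
    field_simp
    ring
  · by_cases hiT : i ∈ T <;> simp [flipMap, hiS, hiT]

/-- A bistellar flip does not change the homeomorphism type of the realization. -/
noncomputable def flipHomeomorph (hS : S.Nonempty) (hT : T.Nonempty) (hST : Disjoint S T)
    (h1 : ∀ F ∈ 𝓚, ¬ T ⊆ F) (h1' : ∀ F ∈ 𝓚', ¬ S ⊆ F)
    (h2 : ∀ F ∈ 𝓚, S ⊆ F → F ⊆ S ∪ T)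
    (h3 : ∀ a ∈ S, (S ∪ T).erase a ∈ 𝓚') (h3' : ∀ b ∈ T, (S ∪ T).erase b ∈ 𝓚)
    (h2' : ∀ F ∈ 𝓚', T ⊆ F → F ⊆ S ∪ T)
    (h4 : ∀ F ∈ 𝓚, ¬ S ⊆ F → F ∈ 𝓚') (h4' : ∀ F ∈ 𝓚', ¬ T ⊆ F → F ∈ 𝓚) :
    Realization 𝓚 ≃ₜ Realization 𝓚' where
  toFun y := ⟨flipMap S T hS y, flipMap_mem hS hT hST h2 h3 h4 y.2⟩
  invFun y := ⟨flipMap T S hT y, flipMap_mem hT hS hST.symm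
    (by simpa only [Finset.union_comm] using h2') (by simpa only [Finset.union_comm] using h3')
    h4' y.2⟩
  left_inv y := Subtype.ext (flipMap_flipMap hS hT hST h1 y.2)
  right_inv y := Subtype.ext (flipMap_flipMap hT hS hST.symm h1' y.2)
  continuous_toFun := ((continuous_flipMap hS).comp continuous_subtype_val).subtype_mk _
  continuous_invFun := ((continuous_flipMap hT).comp continuous_subtype_val).subtype_mk _

end Flip

/-! ### Complexes as lists of bit masks, and computable flips -/

/-- The set of vertices encoded by a bit mask. -/
def maskSet (N F : ℕ) : Finset (Fin N) := Finset.univ.filter fun i => F.testBit i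

/-- The family of simplices encoded by a list of bit masks. -/
def maskFamily (N : ℕ) (K : List ℕ) : Set (Finset (Fin N)) := {s | ∃ F ∈ K, maskSet N F = s}

/-- Inclusion of bit masks. -/
def maskLE (A F : ℕ) : Bool := Nat.beq (Nat.land A F) A

/-- The bits of a mask below `N`. -/
def maskBits (N A : ℕ) : List ℕ := (List.range N).filter A.testBit

/-- The vertices of the link of the face `A` in the complex `K`. -/
def linkMask (A : ℕ) : List ℕ → ℕ
  | [] => 0
  | F :: K => bif maskLE A F then Nat.lor (Nat.xor F A) (linkMask A K) else linkMask A K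

/-- The conditions under which `A * ∂B` can be replaced by `∂A * B` in `K`. -/
def flipOK (N : ℕ) (K : List ℕ) (A B : ℕ) : Bool :=
  !Nat.beq A 0 && !Nat.beq B 0 && Nat.blt A (2 ^ N) && Nat.blt B (2 ^ N) &&
  Nat.beq (Nat.land A B) 0 &&
  K.all (fun F => !maskLE B F && (!maskLE A F || maskLE F (Nat.lor A B))) &&
  (maskBits N B).all fun b => K.any fun F => Nat.beq F (Nat.xor (Nat.lor A B) (2 ^ b))

/-- The complex obtained from `K` by replacing `A * ∂B` by `∂A * B`. -/
def flipList (N : ℕ) (K : List ℕ) (A B : ℕ) : List ℕ :=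
  (maskBits N A).map (fun a => Nat.xor (Nat.lor A B) (2 ^ a)) ++ K.filter fun F => !maskLE A F

/-- Perform a sequence of bistellar flips, each given by the face that it removes. -/
def runFlips (N : ℕ) : List ℕ → List ℕ → Option (List ℕ)
  | K, [] => some K
  | K, A :: l =>
    bif flipOK N K A (linkMask A K) then runFlips N (flipList N K A (linkMask A K)) l else none


theorem mem_maskSet {N F : ℕ} {i : Fin N} : i ∈ maskSet N F ↔ F.testBit i = true := by
  simp [maskSet]

theorem maskLE_iff {A F : ℕ} : maskLE A F = true ↔ ∀ i, A.testBit i = true → F.testBit i = true := by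
  rw [maskLE, Nat.beq_eq]
  change A &&& F = A ↔ _
  constructor
  · intro h i hi
    rw [← h, Nat.testBit_and, Bool.and_eq_true] at hi
    exact hi.2
  · intro h
    refine Nat.eq_of_testBit_eq fun i => ?_
    rw [Nat.testBit_and]
    have := h i
    cases hA : A.testBit i <;> simp_all

theorem maskSet_subset_iff {N A F : ℕ} (hA : A < 2 ^ N) :
    maskSet N A ⊆ maskSet N F ↔ maskLE A F = true := by
  rw [maskLE_iff]
  constructor
  · intro h i hi
    have hiN : i < N := by
      by_contra hn
      rw [Nat.testBit_lt_two_pow (hA.trans_le (Nat.pow_le_pow_right two_pos (not_lt.1 hn)))] at hi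
      exact Bool.false_ne_true hi
    have hm : (⟨i, hiN⟩ : Fin N) ∈ maskSet N A := mem_maskSet.2 hi
    exact mem_maskSet.1 (h hm)
  · exact fun h i hi => mem_maskSet.2 (h i (mem_maskSet.1 hi))

theorem maskSet_lor (N A B : ℕ) : maskSet N (Nat.lor A B) = maskSet N A ∪ maskSet N B := by
  ext i
  rw [Finset.mem_union, mem_maskSet, mem_maskSet, mem_maskSet]
  change (A ||| B).testBit i = true ↔ _
  rw [Nat.testBit_or, Bool.or_eq_true]

theorem maskSet_xor_two_pow {N C : ℕ} {a : Fin N} (ha : a ∈ maskSet N C) :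
    maskSet N (Nat.xor C (2 ^ (a : ℕ))) = (maskSet N C).erase a := by
  ext i
  rw [Finset.mem_erase, mem_maskSet, mem_maskSet]
  change (C ^^^ 2 ^ (a : ℕ)).testBit i = true ↔ _
  rw [mem_maskSet] at ha
  rw [Nat.testBit_xor, Nat.testBit_two_pow]
  by_cases h : i = a
  · subst h; simp [ha]
  · have : (a : ℕ) ≠ i := fun h' => h (Fin.ext h'.symm)
    simp [h, this]

theorem maskSet_nonempty {N A : ℕ} (hA : A < 2 ^ N) (h0 : A ≠ 0) : (maskSet N A).Nonempty := by
  obtain ⟨i, hi⟩ := Nat.exists_testBit_of_ne_zero h0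
  have hiN : i < N := by
    by_contra hn
    rw [Nat.testBit_lt_two_pow (hA.trans_le (Nat.pow_le_pow_right two_pos (not_lt.1 hn)))] at hi
    exact Bool.false_ne_true hi
  exact ⟨⟨i, hiN⟩, mem_maskSet.2 hi⟩

theorem mem_maskBits {N A a : ℕ} : a ∈ maskBits N A ↔ a < N ∧ A.testBit a = true := by
  simp [maskBits]

/-- The Boolean test says that the link of `A` is the boundary of the simplex `B` and that `B` is
not yet a face. Looking only at generating simplices is enough, because the realization is defined
by them. -/
theorem nonempty_homeomorph_flipList {N : ℕ} {K : List ℕ} {A B : ℕ} (h : flipOK N K A B = true) :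
    Nonempty (Realization (maskFamily N K) ≃ₜ Realization (maskFamily N (flipList N K A B))) := by
  simp only [flipOK, Bool.and_eq_true, Bool.not_eq_true', List.all_eq_true, List.any_eq_true,
    Bool.or_eq_true, Nat.beq_eq, Nat.blt_eq] at h
  obtain ⟨⟨⟨⟨⟨⟨hA0, hB0⟩, hA⟩, hB⟩, hAB⟩, hK⟩, hBf⟩ := h
  have hA0' : A ≠ 0 := fun h => by simp [h] at hA0
  have hB0' : B ≠ 0 := fun h => by simp [h] at hB0
  have hC : Nat.lor A B < 2 ^ N := Nat.or_lt_two_pow hA hB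
  have hdisj : Disjoint (maskSet N A) (maskSet N B) := by
    rw [Finset.disjoint_left]
    intro i hi hj
    rw [mem_maskSet] at hi hj
    have : (A &&& B).testBit i = true := by rw [Nat.testBit_and, hi, hj]; rfl
    rw [show A &&& B = 0 from hAB] at this
    simp at this
  have hnew : ∀ a ∈ maskSet N A,
      (maskSet N A ∪ maskSet N B).erase a ∈ maskFamily N (flipList N K A B) := fun a ha => by
    refine ⟨Nat.xor (Nat.lor A B) (2 ^ (a : ℕ)), List.mem_append_left _ (List.mem_map.2
      ⟨a, mem_maskBits.2 ⟨a.2, mem_maskSet.1 ha⟩, rfl⟩), ?_⟩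
    rw [maskSet_xor_two_pow (by rw [maskSet_lor]; exact Finset.mem_union_left _ ha), maskSet_lor]
  have hcases : ∀ s ∈ maskFamily N (flipList N K A B),
      (∃ a ∈ maskSet N A, s = (maskSet N A ∪ maskSet N B).erase a) ∨
      (s ∈ maskFamily N K ∧ ¬ maskSet N A ⊆ s) := by
    rintro s ⟨F, hF, rfl⟩
    rcases List.mem_append.1 hF with hF | hF
    · obtain ⟨a, ha, rfl⟩ := List.mem_map.1 hF
      obtain ⟨haN, ha⟩ := mem_maskBits.1 ha
      have ha' : (⟨a, haN⟩ : Fin N) ∈ maskSet N A := mem_maskSet.2 ha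
      refine Or.inl ⟨⟨a, haN⟩, ha', ?_⟩
      rw [← maskSet_lor]
      exact maskSet_xor_two_pow (a := ⟨a, haN⟩)
        (by rw [maskSet_lor]; exact Finset.mem_union_left _ ha')
    · obtain ⟨hF1, hF2⟩ := List.mem_filter.1 hF
      refine Or.inr ⟨⟨F, hF1, rfl⟩, ?_⟩
      rw [maskSet_subset_iff hA]
      simpa using hF2
  refine ⟨flipHomeomorph (S := maskSet N A) (T := maskSet N B) (maskSet_nonempty hA hA0')
    (maskSet_nonempty hB hB0') hdisj ?_ ?_ ?_ hnew ?_ ?_ ?_ ?_⟩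
  · rintro _ ⟨F, hF, rfl⟩
    rw [maskSet_subset_iff hB, (hK F hF).1]
    exact Bool.false_ne_true
  · intro s hs
    rcases hcases s hs with ⟨a, ha, rfl⟩ | h
    · exact fun h => (Finset.mem_erase.1 (h ha)).1 rfl
    · exact h.2
  · rintro _ ⟨F, hF, rfl⟩ hAF
    have hlt : maskSet N F ⊆ maskSet N (Nat.lor A B) := by
      intro i hi
      rw [maskSet_subset_iff hA] at hAF
      have := (hK F hF).2
      rw [hAF] at this
      simp only [Bool.true_eq_false, false_or] at this
      exact mem_maskSet.2 (maskLE_iff.1 this i (mem_maskSet.1 hi))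
    rwa [maskSet_lor] at hlt
  · intro b hb
    obtain ⟨F, hF, hFb⟩ := hBf b (mem_maskBits.2 ⟨b.2, mem_maskSet.1 hb⟩)
    refine ⟨F, hF, ?_⟩
    rw [hFb, maskSet_xor_two_pow (by rw [maskSet_lor]; exact Finset.mem_union_right _ hb),
      maskSet_lor]
  · intro s hs
    rcases hcases s hs with ⟨a, ha, rfl⟩ | ⟨⟨F, hF, rfl⟩, h⟩
    · exact fun _ => Finset.erase_subset _ _
    · intro hBF
      rw [maskSet_subset_iff hB, (hK F hF).1] at hBF
      exact absurd hBF Bool.false_ne_true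
  · rintro _ ⟨F, hF, rfl⟩ h
    refine ⟨F, List.mem_append_right _ (List.mem_filter.2 ⟨hF, ?_⟩), rfl⟩
    rw [maskSet_subset_iff hA] at h
    simpa using h
  · intro s hs hBs
    rcases hcases s hs with ⟨a, ha, rfl⟩ | h
    · refine absurd (fun b hb => ?_) hBs
      exact Finset.mem_erase.2 ⟨fun h => Finset.disjoint_left.1 hdisj ha (h ▸ hb),
        Finset.mem_union_right _ hb⟩
    · exact h.1

/-- A flip is recorded by the removed face alone, since the link determines the inserted one. The
link must be nonempty, so no flip introduces a vertex. -/
theorem nonempty_homeomorph_of_runFlips {N : ℕ} (l : List ℕ) {K K' : List ℕ}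
    (h : runFlips N K l = some K') :
    Nonempty (Realization (maskFamily N K) ≃ₜ Realization (maskFamily N K')) := by
  induction l generalizing K with
  | nil =>
    obtain rfl : K = K' := by simpa [runFlips] using h
    exact ⟨Homeomorph.refl _⟩
  | cons A l ih =>
    rw [runFlips] at h
    cases hok : flipOK N K A (linkMask A K) with
    | false => rw [hok] at h; cases h
    | true =>
      rw [hok] at h
      obtain ⟨e⟩ := nonempty_homeomorph_flipList hok
      obtain ⟨e'⟩ := ih h
      exact ⟨e.trans e'⟩

/-! ### From bit masks to geometric simplicial complexes -/

/-- The number of vertices of the complex encoded by a list of bit masks. -/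
def maskVertexCount (N : ℕ) (K : List ℕ) : ℕ :=
  ((List.range N).filter fun i => K.any fun F => F.testBit i).length

section Geometric

variable {N : ℕ}

/-- The vertices of the standard simplex. -/
noncomputable def stdVertex (i : Fin N) : Euc N := EuclideanSpace.single i 1

theorem stdVertex_apply (i j : Fin N) : stdVertex i j = if j = i then 1 else 0 := by
  simp [stdVertex]

theorem stdVertex_injective : Function.Injective (stdVertex (N := N)) := fun i j h => by
  have := congrArg (fun v : Euc N => v i) h
  by_contra hne
  simp [stdVertex_apply, hne] at this

theorem affineIndependent_stdVertex : AffineIndependent ℝ (stdVertex (N := N)) := by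
  have := (EuclideanSpace.basisFun (Fin N) ℝ).toBasis.linearIndependent.affineIndependent
  rwa [show ⇑(EuclideanSpace.basisFun (Fin N) ℝ).toBasis = stdVertex from
    funext fun i => by simp [stdVertex]] at this

theorem mem_convexHull_stdVertex (G : Finset (Fin N)) (x : Euc N) :
    x ∈ convexHull ℝ (stdVertex '' (G : Set (Fin N))) ↔
      (∀ i, 0 ≤ x i) ∧ ∑ i, x i = 1 ∧ ∀ i, x i ≠ 0 → i ∈ G := by
  constructor
  · intro hx
    refine convexHull_min (t := {x : Euc N | (∀ i, 0 ≤ x i) ∧ ∑ i, x i = 1 ∧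
      ∀ i, x i ≠ 0 → i ∈ G}) ?_ ?_ hx
    · rintro _ ⟨j, hj, rfl⟩
      refine ⟨fun i => ?_, by simp [stdVertex_apply], fun i hi => ?_⟩
      · rw [stdVertex_apply]; split_ifs <;> norm_num
      · by_contra h
        rw [stdVertex_apply, if_neg (by rintro rfl; exact h hj)] at hi
        exact hi rfl
    · rintro x ⟨hx0, hx1, hx2⟩ y ⟨hy0, hy1, hy2⟩ a b ha hb hab
      refine ⟨fun i => ?_, ?_, fun i hi => ?_⟩
      · exact add_nonneg (mul_nonneg ha (hx0 i)) (mul_nonneg hb (hy0 i))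
      · simp [Finset.sum_add_distrib, ← Finset.mul_sum, hx1, hy1, hab]
      · by_contra h
        have h1 : x i = 0 := by_contra fun h' => h (hx2 i h')
        have h2 : y i = 0 := by_contra fun h' => h (hy2 i h')
        simp [h1, h2] at hi
  · rintro ⟨h0, h1, h2⟩
    have hs : ∑ i ∈ G, x i = 1 := by
      rw [← h1]
      exact Finset.sum_subset (Finset.subset_univ _) fun i _ hi => by_contra fun h => hi (h2 i h)
    have hx : x = ∑ i ∈ G, x i • stdVertex i := by
      ext j
      simp only [WithLp.ofLp_sum, WithLp.ofLp_smul, Finset.sum_apply, Pi.smul_apply, smul_eq_mul,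
        stdVertex_apply, mul_ite, mul_one, mul_zero, Finset.sum_ite_eq]
      split_ifs with h
      · rfl
      · exact by_contra fun h' => h (h2 j h')
    rw [hx]
    exact (convex_convexHull ℝ _).sum_mem (fun i _ => h0 i) hs
      fun i hi => subset_convexHull ℝ _ ⟨i, hi, rfl⟩

/-- The geometric simplicial complex encoded by a list of bit masks. -/
noncomputable def maskComplex (N : ℕ) (K : List ℕ) : Geometry.SimplicialComplex ℝ (Euc N) :=
  Geometry.SimplicialComplex.ofAffineIndependent
    { faces := {s | s.Nonempty ∧ ∃ F ∈ K, (s : Set (Euc N)) ⊆ stdVertex '' (maskSet N F : Set (Fin N))}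
      isRelLowerSet_faces := by
        rintro s ⟨hs, F, hF, hsF⟩
        exact ⟨hs, fun t hts ht => ⟨ht, F, hF, (Finset.coe_subset.2 hts).trans hsF⟩⟩ }
    (by
      refine affineIndependent_stdVertex.range.mono fun x hx => ?_
      simp only [Set.mem_iUnion, Finset.mem_coe] at hx
      obtain ⟨s, ⟨-, F, -, hs⟩, hx⟩ := hx
      obtain ⟨i, -, rfl⟩ := hs hx
      exact ⟨i, rfl⟩)

theorem mem_faces_maskComplex {K : List ℕ} {s : Finset (Euc N)} : s ∈ (maskComplex N K).faces ↔
    s.Nonempty ∧ ∃ F ∈ K, (s : Set (Euc N)) ⊆ stdVertex '' (maskSet N F : Set (Fin N)) := Iff.rfl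

theorem mem_space_maskComplex {K : List ℕ} (x : Euc N) :
    x ∈ (maskComplex N K).space ↔ x.ofLp ∈ Realization (maskFamily N K) := by
  rw [Geometry.SimplicialComplex.mem_space_iff]
  constructor
  · rintro ⟨s, hs, hx⟩
    obtain ⟨-, F, hF, hsF⟩ := mem_faces_maskComplex.1 hs
    obtain ⟨h0, h1, h2⟩ := (mem_convexHull_stdVertex _ x).1 (convexHull_mono hsF hx)
    exact ⟨h0, h1, _, ⟨F, hF, rfl⟩, h2⟩
  · rintro ⟨h0, h1, _, ⟨F, hF, rfl⟩, h2⟩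
    refine ⟨(maskSet N F).image stdVertex, ⟨?_, F, hF, by simp⟩, ?_⟩
    · rw [Finset.image_nonempty, Finset.nonempty_iff_ne_empty]
      intro he
      have : ∀ i, x i = 0 := fun i => by_contra fun h => by simpa [he] using h2 i h
      simp [this] at h1
    · rw [Finset.coe_image]
      exact (mem_convexHull_stdVertex _ x).2 ⟨h0, h1, h2⟩

theorem vertices_maskComplex (K : List ℕ) : (maskComplex N K).vertices =
    stdVertex '' ((Finset.univ.filter fun i : Fin N => (K.any fun F => F.testBit i) = true :
      Finset (Fin N)) : Set (Fin N)) := by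
  ext x
  rw [Geometry.SimplicialComplex.mem_vertices, mem_faces_maskComplex]
  simp only [Finset.coe_singleton, Set.singleton_subset_iff, Set.mem_image, Finset.mem_coe,
    mem_maskSet, Finset.mem_filter, Finset.mem_univ, true_and, List.any_eq_true]
  constructor
  · rintro ⟨-, F, hF, i, hi, rfl⟩
    exact ⟨i, ⟨F, hF, hi⟩, rfl⟩
  · rintro ⟨i, ⟨F, hF, hi⟩, rfl⟩
    exact ⟨Finset.singleton_nonempty _, F, hF, i, hi, rfl⟩

/-- Placing the labels at the standard basis vectors makes them affinely independent, so every
family of faces closed under passing to subsets is a geometric complex. Labels used by no facet are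
not vertices of it, which is why the count is not simply `N`. -/
theorem hasTriangulation_of_homeomorph_realization {X : Type*} [TopologicalSpace X] {K : List ℕ}
    (e : Realization (maskFamily N K) ≃ₜ X) : HasTriangulation X (maskVertexCount N K) := by
  refine ⟨N, maskComplex N K, ?_, ?_, ⟨?_⟩⟩
  · rw [vertices_maskComplex]
    exact (Finset.finite_toSet _).image _
  · rw [vertices_maskComplex, Set.ncard_image_of_injective _ stdVertex_injective,
      Set.ncard_coe_finset, maskVertexCount, ← List.toFinset_card_of_nodup
        ((List.nodup_range).filter _), ← Finset.card_map Fin.valEmbedding]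
    congr 1
    ext i
    simp only [Finset.mem_map, Finset.mem_filter, Finset.mem_univ, true_and,
      Fin.valEmbedding_apply, List.mem_toFinset, List.mem_filter, List.mem_range]
    constructor
    · rintro ⟨j, hj, rfl⟩
      exact ⟨j.2, hj⟩
    · rintro ⟨hi, h⟩
      exact ⟨⟨i, hi⟩, h, rfl⟩
  · refine Homeomorph.trans ?_ e
    exact Homeomorph.subtype (EuclideanSpace.equiv (Fin N) ℝ).toHomeomorph mem_space_maskComplex

end Geometric

theorem hasTriangulation_of_runFlips {N n : ℕ} {X : Type*} [TopologicalSpace X] {K : List ℕ}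
    (l : List ℕ) (e : Nonempty (Realization (maskFamily N K) ≃ₜ X))
    (h : (runFlips N K l).map (maskVertexCount N) = some n) : HasTriangulation X n := by
  obtain ⟨K', hK', rfl⟩ := Option.map_eq_some_iff.1 h
  obtain ⟨e'⟩ := nonempty_homeomorph_of_runFlips l hK'
  obtain ⟨e⟩ := e
  exact hasTriangulation_of_homeomorph_realization (e'.symm.trans e)


/-! ### Chain coordinates for the braid arrangement -/

/-- The coefficient of the set `S` when `a` is written, up to a constant vector, as a nonnegative
combination of indicator vectors of a chain of proper nonempty subsets. -/
noncomputable def chainCoord (a : Fin 4 → ℝ) (S : Finset (Fin 4)) : ℝ :=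
  if h : (S ×ˢ Sᶜ).Nonempty then max 0 ((S ×ˢ Sᶜ).inf' h fun p => a p.1 - a p.2) else 0

theorem continuous_chainCoord (S : Finset (Fin 4)) : Continuous fun a => chainCoord a S := by
  unfold chainCoord
  split_ifs with h
  · have := Continuous.finset_inf'_apply (f := fun (p : Fin 4 × Fin 4) (a : Fin 4 → ℝ) =>
      a p.1 - a p.2) h (fun i _ => by fun_prop)
    exact continuous_const.max this
  · exact continuous_const

theorem chainCoord_nonneg (a : Fin 4 → ℝ) (S : Finset (Fin 4)) : 0 ≤ chainCoord a S := by
  unfold chainCoord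
  split_ifs
  · exact le_max_left _ _
  · exact le_rfl

theorem chainCoord_le (a : Fin 4 → ℝ) {S : Finset (Fin 4)} {i j : Fin 4} (hi : i ∈ S) (hj : j ∉ S) :
    chainCoord a S ≤ max 0 (a i - a j) := by
  have hm : (i, j) ∈ S ×ˢ Sᶜ := Finset.mk_mem_product hi (Finset.mem_compl.2 hj)
  rw [chainCoord, dif_pos ⟨_, hm⟩]
  exact max_le_max le_rfl (Finset.inf'_le (fun p : Fin 4 × Fin 4 => a p.1 - a p.2) hm)

theorem chainCoord_eq (a : Fin 4 → ℝ) (S : Finset (Fin 4)) : chainCoord a S = 0 ∨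
    ∃ i ∈ S, ∃ j ∉ S, chainCoord a S = max 0 (a i - a j) := by
  rw [chainCoord]
  split_ifs with h
  · obtain ⟨p, hp, he⟩ := Finset.exists_mem_eq_inf' h fun p : Fin 4 × Fin 4 => a p.1 - a p.2
    rw [Finset.mem_product, Finset.mem_compl] at hp
    exact Or.inr ⟨p.1, hp.1, p.2, hp.2, by rw [he]⟩
  · exact Or.inl rfl

theorem exists_mem_notMem_of_chainCoord_ne_zero {a : Fin 4 → ℝ} {S : Finset (Fin 4)}
    (h : chainCoord a S ≠ 0) : (∃ i, i ∈ S) ∧ ∃ j, j ∉ S := by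
  rcases chainCoord_eq a S with h' | ⟨i, hi, j, hj, -⟩
  · exact absurd h' h
  · exact ⟨⟨i, hi⟩, ⟨j, hj⟩⟩

theorem lt_of_chainCoord_ne_zero {a : Fin 4 → ℝ} {S : Finset (Fin 4)} (h : chainCoord a S ≠ 0)
    {i j : Fin 4} (hi : i ∈ S) (hj : j ∉ S) : a j < a i := by
  have h1 := (chainCoord_nonneg a S).lt_of_ne' h
  have h2 := chainCoord_le a hi hj
  by_contra hn
  rw [max_eq_left (by linarith)] at h2
  linarith

/-- A one-sided comparison. Scaling, complementation and permutation of coordinates are invertible,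
so applying it both ways gives the corresponding equalities. The condition `hT` excludes the sets
for which the coordinate is zero by convention. -/
theorem chainCoord_le_mul {a b : Fin 4 → ℝ} {S T : Finset (Fin 4)} {t : ℝ} (ht : 0 ≤ t)
    (h : ∀ i ∈ S, ∀ j ∉ S, ∃ i' ∈ T, ∃ j' ∉ T, b i' - b j' = t * (a i - a j))
    (hT : (∃ i, i ∈ T) → (∃ j, j ∉ T) → (∃ i, i ∈ S) ∧ ∃ j, j ∉ S) :
    chainCoord b T ≤ t * chainCoord a S := by
  by_cases h0 : chainCoord b T = 0
  · rw [h0]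
    exact mul_nonneg ht (chainCoord_nonneg _ _)
  obtain ⟨hT1, hT2⟩ := exists_mem_notMem_of_chainCoord_ne_zero h0
  obtain ⟨⟨i, hi⟩, ⟨j, hj⟩⟩ := hT hT1 hT2
  have hne : (S ×ˢ Sᶜ).Nonempty := ⟨(i, j), Finset.mk_mem_product hi (Finset.mem_compl.2 hj)⟩
  obtain ⟨p, hp, he⟩ := Finset.exists_mem_eq_inf' hne fun p : Fin 4 × Fin 4 => a p.1 - a p.2
  rw [Finset.mem_product, Finset.mem_compl] at hp
  obtain ⟨i', hi', j', hj', hb⟩ := h p.1 hp.1 p.2 hp.2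
  rw [chainCoord.eq_def a S, dif_pos hne, he, mul_max_of_nonneg _ _ ht, mul_zero, ← hb]
  exact chainCoord_le b hi' hj'

theorem chainCoord_mul_add (a : Fin 4 → ℝ) (S : Finset (Fin 4)) {t : ℝ} (ht : 0 < t) (s : ℝ) :
    chainCoord (fun i => t * a i + s) S = t * chainCoord a S := by
  refine le_antisymm (chainCoord_le_mul ht.le (fun i hi j hj => ⟨i, hi, j, hj, by ring⟩)
    fun h1 h2 => ⟨h1, h2⟩) ?_
  have := chainCoord_le_mul (a := fun i => t * a i + s) (b := a) (S := S) (T := S) (t := t⁻¹)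
    (inv_nonneg.2 ht.le) (fun i hi j hj => ⟨i, hi, j, hj, by field_simp; ring⟩)
    fun h1 h2 => ⟨h1, h2⟩
  rwa [inv_mul_eq_div, le_div_iff₀' ht] at this

theorem chainCoord_neg_compl_le (a : Fin 4 → ℝ) (S : Finset (Fin 4)) :
    chainCoord (-a) Sᶜ ≤ chainCoord a S := by
  have := chainCoord_le_mul (a := a) (b := -a) (S := S) (T := Sᶜ) zero_le_one
    (fun i hi j hj => ⟨j, by simpa using hj, i, by simpa using hi, by simp; ring⟩)
    (fun h1 h2 => ⟨by simpa using h2, by simpa using h1⟩)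
  rwa [one_mul] at this

theorem chainCoord_neg_compl (a : Fin 4 → ℝ) (S : Finset (Fin 4)) :
    chainCoord (-a) Sᶜ = chainCoord a S := by
  refine le_antisymm (chainCoord_neg_compl_le a S) ?_
  simpa using chainCoord_neg_compl_le (-a) Sᶜ

theorem chainCoord_comp_le (a : Fin 4 → ℝ) (σ : Equiv.Perm (Fin 4)) (S : Finset (Fin 4)) :
    chainCoord (a ∘ σ) (S.map σ.symm.toEmbedding) ≤ chainCoord a S := by
  have := chainCoord_le_mul (a := a) (b := a ∘ σ) (S := S) (T := S.map σ.symm.toEmbedding)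
    zero_le_one
    (fun i hi j hj => ⟨σ.symm i, by simpa using hi, σ.symm j, by simpa using hj, by simp⟩)
    (by
      rintro ⟨i, hi⟩ ⟨j, hj⟩
      obtain ⟨i, hi, -⟩ := Finset.mem_map.1 hi
      exact ⟨⟨i, hi⟩, ⟨σ j, fun h => hj (Finset.mem_map.2 ⟨σ j, h, by simp⟩)⟩⟩)
  rwa [one_mul] at this

theorem chainCoord_comp (a : Fin 4 → ℝ) (σ : Equiv.Perm (Fin 4)) (S : Finset (Fin 4)) :
    chainCoord (a ∘ σ) (S.map σ.symm.toEmbedding) = chainCoord a S := by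
  refine le_antisymm (chainCoord_comp_le a σ S) ?_
  have := chainCoord_comp_le (a ∘ σ) σ.symm (S.map σ.symm.toEmbedding)
  have h2 : (S.map σ.symm.toEmbedding).map σ.symm.symm.toEmbedding = S := by
    ext i; simp
  rwa [h2, Function.comp_assoc, Equiv.self_comp_symm, Function.comp_id] at this

/-- The initial segments of the ordering `σ 0, σ 1, σ 2, σ 3`. -/
def seg (σ : Equiv.Perm (Fin 4)) (k : Fin 3) : Finset (Fin 4) :=
  Finset.univ.filter fun i => σ.symm i ≤ k.castSucc

theorem mem_seg {σ : Equiv.Perm (Fin 4)} {k : Fin 3} {l : Fin 4} :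
    σ l ∈ seg σ k ↔ l ≤ k.castSucc := by
  simp [seg]

theorem seg_injective (σ : Equiv.Perm (Fin 4)) : Function.Injective (seg σ) := by
  intro k l h
  have h1 := mem_seg (σ := σ) (k := k) (l := k.castSucc)
  have h2 := mem_seg (σ := σ) (k := l) (l := l.castSucc)
  rw [h] at h1
  rw [← h] at h2
  rw [mem_seg] at h1 h2
  simp only [le_refl, iff_true, Fin.castSucc_le_castSucc_iff] at h1 h2
  exact le_antisymm h1 h2

/-- A finite check over all orderings and subsets: a proper nonempty set that precedes its
complement is an initial segment. -/
theorem exists_eq_seg : ∀ (σ : Equiv.Perm (Fin 4)) (S : Finset (Fin 4)), (∃ i, i ∈ S) →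
    (∃ j, j ∉ S) → (∀ i ∈ S, ∀ j ∉ S, σ.symm i ≤ σ.symm j) → ∃ k, S = seg σ k := by
  decide +kernel

theorem exists_antitone_comp (a : Fin 4 → ℝ) : ∃ σ : Equiv.Perm (Fin 4), Antitone (a ∘ σ) :=
  ⟨Tuple.sort (-a), fun _ _ h => neg_le_neg_iff.1 (Tuple.monotone_sort (-a) h)⟩

/-- Among the pairs across the cut, the smallest difference is attained at the two neighbours of the
cut. -/
theorem chainCoord_seg {a : Fin 4 → ℝ} {σ : Equiv.Perm (Fin 4)} (h : Antitone (a ∘ σ)) (k : Fin 3) :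
    chainCoord a (seg σ k) = a (σ k.castSucc) - a (σ k.succ) := by
  have hk : a (σ k.succ) ≤ a (σ k.castSucc) := h (Fin.castSucc_lt_succ).le
  have hi : σ k.castSucc ∈ seg σ k := mem_seg.2 le_rfl
  have hj : σ k.succ ∉ seg σ k := fun h => absurd (mem_seg.1 h) (not_le.2 Fin.castSucc_lt_succ)
  refine le_antisymm ?_ ?_
  · have := chainCoord_le a hi hj
    rwa [max_eq_right (sub_nonneg.2 hk)] at this
  · have hne : (seg σ k ×ˢ (seg σ k)ᶜ).Nonempty :=
      ⟨_, Finset.mk_mem_product hi (Finset.mem_compl.2 hj)⟩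
    rw [chainCoord, dif_pos hne]
    refine le_max_of_le_right (Finset.le_inf' _ _ fun p hp => ?_)
    rw [Finset.mem_product, Finset.mem_compl] at hp
    obtain ⟨j, hj⟩ : ∃ j, σ j = p.2 := σ.surjective _
    obtain ⟨i, hi⟩ : ∃ i, σ i = p.1 := σ.surjective _
    rw [← hj, ← hi, mem_seg, mem_seg, not_le] at hp
    rw [← hj, ← hi]
    have h1 : a (σ k.castSucc) ≤ a (σ i) := h hp.1
    have h2 : a (σ j) ≤ a (σ k.succ) := h (Fin.castSucc_lt_iff_succ_le.1 hp.2)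
    linarith

/-- A nonzero coordinate forces `a` to be strictly larger on `S` than off it, so any decreasing
ordering of `a` lists `S` first. The support is therefore a chain. -/
theorem exists_eq_seg_of_chainCoord_ne_zero {a : Fin 4 → ℝ} {σ : Equiv.Perm (Fin 4)}
    (h : Antitone (a ∘ σ)) {S : Finset (Fin 4)} (hS : chainCoord a S ≠ 0) : ∃ k, S = seg σ k := by
  obtain ⟨h1, h2⟩ := exists_mem_notMem_of_chainCoord_ne_zero hS
  refine exists_eq_seg σ S h1 h2 fun i hi j hj => ?_
  by_contra hn
  have := h (not_le.1 hn).le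
  simp only [Function.comp_apply, Equiv.apply_symm_apply] at this
  exact absurd (lt_of_chainCoord_ne_zero hS hi hj) (not_lt.2 this)

theorem sum_mul_of_support_seg {σ : Equiv.Perm (Fin 4)} {w : Finset (Fin 4) → ℝ}
    (h : ∀ S, w S ≠ 0 → ∃ k, S = seg σ k) (g : Finset (Fin 4) → ℝ) :
    ∑ S, w S * g S = ∑ k, w (seg σ k) * g (seg σ k) := by
  rw [← Finset.sum_image (f := fun S => w S * g S) (g := seg σ)
    (fun k _ l _ hkl => seg_injective σ hkl)]
  refine (Finset.sum_subset (Finset.subset_univ _) fun S _ hS => ?_).symm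
  have : w S = 0 := by
    by_contra hne
    obtain ⟨k, rfl⟩ := h S hne
    exact hS (Finset.mem_image_of_mem _ (Finset.mem_univ _))
  rw [this, zero_mul]

theorem sum_chainCoord_mul {a : Fin 4 → ℝ} {σ : Equiv.Perm (Fin 4)} (h : Antitone (a ∘ σ))
    (g : Finset (Fin 4) → ℝ) : ∑ S, chainCoord a S * g S =
      (a (σ 0) - a (σ 1)) * g (seg σ 0) + (a (σ 1) - a (σ 2)) * g (seg σ 1) +
      (a (σ 2) - a (σ 3)) * g (seg σ 2) := by
  rw [sum_mul_of_support_seg (fun S hS => exists_eq_seg_of_chainCoord_ne_zero h hS),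
    Fin.sum_univ_three, chainCoord_seg h, chainCoord_seg h, chainCoord_seg h]
  rfl

/-- The sum of the chain coordinates. -/
noncomputable def chainSum (a : Fin 4 → ℝ) : ℝ := ∑ S, chainCoord a S

/-- Summation by parts: the consecutive gaps from position `i` downwards telescope, and `s` is the
smallest value of `a`. -/
theorem sum_chainCoord_mem (a : Fin 4 → ℝ) : ∃ s, ∀ i,
    ∑ S, chainCoord a S * (if i ∈ S then 1 else 0) = a i - s := by
  obtain ⟨σ, h⟩ := exists_antitone_comp a
  refine ⟨a (σ 3), fun i => ?_⟩
  obtain ⟨i, rfl⟩ := σ.surjective i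
  rw [sum_chainCoord_mul h]
  simp only [mem_seg]
  fin_cases i <;> simp +decide

/-- The segments separating `i` from `j` are those cut between them, and their gaps telescope. The
separation condition does not distinguish a set from its complement, so this identity survives the
antipodal identification. -/
theorem sum_chainCoord_sep (a : Fin 4 → ℝ) (i j : Fin 4) :
    ∑ S, chainCoord a S * (if (i ∈ S ↔ j ∈ S) then 0 else 1) = |a i - a j| := by
  obtain ⟨σ, h⟩ := exists_antitone_comp a
  obtain ⟨i, rfl⟩ := σ.surjective i
  obtain ⟨j, rfl⟩ := σ.surjective j
  rw [sum_chainCoord_mul h]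
  simp only [mem_seg]
  have h01 : a (σ 1) ≤ a (σ 0) := h (by decide)
  have h12 : a (σ 2) ≤ a (σ 1) := h (by decide)
  have h23 : a (σ 3) ≤ a (σ 2) := h (by decide)
  rcases le_total i j with hij | hij
  · rw [abs_of_nonneg (sub_nonneg.2 (show a (σ j) ≤ a (σ i) from h hij))]
    fin_cases i <;> fin_cases j <;> simp +decide at hij ⊢
  · rw [abs_of_nonpos (sub_nonpos.2 (show a (σ i) ≤ a (σ j) from h hij))]
    fin_cases i <;> fin_cases j <;> simp +decide at hij ⊢

theorem chainSum_pos {a : Fin 4 → ℝ} {i j : Fin 4} (h : a i ≠ a j) : 0 < chainSum a := by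
  refine (Finset.sum_nonneg fun S _ => chainCoord_nonneg a S).lt_of_ne' fun h0 => h ?_
  have h1 := (Finset.sum_eq_zero_iff_of_nonneg fun S _ => chainCoord_nonneg a S).1 h0
  have := sum_chainCoord_sep a i j
  rw [Finset.sum_eq_zero fun S hS => by rw [h1 S hS, zero_mul]] at this
  exact sub_eq_zero.1 (abs_eq_zero.1 this.symm)

/-- Nonnegative weights on a chain add up to a function that decreases along the chain, and its
consecutive gaps return the weights. This is the surjectivity half of the coordinates. -/
theorem chainCoord_of_weights {σ : Equiv.Perm (Fin 4)} {w : Finset (Fin 4) → ℝ} (h0 : ∀ S, 0 ≤ w S)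
    (h : ∀ S, w S ≠ 0 → ∃ k, S = seg σ k) :
    chainCoord (fun i => ∑ S, w S * if i ∈ S then 1 else 0) = w := by
  set a : Fin 4 → ℝ := fun i => ∑ S, w S * if i ∈ S then 1 else 0 with ha
  have hv : ∀ l, a (σ l) = ∑ k, w (seg σ k) * if l ≤ k.castSucc then 1 else 0 := fun l => by
    rw [ha]
    simp only
    rw [sum_mul_of_support_seg h]
    simp only [mem_seg]
  have hanti : Antitone (a ∘ σ) := by
    intro l m hlm
    simp only [Function.comp_apply, hv]
    refine Finset.sum_le_sum fun k _ => mul_le_mul_of_nonneg_left ?_ (h0 _)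
    split_ifs with h1 h2
    · exact le_rfl
    · exact absurd (hlm.trans h1) h2
    · exact zero_le_one
    · exact le_rfl
  funext S
  by_cases hS : ∃ k, S = seg σ k
  · obtain ⟨k, rfl⟩ := hS
    rw [chainCoord_seg hanti, hv, hv, Fin.sum_univ_three, Fin.sum_univ_three]
    fin_cases k <;> simp +decide
  · rw [by_contra fun hne => hS (h S hne)]
    exact by_contra fun hne => hS (exists_eq_seg_of_chainCoord_ne_zero hanti hne)


/-! ### The triangulated sphere and its symmetries -/

/-- Four linear functionals on `ℝ³` whose differences separate points. -/
noncomputable def fourCoord (x : Euc 3) : Fin 4 → ℝ := ![x 0, -x 0, x 1, x 2]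

theorem fourCoord_neg (x : Euc 3) : fourCoord (-x) = -fourCoord x := by
  funext i
  fin_cases i <;> simp [fourCoord]

theorem fourCoord_smul (t : ℝ) (x : Euc 3) : fourCoord (t • x) = fun i => t * fourCoord x i + 0 := by
  funext i
  fin_cases i <;> simp [fourCoord]

theorem continuous_fourCoord : Continuous fourCoord := by
  refine continuous_pi fun i => ?_
  fin_cases i <;> simp [fourCoord] <;> fun_prop

theorem exists_fourCoord_ne {x : Euc 3} (hx : x ≠ 0) : ∃ i j, fourCoord x i ≠ fourCoord x j := by
  by_contra! h
  have h1 := h 0 1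
  have h2 := h 2 0
  have h3 := h 3 0
  simp only [fourCoord, Matrix.cons_val] at h1 h2 h3
  have h0 : x 0 = 0 := by linarith
  refine hx ?_
  ext i
  fin_cases i
  · exact h0
  · exact h2.trans h0
  · exact h3.trans h0

theorem chainSum_fourCoord_pos {x : Euc 3} (hx : x ≠ 0) : 0 < chainSum (fourCoord x) := by
  obtain ⟨i, j, h⟩ := exists_fourCoord_ne hx
  exact chainSum_pos h

theorem chainCoord_fourCoord_smul {t : ℝ} (ht : 0 < t) (x : Euc 3) (S : Finset (Fin 4)) :
    chainCoord (fourCoord (t • x)) S = t * chainCoord (fourCoord x) S := by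
  rw [fourCoord_smul, chainCoord_mul_add _ _ ht]

/-- Barycentric coordinates on the sphere for the triangulation by the braid arrangement. -/
noncomputable def sphereCoord (x : StdSphere 2) (S : Finset (Fin 4)) : ℝ :=
  chainCoord (fourCoord x) S / chainSum (fourCoord x)

theorem continuous_sphereCoord (S : Finset (Fin 4)) : Continuous fun x => sphereCoord x S := by
  have h : Continuous fun x : StdSphere 2 => fourCoord x :=
    continuous_fourCoord.comp continuous_subtype_val
  refine ((continuous_chainCoord S).comp h).div ?_ fun x =>
    (chainSum_fourCoord_pos (ne_zero_of_mem_unit_sphere x)).ne'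
  exact continuous_finsetSum _ fun T _ => (continuous_chainCoord T).comp h

theorem sphereCoord_nonneg (x : StdSphere 2) (S : Finset (Fin 4)) : 0 ≤ sphereCoord x S :=
  div_nonneg (chainCoord_nonneg _ _) (chainSum_fourCoord_pos (ne_zero_of_mem_unit_sphere x)).le

theorem sum_sphereCoord (x : StdSphere 2) : ∑ S, sphereCoord x S = 1 := by
  simp only [sphereCoord]
  rw [← Finset.sum_div]
  exact div_self (chainSum_fourCoord_pos (ne_zero_of_mem_unit_sphere x)).ne'

theorem exists_seg_of_sphereCoord (x : StdSphere 2) :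
    ∃ σ, ∀ S, sphereCoord x S ≠ 0 → ∃ k, S = seg σ k := by
  obtain ⟨σ, h⟩ := exists_antitone_comp (fourCoord x)
  refine ⟨σ, fun S hS => exists_eq_seg_of_chainCoord_ne_zero h fun h0 => hS ?_⟩
  rw [sphereCoord, h0, zero_div]

/-- Otherwise the functionals would be strictly larger on `S` than on its complement, and
conversely. -/
theorem sphereCoord_compl_eq_zero {x : StdSphere 2} {S : Finset (Fin 4)} (h : sphereCoord x S ≠ 0) :
    sphereCoord x Sᶜ = 0 := by
  by_contra h'
  have h1 : chainCoord (fourCoord x) S ≠ 0 := fun h0 => h (by rw [sphereCoord, h0, zero_div])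
  have h2 : chainCoord (fourCoord x) Sᶜ ≠ 0 := fun h0 => h' (by rw [sphereCoord, h0, zero_div])
  obtain ⟨⟨i, hi⟩, ⟨j, hj⟩⟩ := exists_mem_notMem_of_chainCoord_ne_zero h1
  exact lt_asymm (lt_of_chainCoord_ne_zero h1 hi hj) (lt_of_chainCoord_ne_zero h2
    (Finset.mem_compl.2 hj) (fun h => Finset.mem_compl.1 h hi))

theorem sum_compl (f : Finset (Fin 4) → ℝ) : ∑ S, f Sᶜ = ∑ S, f S :=
  Equiv.sum_comp (⟨compl, compl, compl_compl, compl_compl⟩ : Equiv.Perm (Finset (Fin 4))) f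

/-- Negation reverses the order of the four functionals, so initial segments turn into complements.
-/
theorem sphereCoord_neg (x : StdSphere 2) (S : Finset (Fin 4)) :
    sphereCoord (-x) S = sphereCoord x Sᶜ := by
  have h : ∀ T, chainCoord (fourCoord ((-x : StdSphere 2) : Euc 3)) T =
      chainCoord (fourCoord x) Tᶜ := fun T => by
    rw [show ((-x : StdSphere 2) : Euc 3) = -(x : Euc 3) from rfl, fourCoord_neg,
      ← chainCoord_neg_compl _ Tᶜ, compl_compl]
  simp only [sphereCoord, chainSum, h]
  rw [sum_compl]

/-- The exchange of the first two elements. -/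
def swapSet (S : Finset (Fin 4)) : Finset (Fin 4) :=
  S.map (Equiv.swap 0 1 : Equiv.Perm (Fin 4)).symm.toEmbedding

theorem swapSet_swapSet (S : Finset (Fin 4)) : swapSet (swapSet S) = S := by
  revert S; decide

theorem sum_swapSet (f : Finset (Fin 4) → ℝ) : ∑ S, f (swapSet S) = ∑ S, f S :=
  Equiv.sum_comp (⟨swapSet, swapSet, swapSet_swapSet, swapSet_swapSet⟩ :
    Equiv.Perm (Finset (Fin 4))) f

theorem reflectionR3_apply (x : Euc 3) :
    reflectionR3 x = WithLp.toLp 2 ![-x 0, x 1, x 2] := by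
  have h1 : ‖(EuclideanSpace.single 0 1 : Euc 3)‖ = 1 := by simp
  rw [reflectionR3, Submodule.reflection_orthogonal_apply, Submodule.reflection_singleton_apply]
  ext i
  fin_cases i <;> simp [EuclideanSpace.inner_single_left]
  ring_nf

theorem fourCoord_reflectionR3 (x : Euc 3) :
    fourCoord (reflectionR3 x) = fourCoord x ∘ (Equiv.swap 0 1 : Equiv.Perm (Fin 4)) := by
  rw [reflectionR3_apply]
  funext i
  fin_cases i
  · simp [fourCoord]
  · simp [fourCoord]
  · simp [fourCoord, Equiv.swap_apply_of_ne_of_ne]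
  · simp [fourCoord, Equiv.swap_apply_of_ne_of_ne]

/-- The reflection exchanges `x 0` and `-x 0`. Both occur among the four functionals precisely so
that it acts by a transposition. -/
theorem sphereCoord_reflection (x : StdSphere 2) (S : Finset (Fin 4)) :
    sphereCoord (sphereMap reflectionR3 x) S = sphereCoord x (swapSet S) := by
  have h : ∀ T, chainCoord (fourCoord ((sphereMap reflectionR3 x : StdSphere 2) : Euc 3)) T =
      chainCoord (fourCoord x) (swapSet T) := fun T => by
    rw [show ((sphereMap reflectionR3 x : StdSphere 2) : Euc 3) = reflectionR3 x from rfl,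
      fourCoord_reflectionR3, ← chainCoord_comp (fourCoord x) (Equiv.swap 0 1) (swapSet T)]
    congr 1
    exact (swapSet_swapSet T).symm
  simp only [sphereCoord, chainSum, h]
  rw [sum_swapSet (chainCoord (fourCoord x))]

theorem eq_of_smul_eq_smul {x y : StdSphere 2} {s t : ℝ} (hs : 0 < s) (ht : 0 < t)
    (h : s • (x : Euc 3) = t • (y : Euc 3)) : x = y := by
  have hn := congrArg norm h
  simp only [norm_smul, norm_eq_of_mem_sphere, Real.norm_eq_abs, abs_of_pos hs, abs_of_pos ht,
    mul_one] at hn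
  subst hn
  exact Subtype.ext (smul_right_injective _ hs.ne' h)

/-- The coordinates return the four functionals up to a common shift and a positive factor. The
opposite functionals `x 0` and `-x 0` fix the shift, and the unit norm fixes the factor. -/
theorem sphereCoord_injective : Function.Injective sphereCoord := by
  intro x y h
  have hx := chainSum_fourCoord_pos (ne_zero_of_mem_unit_sphere x)
  have hy := chainSum_fourCoord_pos (ne_zero_of_mem_unit_sphere y)
  obtain ⟨s, hs⟩ := sum_chainCoord_mem (fourCoord x)
  obtain ⟨t, ht⟩ := sum_chainCoord_mem (fourCoord y)
  have key : ∀ i, (fourCoord x i - s) / chainSum (fourCoord x) =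
      (fourCoord y i - t) / chainSum (fourCoord y) := fun i => by
    rw [← hs, ← ht, Finset.sum_div, Finset.sum_div]
    refine Finset.sum_congr rfl fun S _ => ?_
    have := congrFun h S
    simp only [sphereCoord] at this
    rw [mul_div_right_comm, this, mul_div_right_comm]
  generalize chainSum (fourCoord x) = D at *
  generalize chainSum (fourCoord y) = E at *
  refine eq_of_smul_eq_smul (inv_pos.2 hx) (inv_pos.2 hy) ?_
  have k0 := key 0
  have k1 := key 1
  have k2 := key 2
  have k3 := key 3
  simp only [fourCoord, Matrix.cons_val, div_eq_inv_mul] at k0 k1 k2 k3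
  ext i
  fin_cases i <;> simp <;> linarith

/-- By `sum_chainCoord_sep` the symmetrized coordinates determine the absolute differences of the
functionals up to a positive factor. Their squares determine all products of two coordinates, hence
the vector up to sign. -/
theorem eq_or_eq_neg_of_sphereCoord_add {x y : StdSphere 2}
    (h : ∀ S, sphereCoord x S + sphereCoord x Sᶜ = sphereCoord y S + sphereCoord y Sᶜ) :
    x = y ∨ x = -y := by
  have hx := chainSum_fourCoord_pos (ne_zero_of_mem_unit_sphere x)
  have hy := chainSum_fourCoord_pos (ne_zero_of_mem_unit_sphere y)
  have hsep : ∀ (z : StdSphere 2) (i j : Fin 4),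
      |fourCoord z i - fourCoord z j| / chainSum (fourCoord z) = 2⁻¹ * ∑ S,
        (sphereCoord z S + sphereCoord z Sᶜ) * (if (i ∈ S ↔ j ∈ S) then 0 else 1) := by
    intro z i j
    have h1 : ∑ S, sphereCoord z Sᶜ * (if (i ∈ S ↔ j ∈ S) then (0 : ℝ) else 1) =
        ∑ S, sphereCoord z S * (if (i ∈ S ↔ j ∈ S) then 0 else 1) := by
      rw [← sum_compl]
      refine Finset.sum_congr rfl fun S _ => ?_
      rw [compl_compl]
      simp only [Finset.mem_compl, not_iff_not]
    simp only [add_mul, Finset.sum_add_distrib]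
    rw [h1, ← two_mul, inv_mul_cancel_left₀ two_ne_zero, ← sum_chainCoord_sep, Finset.sum_div]
    exact Finset.sum_congr rfl fun S _ => by rw [sphereCoord, mul_div_right_comm]
  have key : ∀ i j, |fourCoord x i - fourCoord x j| / chainSum (fourCoord x) =
      |fourCoord y i - fourCoord y j| / chainSum (fourCoord y) := fun i j => by
    rw [hsep, hsep]
    simp only [h]
  generalize chainSum (fourCoord x) = D at *
  generalize chainSum (fourCoord y) = E at *
  have key2 : ∀ i j, (D⁻¹ * fourCoord x i - D⁻¹ * fourCoord x j) ^ 2 =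
      (E⁻¹ * fourCoord y i - E⁻¹ * fourCoord y j) ^ 2 := fun i j => by
    have := congrArg (· ^ 2) (key i j)
    simp only [div_pow, sq_abs] at this
    rw [← mul_sub, ← mul_sub, mul_pow, mul_pow, inv_pow, inv_pow, ← div_eq_inv_mul,
      ← div_eq_inv_mul, this]
  set u : Euc 3 := D⁻¹ • (x : Euc 3) with hu
  set v : Euc 3 := E⁻¹ • (y : Euc 3) with hv
  -- Polarization: with the values `u 0, -u 0, u 1, u 2`, the six squared differences are
  -- independent linear combinations of the six products, so the products follow linearly.
  have hprod : ∀ i j, u i * u j = v i * v j := by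
    have k01 := key2 0 1
    have k02 := key2 0 2
    have k12 := key2 1 2
    have k03 := key2 0 3
    have k13 := key2 1 3
    have k23 := key2 2 3
    simp only [fourCoord, Matrix.cons_val] at k01 k02 k12 k03 k13 k23
    have e : ∀ i, u i = D⁻¹ * (x : Euc 3) i := fun i => rfl
    have e' : ∀ i, v i = E⁻¹ * (y : Euc 3) i := fun i => rfl
    simp only [mul_neg, ← e, ← e'] at k01 k02 k12 k03 k13 k23
    intro i j
    fin_cases i <;> fin_cases j <;> simp only [Fin.zero_eta, Fin.mk_one, Fin.reduceFinMk] <;>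
      linarith
  have hu0 : u ≠ 0 := smul_ne_zero (inv_ne_zero hx.ne') (ne_zero_of_mem_unit_sphere x)
  obtain ⟨i, hi⟩ : ∃ i, u i ≠ 0 := by
    by_contra! hn
    exact hu0 (by ext i; exact hn i)
  rcases mul_self_eq_mul_self_iff.1 (hprod i i) with h1 | h1
  · left
    refine eq_of_smul_eq_smul (inv_pos.2 hx) (inv_pos.2 hy) ?_
    rw [← hu, ← hv]
    ext j
    have := hprod i j
    rw [← h1] at this
    exact mul_left_cancel₀ hi this
  · right
    refine eq_of_smul_eq_smul (inv_pos.2 hx) (inv_pos.2 hy) ?_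
    rw [← hu, show ((-y : StdSphere 2) : Euc 3) = -(y : Euc 3) from rfl, smul_neg, ← hv]
    ext j
    have := hprod i j
    rw [show v i = - u i by linarith, neg_mul, ← mul_neg] at this
    exact mul_left_cancel₀ hi this

theorem exists_sphereCoord_eq {σ : Equiv.Perm (Fin 4)} {w : Finset (Fin 4) → ℝ} (h0 : ∀ S, 0 ≤ w S)
    (h1 : ∑ S, w S = 1) (h : ∀ S, w S ≠ 0 → ∃ k, S = seg σ k) : ∃ x, sphereCoord x = w := by
  have hw := chainCoord_of_weights h0 h
  set a : Fin 4 → ℝ := fun i => ∑ S, w S * if i ∈ S then 1 else 0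
  -- Subtracting `(a 0 + a 1) / 2` from `a` makes its first two entries opposite, as the values of
  -- `fourCoord` must be; the shift does not affect chain coordinates.
  set x : Euc 3 := WithLp.toLp 2
    ![(a 0 - a 1) / 2, a 2 - (a 0 + a 1) / 2, a 3 - (a 0 + a 1) / 2] with hxdef
  have hx : fourCoord x = fun i => 1 * a i + -((a 0 + a 1) / 2) := by
    funext i
    fin_cases i <;> simp [fourCoord, x] <;> ring
  have hc : chainCoord (fourCoord x) = w := by
    funext S
    rw [hx, chainCoord_mul_add _ _ one_pos, hw, one_mul]
  have hx0 : x ≠ 0 := by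
    intro h0
    have : chainSum (fourCoord x) = 0 := by
      -- Were `x` zero, doubling it would change nothing, so homogeneity would annihilate the
      -- coordinates, whose sum is one.
      have h2 : fourCoord x = fun i => 2 * fourCoord x i + 0 := by
        rw [← fourCoord_smul, h0, smul_zero]
      have h3 : ∀ S, chainCoord (fourCoord x) S = 0 := fun S => by
        have := chainCoord_mul_add (fourCoord x) S two_pos 0
        rw [← h2] at this
        linarith
      exact Finset.sum_eq_zero fun S _ => h3 S
    rw [chainSum, hc, h1] at this
    exact one_ne_zero this
  have hn : 0 < ‖x‖⁻¹ := inv_pos.2 (norm_pos_iff.2 hx0)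
  refine ⟨⟨‖x‖⁻¹ • x, by simp [norm_smul, hx0]⟩, funext fun S => ?_⟩
  simp only [sphereCoord, chainSum, chainCoord_fourCoord_smul hn, hc]
  rw [← Finset.mul_sum, h1, mul_one, mul_comm, mul_div_assoc, div_self hn.ne', mul_one]


/-! ### Staircase triangulation of the product with an interval -/

/-- The order in which the vertices of a layer are listed. -/
def vertexRank (S : ℕ) : ℕ := min S (15 - S)

/-- Maximal chains of proper nonempty subsets of a set with four elements, sorted by rank. -/
def flagTriples : List (ℕ × ℕ × ℕ) :=
  (List.range 15).flatMap fun a => (List.range 15).flatMap fun b => (List.range 15).filterMap fun c =>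
    if 1 ≤ a ∧ 1 ≤ b ∧ 1 ≤ c ∧ vertexRank a < vertexRank b ∧ vertexRank b < vertexRank c ∧
      (maskLE a b || maskLE b a) ∧ (maskLE a c || maskLE c a) ∧ (maskLE b c || maskLE c b)
    then some (a, b, c) else none

/-- The staircase triangulation with `m` layers and vertices identified by `q`. -/
def staircase (m : ℕ) (q : ℕ → ℕ → ℕ) : List ℕ :=
  (List.range m).flatMap fun j => flagTriples.flatMap fun t =>
    [Nat.lor (Nat.lor (2 ^ q j t.1) (2 ^ q (j + 1) t.1))
      (Nat.lor (2 ^ q (j + 1) t.2.1) (2 ^ q (j + 1) t.2.2)),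
     Nat.lor (Nat.lor (2 ^ q j t.1) (2 ^ q j t.2.1))
      (Nat.lor (2 ^ q (j + 1) t.2.1) (2 ^ q (j + 1) t.2.2)),
     Nat.lor (Nat.lor (2 ^ q j t.1) (2 ^ q j t.2.1))
      (Nat.lor (2 ^ q j t.2.2) (2 ^ q (j + 1) t.2.2))]

/-- The bit mask of a subset of `Fin 4`. -/
def setMask (S : Finset (Fin 4)) : ℕ := ∑ i ∈ S, 2 ^ (i : ℕ)

/-- The rank of a vertex, which is the same for complementary sets. -/
def setRank (S : Finset (Fin 4)) : ℕ := vertexRank (setMask S)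

theorem setMask_lt (S : Finset (Fin 4)) : setMask S < 16 := by
  revert S; decide

theorem setMask_injective : Function.Injective setMask := by
  unfold Function.Injective; decide

/-- The mask of the complement is `15 - S`. Ordering vertices by rank rather than by cardinality
makes the staircases invariant under the antipodal map, while a chain still has distinct ranks
because it never contains a complementary pair. -/
theorem setRank_compl (S : Finset (Fin 4)) : setRank Sᶜ = setRank S := by
  revert S; decide

theorem setRank_eq_iff {S T : Finset (Fin 4)} : setRank S = setRank T ↔ S = T ∨ S = Tᶜ := by
  revert S T; decide

theorem exists_flagTriple (σ : Equiv.Perm (Fin 4)) : ∃ t ∈ flagTriples, ∀ k,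
    setMask (seg σ k) = t.1 ∨ setMask (seg σ k) = t.2.1 ∨ setMask (seg σ k) = t.2.2 := by
  revert σ; decide +kernel

/-- Three sets of increasing rank that are the initial segments of an ordering. -/
structure IsFlag (t : ℕ × ℕ × ℕ) (a b c : Finset (Fin 4)) : Prop where
  fst : setMask a = t.1
  snd : setMask b = t.2.1
  trd : setMask c = t.2.2
  rank_lt : setRank a < setRank b
  rank_lt' : setRank b < setRank c
  exists_seg : ∃ σ : Equiv.Perm (Fin 4), (∃ k, a = seg σ k) ∧ (∃ k, b = seg σ k) ∧ ∃ k, c = seg σ k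

theorem exists_isFlag {t : ℕ × ℕ × ℕ} (ht : t ∈ flagTriples) : ∃ a b c, IsFlag t a b c := by
  have : ∀ t ∈ flagTriples, (setMask (maskSet 4 t.1) = t.1 ∧ setMask (maskSet 4 t.2.1) = t.2.1 ∧
      setMask (maskSet 4 t.2.2) = t.2.2) ∧ (setRank (maskSet 4 t.1) < setRank (maskSet 4 t.2.1) ∧
      setRank (maskSet 4 t.2.1) < setRank (maskSet 4 t.2.2)) ∧ ∃ σ : Equiv.Perm (Fin 4),
      (∃ k, maskSet 4 t.1 = seg σ k) ∧ (∃ k, maskSet 4 t.2.1 = seg σ k) ∧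
      ∃ k, maskSet 4 t.2.2 = seg σ k := by decide +kernel
  obtain ⟨⟨h1, h2, h3⟩, ⟨h4, h5⟩, h6⟩ := this t ht
  exact ⟨_, _, _, h1, h2, h3, h4, h5, h6⟩

theorem exists_flag_of_sphereCoord (x : StdSphere 2) : ∃ t ∈ flagTriples, ∃ a b c, IsFlag t a b c ∧
    ∀ S, sphereCoord x S ≠ 0 → S = a ∨ S = b ∨ S = c := by
  obtain ⟨σ, hσ⟩ := exists_seg_of_sphereCoord x
  obtain ⟨t, ht, hk⟩ := exists_flagTriple σ
  obtain ⟨a, b, c, h⟩ := exists_isFlag ht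
  refine ⟨t, ht, a, b, c, h, fun S hS => ?_⟩
  obtain ⟨k, rfl⟩ := hσ S hS
  rcases hk k with hk | hk | hk
  · exact Or.inl (setMask_injective (hk.trans h.fst.symm))
  · exact Or.inr (Or.inl (setMask_injective (hk.trans h.snd.symm)))
  · exact Or.inr (Or.inr (setMask_injective (hk.trans h.trd.symm)))

theorem IsFlag.sum_eq {t : ℕ × ℕ × ℕ} {a b c : Finset (Fin 4)} (h : IsFlag t a b c)
    {f : Finset (Fin 4) → ℝ} (hf : ∀ S, f S ≠ 0 → S = a ∨ S = b ∨ S = c) :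
    ∑ S, f S = f a + f b + f c := by
  have hab : a ≠ b := fun e => h.rank_lt.ne (by rw [e])
  have hbc : b ≠ c := fun e => h.rank_lt'.ne (by rw [e])
  have hac : a ≠ c := fun e => (h.rank_lt.trans h.rank_lt').ne (by rw [e])
  rw [← Finset.sum_subset (Finset.subset_univ {a, b, c}) fun S _ hS => by_contra fun hne => hS
    (by simpa using hf S hne), Finset.sum_insert (by simp [hab, hac]),
    Finset.sum_insert (by simp [hbc]), Finset.sum_singleton, add_assoc]

/-- The projection of the real line to the interval `[j, j + 1]`. -/
noncomputable def clampLayer (j : ℕ) (u : ℝ) : ℝ := max j (min u (j + 1))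

theorem clampLayer_mono (j : ℕ) : Monotone (clampLayer j) := fun _ _ h =>
  max_le_max le_rfl (min_le_min h le_rfl)

theorem clampLayer_of_le {j : ℕ} {u : ℝ} (h : u ≤ j) : clampLayer j u = j := by
  rw [clampLayer, max_eq_left ((min_le_left _ _).trans h)]

theorem clampLayer_of_ge {j : ℕ} {u : ℝ} (h : (j : ℝ) + 1 ≤ u) : clampLayer j u = j + 1 := by
  rw [clampLayer, min_eq_right h, max_eq_right (by linarith)]

theorem clampLayer_of_mem {j : ℕ} {u : ℝ} (h : (j : ℝ) ≤ u) (h' : u ≤ j + 1) :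
    clampLayer j u = u := by
  rw [clampLayer, min_eq_left h', max_eq_right h]

theorem sum_clampLayer (n : ℕ) {u : ℝ} (h0 : 0 ≤ u) :
    ∑ j ∈ Finset.range n, (clampLayer j u - j) = min u n := by
  induction n with
  | zero => simp [h0]
  | succ n ih =>
    rw [Finset.sum_range_succ, ih, Nat.cast_succ]
    rcases le_total u n with h | h
    · rw [clampLayer_of_le h, min_eq_left h, min_eq_left (by linarith)]; ring
    · rcases le_total u (n + 1) with h' | h'
      · rw [clampLayer_of_mem h h', min_eq_right h, min_eq_left h']; ring
      · rw [clampLayer_of_ge h', min_eq_right h, min_eq_right h']; ring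

/-- The total weight of the vertices of smaller rank. -/
noncomputable def lowerSum (x : StdSphere 2) (S : Finset (Fin 4)) : ℝ :=
  ∑ T, if setRank T < setRank S then sphereCoord x T else 0

/-- The weight of the vertex `S` of layer `j` at the point `x` of height `τ` in the staircase
triangulation. -/
noncomputable def stairCoord (x : StdSphere 2) (τ : ℝ) (j : ℕ) (S : Finset (Fin 4)) : ℝ :=
  clampLayer j (τ + lowerSum x S + sphereCoord x S) - clampLayer j (τ + lowerSum x S)

theorem lowerSum_nonneg (x : StdSphere 2) (S : Finset (Fin 4)) : 0 ≤ lowerSum x S :=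
  Finset.sum_nonneg fun T _ => by
    split_ifs
    · exact sphereCoord_nonneg x T
    · exact le_rfl

theorem lowerSum_add_le (x : StdSphere 2) (S : Finset (Fin 4)) :
    lowerSum x S + sphereCoord x S ≤ 1 := by
  rw [← sum_sphereCoord x, lowerSum]
  have : sphereCoord x S = ∑ T, if T = S then sphereCoord x T else 0 := by simp
  rw [this, ← Finset.sum_add_distrib]
  refine Finset.sum_le_sum fun T _ => ?_
  have := sphereCoord_nonneg x T
  by_cases h : T = S
  · subst h; simp
  · simp only [h, if_false, add_zero]
    split_ifs
    · exact le_rfl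
    · exact this

section Flag

variable {t : ℕ × ℕ × ℕ} {a b c : Finset (Fin 4)} {x : StdSphere 2}

theorem IsFlag.lowerSum_eq (h : IsFlag t a b c)
    (hx : ∀ S, sphereCoord x S ≠ 0 → S = a ∨ S = b ∨ S = c) : lowerSum x a = 0 ∧
      lowerSum x b = sphereCoord x a ∧ lowerSum x c = sphereCoord x a + sphereCoord x b := by
  have h1 := h.rank_lt
  have h2 := h.rank_lt'
  have key : ∀ S, lowerSum x S = (if setRank a < setRank S then sphereCoord x a else 0) +
      (if setRank b < setRank S then sphereCoord x b else 0) +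
      if setRank c < setRank S then sphereCoord x c else 0 := fun S =>
    h.sum_eq fun T hT => hx T fun h0 => hT (by simp [h0])
  refine ⟨?_, ?_, ?_⟩
  · simp [key, h1.not_gt, (h1.trans h2).not_gt]
  · simp [key, h1, h2.not_gt]
  · simp [key, h1.trans h2, h2]

theorem IsFlag.sum_sphereCoord_eq (h : IsFlag t a b c)
    (hx : ∀ S, sphereCoord x S ≠ 0 → S = a ∨ S = b ∨ S = c) :
    sphereCoord x a + sphereCoord x b + sphereCoord x c = 1 := by
  rw [← h.sum_eq hx, sum_sphereCoord]

end Flag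

/-- Cut the interval from `τ` to `τ + 1`, in order of rank, into segments of lengths `sphereCoord x
S`. Then `stairCoord x τ j S` is the length of the part of segment `S` inside `[j, j + 1]`, which
explains this and the following formulas. -/
theorem stairCoord_nonneg (x : StdSphere 2) (τ : ℝ) (j : ℕ) (S : Finset (Fin 4)) :
    0 ≤ stairCoord x τ j S :=
  sub_nonneg.2 (clampLayer_mono j (le_add_of_nonneg_right (sphereCoord_nonneg x S)))

theorem stairCoord_eq_zero_of_sphereCoord {x : StdSphere 2} {S : Finset (Fin 4)}
    (h : sphereCoord x S = 0) (τ : ℝ) (j : ℕ) : stairCoord x τ j S = 0 := by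
  rw [stairCoord, h, add_zero, sub_self]

theorem stairCoord_eq_zero_of_le {x : StdSphere 2} {S : Finset (Fin 4)} {τ : ℝ} {j : ℕ}
    (h : τ + 1 ≤ j) : stairCoord x τ j S = 0 := by
  have h1 := lowerSum_add_le x S
  have h2 := sphereCoord_nonneg x S
  rw [stairCoord, clampLayer_of_le (by linarith), clampLayer_of_le (by linarith), sub_self]

theorem stairCoord_eq_zero_of_ge {x : StdSphere 2} {S : Finset (Fin 4)} {τ : ℝ} {j : ℕ}
    (h : (j : ℝ) + 1 ≤ τ) : stairCoord x τ j S = 0 := by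
  have h1 := lowerSum_nonneg x S
  have h2 := sphereCoord_nonneg x S
  rw [stairCoord, clampLayer_of_ge (by linarith), clampLayer_of_ge (by linarith), sub_self]

theorem stairCoord_self (x : StdSphere 2) (j : ℕ) (S : Finset (Fin 4)) :
    stairCoord x j j S = sphereCoord x S := by
  have h1 := lowerSum_nonneg x S
  have h2 := sphereCoord_nonneg x S
  have h3 := lowerSum_add_le x S
  rw [stairCoord, clampLayer_of_mem (by linarith) (by linarith),
    clampLayer_of_mem (by linarith) (by linarith)]
  ring

/-- The segments fill the interval from `τ` to `τ + 1`, so the total weight of a layer depends on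
the height alone. This is what later recovers `τ`. -/
theorem sum_stairCoord (x : StdSphere 2) (τ : ℝ) (j : ℕ) :
    ∑ S, stairCoord x τ j S = clampLayer j (τ + 1) - clampLayer j τ := by
  obtain ⟨t, -, a, b, c, h, hx⟩ := exists_flag_of_sphereCoord x
  obtain ⟨ha, hb, hc⟩ := h.lowerSum_eq hx
  rw [h.sum_eq fun S hS => hx S fun h0 => hS (stairCoord_eq_zero_of_sphereCoord h0 τ j),
    stairCoord, stairCoord, stairCoord, ha, hb, hc, ← h.sum_sphereCoord_eq hx, add_zero,
    ← add_assoc, ← add_assoc]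
  ring_nf

/-- For these heights all segments lie in `[0, m + 1]`, which the layers cover. Forgetting the
layers therefore gives back the point of the sphere. -/
theorem sum_range_stairCoord (x : StdSphere 2) {τ : ℝ} {m : ℕ} (h0 : 0 ≤ τ) (hm : τ ≤ m)
    (S : Finset (Fin 4)) : ∑ j ∈ Finset.range (m + 1), stairCoord x τ j S = sphereCoord x S := by
  have h1 := lowerSum_nonneg x S
  have h2 := sphereCoord_nonneg x S
  have h3 := lowerSum_add_le x S
  have e : ∀ j : ℕ, stairCoord x τ j S = (clampLayer j (τ + lowerSum x S + sphereCoord x S) - j) -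
    (clampLayer j (τ + lowerSum x S) - j) := fun j => by rw [stairCoord]; ring
  simp only [e]
  rw [Finset.sum_sub_distrib, sum_clampLayer _ (by linarith), sum_clampLayer _ (by linarith),
    Nat.cast_succ, min_eq_left (by linarith), min_eq_left (by linarith)]
  ring

theorem continuous_stairCoord (j : ℕ) (S : Finset (Fin 4)) :
    Continuous fun p : StdSphere 2 × ℝ => stairCoord p.1 p.2 j S := by
  have hc : Continuous (clampLayer j) := by unfold clampLayer; fun_prop
  have hs : ∀ T, Continuous fun p : StdSphere 2 × ℝ => sphereCoord p.1 T := fun T =>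
    (continuous_sphereCoord T).comp continuous_fst
  have hl : Continuous fun p : StdSphere 2 × ℝ => lowerSum p.1 S :=
    continuous_finsetSum _ fun T _ => by
      split_ifs
      · exact hs T
      · exact continuous_const
  exact (hc.comp ((continuous_snd.add hl).add (hs S))).sub (hc.comp (continuous_snd.add hl))

theorem stairCoord_neg (x : StdSphere 2) (τ : ℝ) (j : ℕ) (S : Finset (Fin 4)) :
    stairCoord (-x) τ j S = stairCoord x τ j Sᶜ := by
  have : lowerSum (-x) S = lowerSum x Sᶜ := by
    unfold lowerSum
    simp only [sphereCoord_neg]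
    rw [← sum_compl]
    simp only [compl_compl, setRank_compl]
  rw [stairCoord, stairCoord, this, sphereCoord_neg]


/-! ### The map onto the identified staircase complex -/

/-- The image of a point of `S² × [0, m]` in the complex obtained from the staircase triangulation
by the identification `q` of vertices. -/
noncomputable def stairPoint (N m : ℕ) (q : ℕ → ℕ → ℕ) (p : StdSphere 2 × ℝ) (l : Fin N) : ℝ :=
  ∑ j ∈ Finset.range (m + 1), ∑ S, if q j (setMask S) = l then stairCoord p.1 p.2 j S else 0

section Stair

variable {N m : ℕ} {q : ℕ → ℕ → ℕ}

theorem continuous_stairPoint : Continuous (stairPoint N m q) := by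
  refine continuous_pi fun l => continuous_finsetSum _ fun j _ => continuous_finsetSum _ fun S _ => ?_
  split_ifs
  · exact continuous_stairCoord j S
  · exact continuous_const

theorem sum_mul_stairPoint (hq : ∀ j ≤ m, ∀ S < 16, q j S < N) (g : ℕ → ℝ) (p : StdSphere 2 × ℝ) :
    ∑ l : Fin N, g l * stairPoint N m q p l =
      ∑ j ∈ Finset.range (m + 1), ∑ S, g (q j (setMask S)) * stairCoord p.1 p.2 j S := by
  simp only [stairPoint, Finset.mul_sum]
  rw [Finset.sum_comm]
  refine Finset.sum_congr rfl fun j hj => ?_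
  rw [Finset.sum_comm]
  refine Finset.sum_congr rfl fun S _ => ?_
  have hlt := hq j (Nat.lt_succ_iff.1 (Finset.mem_range.1 hj)) _ (setMask_lt S)
  rw [Finset.sum_eq_single (⟨q j (setMask S), hlt⟩ : Fin N)]
  · simp
  · intro l _ hl
    rw [if_neg (fun h => hl (Fin.ext h.symm)), mul_zero]
  · simp

/-- An interval of length one starting in `[j, j + 1]` meets only layers `j` and `j + 1` in positive
length. -/
theorem stairPoint_eq_of_flag {t : ℕ × ℕ × ℕ} {a b c : Finset (Fin 4)} {x : StdSphere 2}
    (h : IsFlag t a b c) (hx : ∀ S, sphereCoord x S ≠ 0 → S = a ∨ S = b ∨ S = c) {j : ℕ}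
    (hj : j < m) {τ : ℝ} (h0 : (j : ℝ) ≤ τ) (h1 : τ ≤ j + 1) (l : Fin N) :
    stairPoint N m q (x, τ) l =
      ((if q j t.1 = l then stairCoord x τ j a else 0) +
       (if q j t.2.1 = l then stairCoord x τ j b else 0) +
       (if q j t.2.2 = l then stairCoord x τ j c else 0)) +
      ((if q (j + 1) t.1 = l then stairCoord x τ (j + 1) a else 0) +
       (if q (j + 1) t.2.1 = l then stairCoord x τ (j + 1) b else 0) +
       (if q (j + 1) t.2.2 = l then stairCoord x τ (j + 1) c else 0)) := by
  have hs : ∀ i, (∑ S, if q i (setMask S) = l then stairCoord x τ i S else 0) =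
      (if q i t.1 = l then stairCoord x τ i a else 0) +
       (if q i t.2.1 = l then stairCoord x τ i b else 0) +
       (if q i t.2.2 = l then stairCoord x τ i c else 0) := fun i => by
    rw [h.sum_eq fun S hS => hx S fun hS0 => hS (by
      simp [stairCoord_eq_zero_of_sphereCoord hS0]), h.fst, h.snd, h.trd]
  rw [stairPoint, ← hs j, ← hs (j + 1), ← Finset.sum_pair (f := fun i => ∑ S, if q i (setMask S) = l
    then stairCoord x τ i S else 0) (Nat.succ_ne_self j).symm]
  refine (Finset.sum_subset ?_ fun i _ hi => ?_).symm
  · intro i hi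
    rw [Finset.mem_insert, Finset.mem_singleton] at hi
    rw [Finset.mem_range]
    omega
  · rw [Finset.mem_insert, Finset.mem_singleton, not_or] at hi
    refine Finset.sum_eq_zero fun S _ => ?_
    have : stairCoord x τ i S = 0 := by
      rcases lt_or_gt_of_ne hi.1 with hlt | hgt
      · refine stairCoord_eq_zero_of_ge ?_
        have : ((i + 1 : ℕ) : ℝ) ≤ j := Nat.cast_le.2 hlt
        push_cast at this
        linarith
      · refine stairCoord_eq_zero_of_le ?_
        have : ((j + 2 : ℕ) : ℝ) ≤ i := Nat.cast_le.2 (by omega)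
        push_cast at this
        linarith
    simp [this]

theorem mem_maskSet_four {n₁ n₂ n₃ n₄ : ℕ} {l : Fin N} :
    l ∈ maskSet N (Nat.lor (Nat.lor (2 ^ n₁) (2 ^ n₂)) (Nat.lor (2 ^ n₃) (2 ^ n₄))) ↔
      n₁ = l ∨ n₂ = l ∨ n₃ = l ∨ n₄ = l := by
  rw [mem_maskSet]
  change ((2 ^ n₁ ||| 2 ^ n₂) ||| (2 ^ n₃ ||| 2 ^ n₄)).testBit l = true ↔ _
  simp [Nat.testBit_or, Nat.testBit_two_pow, or_assoc]

theorem mem_staircase {F : ℕ} : F ∈ staircase m q ↔ ∃ j < m, ∃ t ∈ flagTriples,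
    F = Nat.lor (Nat.lor (2 ^ q j t.1) (2 ^ q (j + 1) t.1))
      (Nat.lor (2 ^ q (j + 1) t.2.1) (2 ^ q (j + 1) t.2.2)) ∨
    F = Nat.lor (Nat.lor (2 ^ q j t.1) (2 ^ q j t.2.1))
      (Nat.lor (2 ^ q (j + 1) t.2.1) (2 ^ q (j + 1) t.2.2)) ∨
    F = Nat.lor (Nat.lor (2 ^ q j t.1) (2 ^ q j t.2.1))
      (Nat.lor (2 ^ q j t.2.2) (2 ^ q (j + 1) t.2.2)) := by
  simp only [staircase, List.mem_flatMap, List.mem_range, List.mem_cons, List.not_mem_nil, or_false]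

theorem stairPoint_mem (hq : ∀ j ≤ m, ∀ S < 16, q j S < N) {x : StdSphere 2} {τ : ℝ} (h0 : 0 ≤ τ)
    (hm : τ ≤ m) (hm0 : 0 < m) :
    stairPoint N m q (x, τ) ∈ Realization (maskFamily N (staircase m q)) := by
  refine ⟨fun l => Finset.sum_nonneg fun j _ => Finset.sum_nonneg fun S _ => ?_, ?_, ?_⟩
  · split_ifs
    · exact stairCoord_nonneg _ _ _ _
    · exact le_rfl
  · have := sum_mul_stairPoint hq (fun _ => 1) (x, τ)
    simp only [one_mul] at this
    rw [this, Finset.sum_comm, Finset.sum_congr rfl fun S _ => sum_range_stairCoord x h0 hm S,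
      sum_sphereCoord]
  · obtain ⟨j, hj, hj0, hj1⟩ : ∃ j < m, (j : ℝ) ≤ τ ∧ τ ≤ j + 1 := by
      rcases hm.lt_or_eq with h | h
      · exact ⟨⌊τ⌋₊, (Nat.floor_lt h0).2 h, Nat.floor_le h0, (Nat.lt_floor_add_one τ).le⟩
      · refine ⟨m - 1, by omega, ?_, ?_⟩ <;>
          rw [Nat.cast_sub hm0, Nat.cast_one] <;> linarith
    obtain ⟨t, ht, a, b, c, h, hx⟩ := exists_flag_of_sphereCoord x
    have hpt := stairPoint_eq_of_flag (N := N) (q := q) h hx hj hj0 hj1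
    obtain ⟨ha, hb, hc⟩ := h.lowerSum_eq hx
    have hs := h.sum_sphereCoord_eq hx
    have na := sphereCoord_nonneg x a
    have nb := sphereCoord_nonneg x b
    have nc := sphereCoord_nonneg x c
    have cj : ((j + 1 : ℕ) : ℝ) = j + 1 := Nat.cast_succ j
    -- The segment that contains the level `j + 1` is the vertex that may occur in both layers, and
    -- it selects one of the three tetrahedra of the prism.
    rcases le_total ((j : ℝ) + 1) (τ + sphereCoord x a) with h1 | h1
    · have eb : stairCoord x τ j b = 0 := by
        rw [stairCoord, hb, clampLayer_of_ge (by linarith), clampLayer_of_ge (by linarith), sub_self]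
      have ec : stairCoord x τ j c = 0 := by
        rw [stairCoord, hc, clampLayer_of_ge (by linarith), clampLayer_of_ge (by linarith), sub_self]
      refine ⟨_, ⟨_, mem_staircase.2 ⟨j, hj, t, ht, Or.inl rfl⟩, rfl⟩, fun l hl => ?_⟩
      rw [mem_maskSet_four]
      by_contra hn
      simp only [not_or] at hn
      exact hl (by simp [hpt, eb, ec, hn])
    rcases le_total ((j : ℝ) + 1) (τ + sphereCoord x a + sphereCoord x b) with h2 | h2
    · have ea : stairCoord x τ (j + 1) a = 0 := by
        rw [stairCoord, ha, clampLayer_of_le (by linarith), clampLayer_of_le (by linarith), sub_self]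
      have ec : stairCoord x τ j c = 0 := by
        rw [stairCoord, hc, clampLayer_of_ge (by linarith), clampLayer_of_ge (by linarith), sub_self]
      refine ⟨_, ⟨_, mem_staircase.2 ⟨j, hj, t, ht, Or.inr (Or.inl rfl)⟩, rfl⟩, fun l hl => ?_⟩
      rw [mem_maskSet_four]
      by_contra hn
      simp only [not_or] at hn
      exact hl (by simp [hpt, ea, ec, hn])
    · have ea : stairCoord x τ (j + 1) a = 0 := by
        rw [stairCoord, ha, clampLayer_of_le (by linarith), clampLayer_of_le (by linarith), sub_self]
      have eb : stairCoord x τ (j + 1) b = 0 := by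
        rw [stairCoord, hb, clampLayer_of_le (by linarith), clampLayer_of_le (by linarith), sub_self]
      refine ⟨_, ⟨_, mem_staircase.2 ⟨j, hj, t, ht, Or.inr (Or.inr rfl)⟩, rfl⟩, fun l hl => ?_⟩
      rw [mem_maskSet_four]
      by_contra hn
      simp only [not_or] at hn
      exact hl (by simp [hpt, ea, eb, hn])

theorem exists_weights {z : Fin N → ℝ} (h0 : ∀ l, 0 ≤ z l) (h1 : ∑ l, z l = 1) {n₁ n₂ n₃ n₄ : ℕ}
    (hn₁ : n₁ < N) (hn₂ : n₂ < N) (hn₃ : n₃ < N) (hn₄ : n₄ < N)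
    (hz : ∀ l, z l ≠ 0 → n₁ = l ∨ n₂ = l ∨ n₃ = l ∨ n₄ = l) :
    ∃ w₁ w₂ w₃ w₄ : ℝ, 0 ≤ w₁ ∧ 0 ≤ w₂ ∧ 0 ≤ w₃ ∧ 0 ≤ w₄ ∧ w₁ + w₂ + w₃ + w₄ = 1 ∧
      ∀ l : Fin N, z l = (if n₁ = l then w₁ else 0) + (if n₂ = l then w₂ else 0) +
        (if n₃ = l then w₃ else 0) + if n₄ = l then w₄ else 0 := by
  obtain ⟨w₁, w₂, w₃, w₄, p₁, p₂, p₃, p₄, hw⟩ : ∃ w₁ w₂ w₃ w₄ : ℝ,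
      0 ≤ w₁ ∧ 0 ≤ w₂ ∧ 0 ≤ w₃ ∧ 0 ≤ w₄ ∧
      ∀ l : Fin N, z l = (if n₁ = l then w₁ else 0) + (if n₂ = l then w₂ else 0) +
        (if n₃ = l then w₃ else 0) + if n₄ = l then w₄ else 0 := by
    -- The identification may make labels coincide. Each value of `z` is assigned to the first
    -- occurrence of its label, and later occurrences get zero.
    refine ⟨z ⟨n₁, hn₁⟩, if n₂ = n₁ then 0 else z ⟨n₂, hn₂⟩,
      if n₃ = n₁ ∨ n₃ = n₂ then 0 else z ⟨n₃, hn₃⟩,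
      if n₄ = n₁ ∨ n₄ = n₂ ∨ n₄ = n₃ then 0 else z ⟨n₄, hn₄⟩, h0 _, ?_, ?_, ?_, fun l => ?_⟩
    · split_ifs <;> simp [h0]
    · split_ifs <;> simp [h0]
    · split_ifs <;> simp [h0]
    · by_cases hl : z l = 0
      · rw [hl]
        have : ∀ n (hn : n < N), n = l → z ⟨n, hn⟩ = 0 := fun n hn he => by
          rw [← hl]; exact congrArg z (Fin.ext he)
        have f : ∀ n (hn : n < N) (P : Prop) [Decidable P],
            (if n = l then (if P then 0 else z ⟨n, hn⟩) else 0) = 0 := fun n hn P _ => by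
          split_ifs with h
          · rfl
          · exact this n hn h
          · rfl
        rw [f, f, f]
        split_ifs with h
        · simp [this n₁ hn₁ h]
        · simp
      · have hl' : ∀ n (hn : n < N), n = l → z ⟨n, hn⟩ = z l := fun n hn he =>
          congrArg z (Fin.ext he)
        have hz' := hz l hl
        by_cases e₁ : n₁ = l
        · subst e₁
          simp +contextual
        by_cases e₂ : n₂ = l
        · subst e₂
          have : ¬ (l : ℕ) = n₁ := fun h => e₁ h.symm
          simp +contextual [e₁, this]
        by_cases e₃ : n₃ = l
        · subst e₃
          have k₁ : ¬ (l : ℕ) = n₁ := fun h => e₁ h.symm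
          have k₂ : ¬ (l : ℕ) = n₂ := fun h => e₂ h.symm
          simp +contextual [e₁, e₂, k₁, k₂]
        obtain e₄ : n₄ = l := by tauto
        subst e₄
        have k₁ : ¬ (l : ℕ) = n₁ := fun h => e₁ h.symm
        have k₂ : ¬ (l : ℕ) = n₂ := fun h => e₂ h.symm
        have k₃ : ¬ (l : ℕ) = n₃ := fun h => e₃ h.symm
        simp [e₁, e₂, e₃, k₁, k₂, k₃]
  refine ⟨w₁, w₂, w₃, w₄, p₁, p₂, p₃, p₄, ?_, hw⟩
  have hsum : ∀ n (_ : n < N) (w : ℝ), ∑ l : Fin N, (if n = l then w else 0) = w := fun n hn w => by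
    rw [Finset.sum_eq_single (⟨n, hn⟩ : Fin N)]
    · simp
    · exact fun l _ hl => if_neg fun h => hl (Fin.ext h.symm)
    · simp
  rw [← h1, Finset.sum_congr rfl fun l _ => hw l, Finset.sum_add_distrib, Finset.sum_add_distrib,
    Finset.sum_add_distrib, hsum _ hn₁, hsum _ hn₂, hsum _ hn₃, hsum _ hn₄]

/-- The spherical weight of a vertex is its total over both layers, and the height is `j` plus the
weight of the upper layer. The condition `hc` says that the lower weights precede the upper ones
with at most one vertex shared, so cutting the segments at `j + 1` reproduces the given split. -/
theorem exists_stairCoord_eq {t : ℕ × ℕ × ℕ} {a b c : Finset (Fin 4)} (h : IsFlag t a b c) (j : ℕ)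
    {α₁ α₂ α₃ β₁ β₂ β₃ : ℝ} (hα₁ : 0 ≤ α₁) (hα₂ : 0 ≤ α₂) (hα₃ : 0 ≤ α₃) (hβ₁ : 0 ≤ β₁)
    (hβ₂ : 0 ≤ β₂) (hβ₃ : 0 ≤ β₃) (hs : α₁ + α₂ + α₃ + β₁ + β₂ + β₃ = 1)
    (hc : α₂ = 0 ∧ α₃ = 0 ∨ β₁ = 0 ∧ α₃ = 0 ∨ β₁ = 0 ∧ β₂ = 0) :
    ∃ x : StdSphere 2, (∀ S, sphereCoord x S ≠ 0 → S = a ∨ S = b ∨ S = c) ∧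
      let τ : ℝ := j + (β₁ + β₂ + β₃)
      stairCoord x τ j a = α₁ ∧ stairCoord x τ j b = α₂ ∧ stairCoord x τ j c = α₃ ∧
      stairCoord x τ (j + 1) a = β₁ ∧ stairCoord x τ (j + 1) b = β₂ ∧
      stairCoord x τ (j + 1) c = β₃ := by
  have hab : a ≠ b := fun e => h.rank_lt.ne (by rw [e])
  have hbc : b ≠ c := fun e => h.rank_lt'.ne (by rw [e])
  have hac : a ≠ c := fun e => (h.rank_lt.trans h.rank_lt').ne (by rw [e])
  set w : Finset (Fin 4) → ℝ := fun S =>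
    if S = a then α₁ + β₁ else if S = b then α₂ + β₂ else if S = c then α₃ + β₃ else 0 with hw
  have hsupp : ∀ S, w S ≠ 0 → S = a ∨ S = b ∨ S = c := fun S hS => by
    by_contra hn
    simp only [not_or] at hn
    exact hS (by simp [hw, hn])
  have wa : w a = α₁ + β₁ := if_pos rfl
  have wb : w b = α₂ + β₂ := by simp [hw, hab.symm]
  have wc : w c = α₃ + β₃ := by simp [hw, hac.symm, hbc.symm]
  obtain ⟨σ, ha, hb, hc'⟩ := h.exists_seg
  obtain ⟨x, hx⟩ := exists_sphereCoord_eq (σ := σ) (w := w)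
    (fun S => by simp only [hw]; split_ifs <;> linarith)
    (by rw [h.sum_eq hsupp, wa, wb, wc]; linarith)
    (fun S hS => by rcases hsupp S hS with rfl | rfl | rfl <;> assumption)
  refine ⟨x, by rwa [hx], ?_⟩
  obtain ⟨la, lb, lc⟩ := h.lowerSum_eq (x := x) (by rwa [hx])
  have cj : ((j + 1 : ℕ) : ℝ) = j + 1 := Nat.cast_succ j
  simp only [stairCoord, la, lb, lc, hx, wa, wb, wc]
  have lo : ∀ u : ℝ, (j : ℝ) ≤ u → clampLayer j u = min u (j + 1) := fun u hu => by
    rw [clampLayer, max_eq_right (le_min hu (by linarith))]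
  have hi : ∀ u : ℝ, u ≤ (j : ℝ) + 2 → clampLayer (j + 1) u = max ((j : ℝ) + 1) u := fun u hu => by
    rw [clampLayer, cj, min_eq_left (by linarith)]
  rw [lo _ (by linarith), lo _ (by linarith), lo _ (by linarith), lo _ (by linarith), lo _ (by linarith), lo _ (by linarith), hi _ (by linarith), hi _ (by linarith), hi _ (by linarith), hi _ (by linarith), hi _ (by linarith), hi _ (by linarith)]
  rcases hc with ⟨rfl, rfl⟩ | ⟨rfl, rfl⟩ | ⟨rfl, rfl⟩
  · rw [min_eq_right (by linarith), min_eq_left (by linarith), min_eq_right (by linarith), min_eq_right (by linarith), min_eq_right (by linarith), min_eq_right (by linarith),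
      max_eq_right (by linarith), max_eq_left (by linarith), max_eq_right (by linarith), max_eq_right (by linarith), max_eq_right (by linarith), max_eq_right (by linarith)]
    refine ⟨?_, ?_, ?_, ?_, ?_, ?_⟩ <;> linarith
  · rw [min_eq_left (by linarith), min_eq_left (by linarith), min_eq_right (by linarith), min_eq_left (by linarith), min_eq_right (by linarith), min_eq_right (by linarith),
      max_eq_left (by linarith), max_eq_left (by linarith), max_eq_right (by linarith), max_eq_left (by linarith), max_eq_right (by linarith), max_eq_right (by linarith)]
    refine ⟨?_, ?_, ?_, ?_, ?_, ?_⟩ <;> linarith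
  · rw [min_eq_left (by linarith), min_eq_left (by linarith), min_eq_left (by linarith), min_eq_left (by linarith), min_eq_right (by linarith), min_eq_left (by linarith),
      max_eq_left (by linarith), max_eq_left (by linarith), max_eq_left (by linarith), max_eq_left (by linarith), max_eq_right (by linarith), max_eq_left (by linarith)]
    refine ⟨?_, ?_, ?_, ?_, ?_, ?_⟩ <;> linarith

theorem exists_stairPoint_eq (hq : ∀ j ≤ m, ∀ S < 16, q j S < N) {z : Fin N → ℝ}
    (hz : z ∈ Realization (maskFamily N (staircase m q))) :
    ∃ (x : StdSphere 2) (τ : ℝ), 0 ≤ τ ∧ τ ≤ m ∧ stairPoint N m q (x, τ) = z := by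
  obtain ⟨h0, h1, _, ⟨F, hF, rfl⟩, hz⟩ := hz
  obtain ⟨j, hj, t, ht, hF⟩ := mem_staircase.1 hF
  obtain ⟨a, b, c, h⟩ := exists_isFlag ht
  have l1 : t.1 < 16 := h.fst ▸ setMask_lt a
  have l2 : t.2.1 < 16 := h.snd ▸ setMask_lt b
  have l3 : t.2.2 < 16 := h.trd ▸ setMask_lt c
  have hjm : ((j + 1 : ℕ) : ℝ) ≤ m := Nat.cast_le.2 hj
  rw [Nat.cast_succ] at hjm
  have main : ∀ {α₁ α₂ α₃ β₁ β₂ β₃ : ℝ}, 0 ≤ α₁ → 0 ≤ α₂ → 0 ≤ α₃ → 0 ≤ β₁ → 0 ≤ β₂ → 0 ≤ β₃ →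
      α₁ + α₂ + α₃ + β₁ + β₂ + β₃ = 1 →
      (α₂ = 0 ∧ α₃ = 0 ∨ β₁ = 0 ∧ α₃ = 0 ∨ β₁ = 0 ∧ β₂ = 0) →
      (∀ l : Fin N, z l = ((if q j t.1 = l then α₁ else 0) + (if q j t.2.1 = l then α₂ else 0) +
        (if q j t.2.2 = l then α₃ else 0)) + ((if q (j + 1) t.1 = l then β₁ else 0) +
        (if q (j + 1) t.2.1 = l then β₂ else 0) + if q (j + 1) t.2.2 = l then β₃ else 0)) →
      ∃ (x : StdSphere 2) (τ : ℝ), 0 ≤ τ ∧ τ ≤ m ∧ stairPoint N m q (x, τ) = z := by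
    intro α₁ α₂ α₃ β₁ β₂ β₃ p₁ p₂ p₃ p₄ p₅ p₆ hs hc hw
    obtain ⟨x, hx, e₁, e₂, e₃, e₄, e₅, e₆⟩ := exists_stairCoord_eq h j p₁ p₂ p₃ p₄ p₅ p₆ hs hc
    refine ⟨x, j + (β₁ + β₂ + β₃), by positivity, by linarith, funext fun l => ?_⟩
    rw [stairPoint_eq_of_flag h hx hj (by linarith) (by linarith), e₁, e₂, e₃, e₄, e₅, e₆, hw]
  rcases hF with rfl | rfl | rfl
  · obtain ⟨w₁, w₂, w₃, w₄, p₁, p₂, p₃, p₄, hs, hw⟩ := exists_weights h0 h1 (hq j hj.le _ l1)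
      (hq (j + 1) hj _ l1) (hq (j + 1) hj _ l2) (hq (j + 1) hj _ l3)
      fun l hl => mem_maskSet_four.1 (hz l hl)
    exact main (α₁ := w₁) (α₂ := 0) (α₃ := 0) (β₁ := w₂) (β₂ := w₃) (β₃ := w₄) p₁ le_rfl le_rfl p₂ p₃ p₄
      (by linarith) (by simp) fun l => by rw [hw]; simp only [ite_self]; ring
  · obtain ⟨w₁, w₂, w₃, w₄, p₁, p₂, p₃, p₄, hs, hw⟩ := exists_weights h0 h1 (hq j hj.le _ l1)
      (hq j hj.le _ l2) (hq (j + 1) hj _ l2) (hq (j + 1) hj _ l3)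
      fun l hl => mem_maskSet_four.1 (hz l hl)
    exact main (α₁ := w₁) (α₂ := w₂) (α₃ := 0) (β₁ := 0) (β₂ := w₃) (β₃ := w₄) p₁ p₂ le_rfl le_rfl p₃ p₄
      (by linarith) (by simp) fun l => by rw [hw]; simp only [ite_self]; ring
  · obtain ⟨w₁, w₂, w₃, w₄, p₁, p₂, p₃, p₄, hs, hw⟩ := exists_weights h0 h1 (hq j hj.le _ l1)
      (hq j hj.le _ l2) (hq j hj.le _ l3) (hq (j + 1) hj _ l3)
      fun l hl => mem_maskSet_four.1 (hz l hl)
    exact main (α₁ := w₁) (α₂ := w₂) (α₃ := w₃) (β₁ := 0) (β₂ := 0) (β₃ := w₄) p₁ p₂ p₃ le_rfl le_rfl p₄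
      (by linarith) (by simp) fun l => by rw [hw]; simp only [ite_self]; ring

end Stair


/-! ### Vertex identifications and the fibers they produce -/

/-- Two points of `X × [0, 1]` with the same image in the mapping torus of `f`. -/
def TorusFiber {X : Type*} (f : X → X) (a b : X × unitInterval) : Prop :=
  a = b ∨ (a.2 = 1 ∧ b.2 = 0 ∧ b.1 = f a.1) ∨ (a.2 = 0 ∧ b.2 = 1 ∧ a.1 = f b.1)

/-- Two points of `S² × [0, 1]` with the same image in `ℝP² × S¹`. -/
def ProjectiveFiber (a b : StdSphere 2 × unitInterval) : Prop :=
  (a.1 = b.1 ∨ a.1 = -b.1) ∧ (a.2 = b.2 ∨ (a.2 = 1 ∧ b.2 = 0) ∨ (a.2 = 0 ∧ b.2 = 1))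

/-- Two points of `S² × [0, 1]` with the same image in `ℝP³ # ℝP³`. -/
def DoubleFiber (a b : StdSphere 2 × unitInterval) : Prop :=
  a = b ∨ (a.2 = b.2 ∧ (a.2 = 0 ∨ a.2 = 1) ∧ a.1 = -b.1)

/-- The vertex identification for a mapping torus. -/
def torusLabel (ρ : ℕ → ℕ) (j S : ℕ) : ℕ := if j = 3 then ρ S else 16 * j + S

/-- The vertex identification for `ℝP² × S¹`. -/
def projectiveLabel (j S : ℕ) : ℕ := 16 * (j % 3) + vertexRank S

/-- The vertex identification for `ℝP³ # ℝP³`. -/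
def doubleLabel (j S : ℕ) : ℕ := if j = 1 then 16 + S else 16 * j + vertexRank S

/-- The exchange of the first two elements, on bit masks. -/
def swapMask (S : ℕ) : ℕ := 4 * (S / 4) + (S % 2) * 2 + S / 2 % 2

theorem setMask_swapSet (S : Finset (Fin 4)) : setMask (swapSet S) = swapMask (setMask S) := by
  revert S; decide

theorem setRank_lt (S : Finset (Fin 4)) : setRank S < 16 := by
  revert S; decide

/-- The total weight of a layer. -/
noncomputable def layerWeight (τ : ℝ) (j : ℕ) : ℝ := clampLayer j (τ + 1) - clampLayer j τ

theorem layerWeight_of_le {τ : ℝ} {j : ℕ} (h : τ + 1 ≤ j) : layerWeight τ j = 0 := by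
  rw [layerWeight, clampLayer_of_le h, clampLayer_of_le (by linarith), sub_self]

theorem layerWeight_of_ge {τ : ℝ} {j : ℕ} (h : (j : ℝ) + 1 ≤ τ) : layerWeight τ j = 0 := by
  rw [layerWeight, clampLayer_of_ge h, clampLayer_of_ge (by linarith), sub_self]

theorem layerWeight_of_mem {τ : ℝ} {j : ℕ} (h : (j : ℝ) ≤ τ) (h' : τ ≤ j + 1) :
    layerWeight τ j = j + 1 - τ := by
  rw [layerWeight, clampLayer_of_ge (by linarith), clampLayer_of_mem h h']

theorem layerWeight_of_mem' {τ : ℝ} {j : ℕ} (h : (j : ℝ) ≤ τ + 1) (h' : τ ≤ j) :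
    layerWeight τ j = τ + 1 - j := by
  rw [layerWeight, clampLayer_of_le h', clampLayer_of_mem h (by linarith)]

/-- With layers 0 and 3 identified, the layer weights run once around the boundary of a triangle as
the height goes from 0 to 3. Only the endpoints meet, and the weights of layers 1 and 2 already
locate the point. -/
theorem eq_or_of_layerWeight {τ τ' : ℝ} (h0 : 0 ≤ τ) (h3 : τ ≤ 3) (h0' : 0 ≤ τ') (h3' : τ' ≤ 3)
    (h1 : layerWeight τ 1 = layerWeight τ' 1) (h2 : layerWeight τ 2 = layerWeight τ' 2) :
    τ = τ' ∨ (τ = 3 ∧ τ' = 0) ∨ (τ = 0 ∧ τ' = 3) := by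
  have key : ∀ t : ℝ, 0 ≤ t → t ≤ 3 → (t ≤ 1 ∧ layerWeight t 1 = t ∧ layerWeight t 2 = 0) ∨
      (1 ≤ t ∧ t ≤ 2 ∧ layerWeight t 1 = 2 - t ∧ layerWeight t 2 = t - 1) ∨
      (2 ≤ t ∧ layerWeight t 1 = 0 ∧ layerWeight t 2 = 3 - t) := by
    intro t p q
    rcases le_total t 1 with h | h
    · left
      rw [layerWeight_of_mem' (by norm_num; linarith) (by norm_num; linarith),
        layerWeight_of_le (by norm_num; linarith)]
      norm_num [h]
    rcases le_total t 2 with h' | h'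
    · right; left
      rw [layerWeight_of_mem (by norm_num; linarith) (by norm_num; linarith),
        layerWeight_of_mem' (by norm_num; linarith) (by norm_num; linarith)]
      norm_num [h, h']
      ring
    · right; right
      rw [layerWeight_of_ge (by norm_num; linarith),
        layerWeight_of_mem (by norm_num; linarith) (by norm_num; linarith)]
      norm_num [h']
  rcases key τ h0 h3 with ⟨a, b, c⟩ | ⟨a, a', b, c⟩ | ⟨a, b, c⟩ <;>
  rcases key τ' h0' h3' with ⟨a', b', c'⟩ | ⟨a', a'', b', c'⟩ | ⟨a', b', c'⟩ <;>
  rw [b, b'] at h1 <;> rw [c, c'] at h2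
  · left; linarith
  · left; linarith
  · right; right; constructor <;> linarith
  · left; linarith
  · left; linarith
  · left; linarith
  · right; left; constructor <;> linarith
  · left; linarith
  · left; linarith

theorem eq_of_layerWeight {τ τ' : ℝ} (h0 : 0 ≤ τ) (h2 : τ ≤ 2) (h0' : 0 ≤ τ') (h2' : τ' ≤ 2)
    (hw : layerWeight τ 0 = layerWeight τ' 0) (hw1 : layerWeight τ 1 = layerWeight τ' 1) :
    τ = τ' := by
  have key : ∀ t : ℝ, 0 ≤ t → t ≤ 2 → (t ≤ 1 ∧ layerWeight t 0 = 1 - t ∧ layerWeight t 1 = t) ∨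
      (1 ≤ t ∧ layerWeight t 0 = 0 ∧ layerWeight t 1 = 2 - t) := by
    intro t p q
    rcases le_total t 1 with h | h
    · left
      rw [layerWeight_of_mem (by norm_num; linarith) (by norm_num; linarith),
        layerWeight_of_mem' (by norm_num; linarith) (by norm_num; linarith)]
      norm_num [h]
    · right
      rw [layerWeight_of_ge (by norm_num; linarith),
        layerWeight_of_mem (by norm_num; linarith) (by norm_num; linarith)]
      norm_num [h]
  rcases key τ h0 h2 with ⟨a, b, c⟩ | ⟨a, b, c⟩ <;>
  rcases key τ' h0' h2' with ⟨a', b', c'⟩ | ⟨a', b', c'⟩ <;>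
  rw [b, b'] at hw <;> rw [c, c'] at hw1 <;> linarith

theorem sum_ite_setMask (j j₀ : ℕ) (T : Finset (Fin 4)) (f : Finset (Fin 4) → ℝ) :
    (∑ S, if 16 * j + setMask S = 16 * j₀ + setMask T then f S else 0) =
      if j = j₀ then f T else 0 := by
  have e : ∀ S, 16 * j + setMask S = 16 * j₀ + setMask T ↔ j = j₀ ∧ S = T := fun S => by
    have h1 := setMask_lt S
    have h2 := setMask_lt T
    rw [← setMask_injective.eq_iff (a := S)]
    omega
  simp only [e]
  split_ifs with h <;> simp [h]

theorem sum_ite_setRank (j j₀ : ℕ) (T : Finset (Fin 4)) (f : Finset (Fin 4) → ℝ) :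
    (∑ S, if 16 * j + setRank S = 16 * j₀ + setRank T then f S else 0) =
      if j = j₀ then f T + f Tᶜ else 0 := by
  have e : ∀ S, 16 * j + setRank S = 16 * j₀ + setRank T ↔ j = j₀ ∧ (S = T ∨ S = Tᶜ) := fun S => by
    have h1 := setRank_lt S
    have h2 := setRank_lt T
    rw [← setRank_eq_iff]
    omega
  have hne : ∀ T : Finset (Fin 4), T ≠ Tᶜ := by decide
  simp only [e]
  split_ifs with h
  · simp only [h, true_and]
    rw [← Finset.sum_pair (f := f) (hne T), ← Finset.sum_filter]
    congr 1
    ext S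
    simp
  · simp [h]

section Labels

variable {ρ : ℕ → ℕ} {R : Finset (Fin 4) → Finset (Fin 4)}

theorem torusLabel_lt (hρ : ∀ S < 16, ρ S < 16) : ∀ j ≤ 3, ∀ S < 16, torusLabel ρ j S < 48 := by
  intro j hj S hS
  have := hρ S hS
  interval_cases j <;> simp [torusLabel] <;> omega

theorem projectiveLabel_lt : ∀ j ≤ 3, ∀ S < 16, projectiveLabel j S < 48 := by
  intro j hj S hS
  have : vertexRank S < 16 := (min_le_left _ _).trans_lt hS
  unfold projectiveLabel
  omega

theorem doubleLabel_lt : ∀ j ≤ 2, ∀ S < 16, doubleLabel j S < 48 := by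
  intro j hj S hS
  have : vertexRank S < 16 := (min_le_left _ _).trans_lt hS
  interval_cases j <;> simp [doubleLabel] <;> omega

theorem stairPoint_nat {N m : ℕ} {q : ℕ → ℕ → ℕ} (x : StdSphere 2) {i : ℕ} (hi : i ≤ m)
    (l : Fin N) : stairPoint N m q (x, i) l =
      ∑ S, if q i (setMask S) = l then sphereCoord x S else 0 := by
  rw [stairPoint, Finset.sum_eq_single i]
  · simp only [stairCoord_self]
  · intro j _ hji
    refine Finset.sum_eq_zero fun S _ => ?_
    have : stairCoord x i j S = 0 := by
      rcases lt_or_gt_of_ne hji with h | h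
      · exact stairCoord_eq_zero_of_ge (by exact_mod_cast h)
      · exact stairCoord_eq_zero_of_le (by exact_mod_cast h)
    simp [this]
  · intro h
    exact absurd (Finset.mem_range.2 (Nat.lt_succ_of_le hi)) h

/-- The label of a vertex of layer `j`. -/
def layerLabel (j : Fin 3) (k : ℕ) (hk : k < 16) : Fin 48 := ⟨16 * j + k, by omega⟩

theorem coe_layerLabel (j : Fin 3) (k : ℕ) (hk : k < 16) :
    (layerLabel j k hk : ℕ) = 16 * j + k := rfl

theorem stairPoint_torusLabel (hR : ∀ S, setMask (R S) = ρ (setMask S)) (hRR : ∀ S, R (R S) = S)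
    (x : StdSphere 2) (τ : ℝ) (j : Fin 3) (T : Finset (Fin 4)) :
    stairPoint 48 3 (torusLabel ρ) (x, τ) (layerLabel j (setMask T) (setMask_lt T)) =
      stairCoord x τ j T + if j = 0 then stairCoord x τ 3 (R T) else 0 := by
  have h3 : (∑ S, if ρ (setMask S) = 16 * (j : ℕ) + setMask T then stairCoord x τ 3 S else 0) =
      if j = 0 then stairCoord x τ 3 (R T) else 0 := by
    have := sum_ite_setMask 0 j T fun S => stairCoord x τ 3 (R S)
    rw [← Equiv.sum_comp (⟨R, R, hRR, hRR⟩ : Equiv.Perm (Finset (Fin 4)))] at this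
    simp only [Equiv.coe_fn_mk, hRR, hR, mul_zero, zero_add] at this
    rw [this]
    simp only [eq_comm (a := 0), Fin.val_eq_zero_iff]
  have e0 : ∀ k, torusLabel ρ 0 k = 16 * 0 + k := fun _ => rfl
  have e1 : ∀ k, torusLabel ρ 1 k = 16 * 1 + k := fun _ => rfl
  have e2 : ∀ k, torusLabel ρ 2 k = 16 * 2 + k := fun _ => rfl
  have e3 : ∀ k, torusLabel ρ 3 k = ρ k := fun _ => rfl
  rw [stairPoint]
  simp only [Finset.sum_range_succ, Finset.sum_range_zero, coe_layerLabel, e0, e1, e2, e3, h3,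
    sum_ite_setMask]
  fin_cases j <;> simp

theorem stairPoint_projectiveLabel (x : StdSphere 2) (τ : ℝ) (j : Fin 3) (T : Finset (Fin 4)) :
    stairPoint 48 3 projectiveLabel (x, τ) (layerLabel j (setRank T) (setRank_lt T)) =
      stairCoord x τ j T + stairCoord x τ j Tᶜ +
        if j = 0 then stairCoord x τ 3 T + stairCoord x τ 3 Tᶜ else 0 := by
  have e : ∀ i S, projectiveLabel i (setMask S) = 16 * (i % 3) + setRank S := fun i S => rfl
  rw [stairPoint]
  simp only [Finset.sum_range_succ, Finset.sum_range_zero, coe_layerLabel, e, sum_ite_setRank]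
  fin_cases j <;> simp

theorem stairPoint_doubleLabel (x : StdSphere 2) (τ : ℝ) (T : Finset (Fin 4)) :
    stairPoint 48 2 doubleLabel (x, τ) (layerLabel 0 (setRank T) (setRank_lt T)) =
      stairCoord x τ 0 T + stairCoord x τ 0 Tᶜ ∧
    stairPoint 48 2 doubleLabel (x, τ) (layerLabel 1 (setMask T) (setMask_lt T)) =
      stairCoord x τ 1 T ∧
    stairPoint 48 2 doubleLabel (x, τ) (layerLabel 2 (setRank T) (setRank_lt T)) =
      stairCoord x τ 2 T + stairCoord x τ 2 Tᶜ := by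
  have e0 : ∀ S, doubleLabel 0 (setMask S) = 16 * 0 + setRank S := fun _ => rfl
  have e1 : ∀ S, doubleLabel 1 (setMask S) = 16 * 1 + setMask S := fun _ => rfl
  have e2 : ∀ S, doubleLabel 2 (setMask S) = 16 * 2 + setRank S := fun _ => rfl
  have n1 : ∀ (S : Finset (Fin 4)), 16 * 1 + setMask S ≠ 16 * 0 + setRank T := fun S => by
    have := setRank_lt T; omega
  have n2 : ∀ (S : Finset (Fin 4)), 16 * 1 + setMask S ≠ 16 * 2 + setRank T := fun S => by
    have := setMask_lt S; omega
  have n3 : ∀ (S : Finset (Fin 4)), 16 * 0 + setRank S ≠ 16 * 1 + setMask T := fun S => by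
    have := setRank_lt S; omega
  have n4 : ∀ (S : Finset (Fin 4)), 16 * 2 + setRank S ≠ 16 * 1 + setMask T := fun S => by
    have := setMask_lt T; omega
  refine ⟨?_, ?_, ?_⟩ <;> rw [stairPoint] <;>
    simp only [Finset.sum_range_succ, Finset.sum_range_zero, coe_layerLabel, e0, e1, e2,
      Fin.val_zero, Fin.val_one, Fin.val_two, n1, n2, n3, n4, if_false, Finset.sum_const_zero,
      sum_ite_setRank, sum_ite_setMask] <;> simp

theorem layerWeight_eq_sum (x : StdSphere 2) (τ : ℝ) (j : ℕ) :
    layerWeight τ j = ∑ S, stairCoord x τ j S := (sum_stairCoord x τ j).symm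

/-- Layer weights first determine the height, up to exchanging the ends. At a common height the
spherical coordinates are recovered layer by layer; at opposite ends the shared labels compare layer
3 with layer 0 through `R`, which is the action of `f`. -/
theorem torusFiber_of_stairPoint_eq {f : StdSphere 2 → StdSphere 2}
    (hf : ∀ x S, sphereCoord (f x) S = sphereCoord x (R S))
    (hR : ∀ S, setMask (R S) = ρ (setMask S)) (hRR : ∀ S, R (R S) = S)
    {x x' : StdSphere 2} {τ τ' : ℝ} (h0 : 0 ≤ τ) (h3 : τ ≤ 3) (h0' : 0 ≤ τ') (h3' : τ' ≤ 3)
    (h : stairPoint 48 3 (torusLabel ρ) (x, τ) = stairPoint 48 3 (torusLabel ρ) (x', τ')) :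
    (x = x' ∧ τ = τ') ∨ (τ = 3 ∧ τ' = 0 ∧ x' = f x) ∨ (τ = 0 ∧ τ' = 3 ∧ x = f x') := by
  have hl : ∀ (j : Fin 3) T, stairCoord x τ j T + (if j = 0 then stairCoord x τ 3 (R T) else 0) =
      stairCoord x' τ' j T + if j = 0 then stairCoord x' τ' 3 (R T) else 0 := fun j T => by
    rw [← stairPoint_torusLabel hR hRR, ← stairPoint_torusLabel hR hRR, h]
  have hl0 : ∀ T, stairCoord x τ 0 T + stairCoord x τ 3 (R T) =
    stairCoord x' τ' 0 T + stairCoord x' τ' 3 (R T) := fun T => by simpa using hl 0 T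
  have hl1 : ∀ T, stairCoord x τ 1 T = stairCoord x' τ' 1 T := fun T => by simpa using hl 1 T
  have hl2 : ∀ T, stairCoord x τ 2 T = stairCoord x' τ' 2 T := fun T => by simpa using hl 2 T
  have hends : ∀ {u v : StdSphere 2}, (∀ T, stairCoord u 3 0 T + stairCoord u 3 3 (R T) =
      stairCoord v 0 0 T + stairCoord v 0 3 (R T)) → v = f u := by
    intro u v huv
    refine sphereCoord_injective (funext fun T => ?_)
    have := huv T
    have e1 := stairCoord_self u 3 (R T)
    have e2 := stairCoord_self v 0 T
    push_cast at e1 e2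
    rw [e1, e2, stairCoord_eq_zero_of_ge (by norm_num), stairCoord_eq_zero_of_le (by norm_num),
      zero_add, add_zero] at this
    rw [hf, this]
  rcases eq_or_of_layerWeight h0 h3 h0' h3'
    (by rw [layerWeight_eq_sum x, layerWeight_eq_sum x']; simp only [hl1])
    (by rw [layerWeight_eq_sum x, layerWeight_eq_sum x']; simp only [hl2])
    with rfl | ⟨rfl, rfl⟩ | ⟨rfl, rfl⟩
  · refine Or.inl ⟨sphereCoord_injective (funext fun T => ?_), rfl⟩
    have e := fun y => sum_range_stairCoord y (m := 3) h0 (by exact_mod_cast h3) T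
    -- Layers 0 and 3 share labels but are never occupied at the same height, so the shared
    -- coordinate can be attributed to one of them.
    have key : stairCoord x τ 0 T = stairCoord x' τ 0 T ∧
        stairCoord x τ 3 T = stairCoord x' τ 3 T := by
      rcases le_total τ 2 with h2 | h2
      · have hz : ∀ y S, stairCoord y τ 3 S = 0 := fun y S =>
          stairCoord_eq_zero_of_le (by norm_num; linarith)
        have := hl0 T
        simp only [hz, add_zero] at this ⊢
        exact ⟨this, trivial⟩
      · have hz : ∀ y S, stairCoord y τ 0 S = 0 := fun y S =>
          stairCoord_eq_zero_of_ge (by norm_num; linarith)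
        have := hl0 (R T)
        simp only [hz, zero_add, hRR] at this ⊢
        exact ⟨trivial, this⟩
    rw [← e x, ← e x']
    simp only [Finset.sum_range_succ, Finset.sum_range_zero, key, hl1, hl2]
  · exact Or.inr (Or.inl ⟨rfl, rfl, hends hl0⟩)
  · exact Or.inr (Or.inr ⟨rfl, rfl, hends fun T => (hl0 T).symm⟩)

theorem stairPoint_torusLabel_three {f : StdSphere 2 → StdSphere 2}
    (hf : ∀ x S, sphereCoord (f x) S = sphereCoord x (R S))
    (hR : ∀ S, setMask (R S) = ρ (setMask S)) (hRR : ∀ S, R (R S) = S) (x : StdSphere 2) :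
    stairPoint 48 3 (torusLabel ρ) (x, 3) = stairPoint 48 3 (torusLabel ρ) (f x, 0) := by
  funext l
  have h3 := stairPoint_nat (N := 48) (m := 3) (q := torusLabel ρ) x (i := 3) le_rfl l
  have h0 := stairPoint_nat (N := 48) (m := 3) (q := torusLabel ρ) (f x) (i := 0) (by norm_num) l
  have e0 : ∀ k, torusLabel ρ 0 k = k := fun k => by simp [torusLabel]
  have e3 : ∀ k, torusLabel ρ 3 k = ρ k := fun _ => rfl
  push_cast at h0 h3
  rw [h0, h3, ← Equiv.sum_comp (⟨R, R, hRR, hRR⟩ : Equiv.Perm (Finset (Fin 4)))]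
  simp only [Equiv.coe_fn_mk, e0, e3, hf, ← hR, hRR]

/-- Every label records the sum over a complementary pair. Summing over the layers yields the
symmetrized spherical coordinates, hence the point up to sign, while the layer weights yield the
height. -/
theorem projectiveFiber_of_stairPoint_eq {x x' : StdSphere 2} {τ τ' : ℝ} (h0 : 0 ≤ τ) (h3 : τ ≤ 3)
    (h0' : 0 ≤ τ') (h3' : τ' ≤ 3)
    (h : stairPoint 48 3 projectiveLabel (x, τ) = stairPoint 48 3 projectiveLabel (x', τ')) :
    (x = x' ∨ x = -x') ∧ (τ = τ' ∨ (τ = 3 ∧ τ' = 0) ∨ (τ = 0 ∧ τ' = 3)) := by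
  have hl : ∀ (j : Fin 3) T, stairCoord x τ j T + stairCoord x τ j Tᶜ +
      (if j = 0 then stairCoord x τ 3 T + stairCoord x τ 3 Tᶜ else 0) =
      stairCoord x' τ' j T + stairCoord x' τ' j Tᶜ +
      if j = 0 then stairCoord x' τ' 3 T + stairCoord x' τ' 3 Tᶜ else 0 := fun j T => by
    rw [← stairPoint_projectiveLabel, ← stairPoint_projectiveLabel, h]
  have hl0 := hl 0
  have hl1 := hl 1
  have hl2 := hl 2
  simp only [if_true, Fin.val_zero, Fin.val_one, Fin.val_two, Fin.reduceEq, if_false, add_zero,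
    one_ne_zero] at hl0 hl1 hl2
  have hw : ∀ (y : StdSphere 2) t j, layerWeight t j =
      2⁻¹ * ∑ S, (stairCoord y t j S + stairCoord y t j Sᶜ) := fun y t j => by
    rw [Finset.sum_add_distrib, sum_compl, ← two_mul, inv_mul_cancel_left₀ two_ne_zero,
      layerWeight_eq_sum]
  constructor
  · refine eq_or_eq_neg_of_sphereCoord_add fun T => ?_
    have e := fun T => sum_range_stairCoord x (m := 3) h0 (by exact_mod_cast h3) T
    have e' := fun T => sum_range_stairCoord x' (m := 3) h0' (by exact_mod_cast h3') T
    rw [← e, ← e, ← e', ← e']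
    simp only [Finset.sum_range_succ, Finset.sum_range_zero]
    linarith [hl0 T, hl1 T, hl2 T]
  · refine eq_or_of_layerWeight h0 h3 h0' h3' ?_ ?_ <;> rw [hw x, hw x']
    · simp only [hl1]
    · simp only [hl2]

theorem stairPoint_projectiveLabel_neg (x : StdSphere 2) (τ : ℝ) :
    stairPoint 48 3 projectiveLabel (-x, τ) = stairPoint 48 3 projectiveLabel (x, τ) := by
  funext l
  refine Finset.sum_congr rfl fun j _ => ?_
  have e : ∀ S, projectiveLabel j (setMask Sᶜ) = projectiveLabel j (setMask S) := fun S =>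
    congrArg (16 * (j % 3) + ·) (setRank_compl S)
  simp only [stairCoord_neg]
  rw [← sum_compl]
  simp only [e, compl_compl]

theorem stairPoint_projectiveLabel_three (x : StdSphere 2) :
    stairPoint 48 3 projectiveLabel (x, 3) = stairPoint 48 3 projectiveLabel (x, 0) := by
  funext l
  have h3 := stairPoint_nat (N := 48) (m := 3) (q := projectiveLabel) x (i := 3) le_rfl l
  have h0 := stairPoint_nat (N := 48) (m := 3) (q := projectiveLabel) x (i := 0) (by norm_num) l
  push_cast at h0 h3
  rw [h0, h3]
  rfl

/-- As in the projective case, height and point up to sign are determined. The middle layer keeps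
complementary sets apart, which excludes a nontrivial sign away from the ends. -/
theorem doubleFiber_of_stairPoint_eq {x x' : StdSphere 2} {τ τ' : ℝ} (h0 : 0 ≤ τ) (h2 : τ ≤ 2)
    (h0' : 0 ≤ τ') (h2' : τ' ≤ 2)
    (h : stairPoint 48 2 doubleLabel (x, τ) = stairPoint 48 2 doubleLabel (x', τ')) :
    τ = τ' ∧ (x = x' ∨ (τ = 0 ∨ τ = 2) ∧ x = -x') := by
  have hl0 : ∀ T, stairCoord x τ 0 T + stairCoord x τ 0 Tᶜ =
      stairCoord x' τ' 0 T + stairCoord x' τ' 0 Tᶜ := fun T => by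
    rw [← (stairPoint_doubleLabel x τ T).1, ← (stairPoint_doubleLabel x' τ' T).1, h]
  have hl1 : ∀ T, stairCoord x τ 1 T = stairCoord x' τ' 1 T := fun T => by
    rw [← (stairPoint_doubleLabel x τ T).2.1, ← (stairPoint_doubleLabel x' τ' T).2.1, h]
  have hl2 : ∀ T, stairCoord x τ 2 T + stairCoord x τ 2 Tᶜ =
      stairCoord x' τ' 2 T + stairCoord x' τ' 2 Tᶜ := fun T => by
    rw [← (stairPoint_doubleLabel x τ T).2.2, ← (stairPoint_doubleLabel x' τ' T).2.2, h]
  have hw : ∀ (y : StdSphere 2) t j, layerWeight t j =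
      2⁻¹ * ∑ S, (stairCoord y t j S + stairCoord y t j Sᶜ) := fun y t j => by
    rw [Finset.sum_add_distrib, sum_compl, ← two_mul, inv_mul_cancel_left₀ two_ne_zero,
      layerWeight_eq_sum]
  obtain rfl : τ = τ' := eq_of_layerWeight h0 h2 h0' h2'
    (by rw [hw x, hw x']; simp only [hl0]) (by rw [hw x, hw x']; simp only [hl1])
  refine ⟨rfl, ?_⟩
  have hpm : x = x' ∨ x = -x' := by
    refine eq_or_eq_neg_of_sphereCoord_add fun T => ?_
    have e := fun y T => sum_range_stairCoord y (m := 2) h0 (by exact_mod_cast h2) T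
    rw [← e x, ← e x, ← e x', ← e x']
    simp only [Finset.sum_range_succ, Finset.sum_range_zero]
    linarith [hl0 T, hl1 T, hl1 Tᶜ, hl2 T]
  rcases hpm with hpm | hpm
  · exact Or.inl hpm
  refine Or.inr ⟨?_, hpm⟩
  by_contra hn
  rw [not_or] at hn
  -- Strictly between the ends the middle layer carries weight, so some `S` is occupied there. For
  -- antipodal points both `S` and its complement would then have nonzero coordinates at the same
  -- point of the sphere.
  have hw1 : layerWeight τ 1 ≠ 0 := by
    rcases le_total τ 1 with h1 | h1
    · rw [layerWeight_of_mem' (by norm_num; linarith) (by norm_num; linarith)]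
      norm_num [hn]
    · rw [layerWeight_of_mem (by norm_num; linarith) (by norm_num; linarith)]
      intro h
      norm_num at h
      exact hn.2 (by linarith)
  refine hw1 ?_
  rw [layerWeight_eq_sum x]
  refine Finset.sum_eq_zero fun S _ => ?_
  by_contra hS
  have k1 : sphereCoord x S ≠ 0 := fun h => hS (stairCoord_eq_zero_of_sphereCoord h _ _)
  have k2 : sphereCoord x' S ≠ 0 := fun h => hS ((hl1 S).trans
    (stairCoord_eq_zero_of_sphereCoord h _ _))
  rw [hpm, sphereCoord_neg] at k1
  exact k1 (sphereCoord_compl_eq_zero k2)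

theorem stairPoint_doubleLabel_neg (x : StdSphere 2) {i : ℕ} (hi : i = 0 ∨ i = 2) :
    stairPoint 48 2 doubleLabel (-x, i) = stairPoint 48 2 doubleLabel (x, i) := by
  funext l
  have e : ∀ S, doubleLabel i (setMask Sᶜ) = doubleLabel i (setMask S) := fun S => by
    rcases hi with rfl | rfl
    · exact congrArg (16 * 0 + ·) (setRank_compl S)
    · exact congrArg (16 * 2 + ·) (setRank_compl S)
  rw [stairPoint_nat _ (by omega), stairPoint_nat _ (by omega), ← sum_compl]
  simp only [e, sphereCoord_neg, compl_compl]

end Labels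


/-! ### Quotients with equal fibers are homeomorphic -/

theorem nonempty_homeomorph_of_fibers {Z X Y : Type*} [TopologicalSpace Z] [TopologicalSpace X]
    [TopologicalSpace Y] {p : Z → X} {q : Z → Y} (hp : Topology.IsQuotientMap p)
    (hq : Topology.IsQuotientMap q) (h : ∀ a b, p a = p b ↔ q a = q b) : Nonempty (X ≃ₜ Y) := by
  have hker : Setoid.ker p = Setoid.ker q := Setoid.ext h
  have e : Quotient (Setoid.ker p) ≃ₜ Quotient (Setoid.ker q) := by
    rw [hker]; exact Homeomorph.refl _
  have ep : Quotient (Setoid.ker p) ≃ₜ X := Topology.IsQuotientMap.homeomorph (f := ⟨p, hp.continuous⟩) hp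
  have eq : Quotient (Setoid.ker q) ≃ₜ Y := Topology.IsQuotientMap.homeomorph (f := ⟨q, hq.continuous⟩) hq
  exact ⟨(ep.symm.trans e).trans eq⟩

theorem isQuotientMap_of_compact {Z X : Type*} [TopologicalSpace Z] [CompactSpace Z]
    [TopologicalSpace X] [T2Space X] {p : Z → X} (hp : Continuous p)
    (hs : Function.Surjective p) : Topology.IsQuotientMap p :=
  hp.isClosedMap.isQuotientMap hp hs

/-- `stairPoint`, rescaled to `[0, 1]`, is a continuous surjection from a compact space onto a
Hausdorff one, hence a quotient map. Comparing fibers is then all that remains. -/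
theorem nonempty_homeomorph_staircase {m : ℕ} (hm : 0 < m) {q : ℕ → ℕ → ℕ}
    (hq : ∀ j ≤ m, ∀ S < 16, q j S < 48) {X : Type*} [TopologicalSpace X]
    {p : StdSphere 2 × unitInterval → X} (hp : Topology.IsQuotientMap p)
    (h : ∀ a b, stairPoint 48 m q (a.1, m * a.2) = stairPoint 48 m q (b.1, m * b.2) ↔ p a = p b) :
    Nonempty (Realization (maskFamily 48 (staircase m q)) ≃ₜ X) := by
  have hm' : (0 : ℝ) < m := Nat.cast_pos.2 hm
  set P : StdSphere 2 × unitInterval → Realization (maskFamily 48 (staircase m q)) := fun a =>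
    ⟨stairPoint 48 m q (a.1, m * a.2), stairPoint_mem hq (mul_nonneg hm'.le a.2.2.1)
      (mul_le_of_le_one_right hm'.le a.2.2.2) hm⟩ with hP
  refine nonempty_homeomorph_of_fibers (p := P) (isQuotientMap_of_compact ?_ ?_) hp fun a b => ?_
  · exact (continuous_stairPoint.comp (by fun_prop)).subtype_mk _
  · rintro ⟨z, hz⟩
    obtain ⟨x, τ, h0, h1, rfl⟩ := exists_stairPoint_eq hq hz
    refine ⟨(x, ⟨τ / m, div_nonneg h0 hm'.le, div_le_one_of_le₀ h1 hm'.le⟩), Subtype.ext ?_⟩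
    simp only [hP]
    rw [mul_div_cancel₀ _ hm'.ne']
  · rw [← h, hP, Subtype.mk.injEq]

theorem unitInterval_bounds {m : ℝ} (hm : 0 ≤ m) (s : unitInterval) : 0 ≤ m * s ∧ m * s ≤ m :=
  ⟨mul_nonneg hm s.2.1, mul_le_of_le_one_right hm s.2.2⟩

theorem three_mul_eq_iff {s : unitInterval} : (3 * (s : ℝ) = 3 ↔ s = 1) ∧ (3 * (s : ℝ) = 0 ↔ s = 0) := by
  constructor
  · rw [mul_eq_left₀ (by norm_num)]; exact Set.Icc.coe_eq_one
  · simp [Set.Icc.coe_eq_zero]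

theorem nonempty_homeomorph_torus {ρ : ℕ → ℕ} {R : Finset (Fin 4) → Finset (Fin 4)}
    {f : StdSphere 2 → StdSphere 2} (hρ : ∀ S < 16, ρ S < 16)
    (hf : ∀ x S, sphereCoord (f x) S = sphereCoord x (R S))
    (hR : ∀ S, setMask (R S) = ρ (setMask S)) (hRR : ∀ S, R (R S) = S)
    {X : Type*} [TopologicalSpace X] {p : StdSphere 2 × unitInterval → X}
    (hp : Topology.IsQuotientMap p) (h : ∀ a b, p a = p b ↔ TorusFiber f a b) :
    Nonempty (Realization (maskFamily 48 (staircase 3 (torusLabel ρ))) ≃ₜ X) := by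
  refine nonempty_homeomorph_staircase (by norm_num) (torusLabel_lt hρ) hp fun a b => ?_
  rw [h]
  obtain ⟨x, s⟩ := a
  obtain ⟨y, t⟩ := b
  obtain ⟨s0, s3⟩ := unitInterval_bounds (m := 3) (by norm_num) s
  obtain ⟨t0, t3⟩ := unitInterval_bounds (m := 3) (by norm_num) t
  have key := stairPoint_torusLabel_three hf hR hRR
  simp only [Nat.cast_ofNat]
  constructor
  · intro he
    rcases torusFiber_of_stairPoint_eq hf hR hRR s0 s3 t0 t3 he with ⟨h1, h2⟩ | ⟨h1, h2, h3⟩ |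
      ⟨h1, h2, h3⟩
    · exact Or.inl (Prod.ext h1 (Subtype.ext (mul_left_cancel₀ (by norm_num) h2)))
    · exact Or.inr (Or.inl ⟨three_mul_eq_iff.1.1 h1, three_mul_eq_iff.2.1 h2, h3⟩)
    · exact Or.inr (Or.inr ⟨three_mul_eq_iff.2.1 h1, three_mul_eq_iff.1.1 h2, h3⟩)
  · rintro (h1 | ⟨h1, h2, h3⟩ | ⟨h1, h2, h3⟩)
    · rw [Prod.mk.injEq] at h1
      rw [h1.1, h1.2]
    · simp only at h1 h2 h3
      rw [three_mul_eq_iff.1.2 h1, three_mul_eq_iff.2.2 h2, h3, key]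
    · simp only at h1 h2 h3
      rw [three_mul_eq_iff.2.2 h1, three_mul_eq_iff.1.2 h2, h3, key]

theorem nonempty_homeomorph_twisted {X : Type*} [TopologicalSpace X]
    {p : StdSphere 2 × unitInterval → X} (hp : Topology.IsQuotientMap p)
    (h : ∀ a b, p a = p b ↔ TorusFiber (sphereMap reflectionR3) a b) :
    Nonempty (Realization (maskFamily 48 (staircase 3 (torusLabel swapMask))) ≃ₜ X) :=
  nonempty_homeomorph_torus (R := swapSet) (by decide) sphereCoord_reflection setMask_swapSet
    swapSet_swapSet hp h

theorem nonempty_homeomorph_product {X : Type*} [TopologicalSpace X]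
    {p : StdSphere 2 × unitInterval → X} (hp : Topology.IsQuotientMap p)
    (h : ∀ a b, p a = p b ↔ TorusFiber id a b) :
    Nonempty (Realization (maskFamily 48 (staircase 3 (torusLabel id))) ≃ₜ X) :=
  nonempty_homeomorph_torus (R := id) (fun _ h => h) (fun _ _ => rfl) (fun _ => rfl)
    (fun _ => rfl) hp h

theorem nonempty_homeomorph_projective {X : Type*} [TopologicalSpace X]
    {p : StdSphere 2 × unitInterval → X} (hp : Topology.IsQuotientMap p)
    (h : ∀ a b, p a = p b ↔ ProjectiveFiber a b) :
    Nonempty (Realization (maskFamily 48 (staircase 3 projectiveLabel)) ≃ₜ X) := by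
  refine nonempty_homeomorph_staircase (by norm_num) projectiveLabel_lt hp fun a b => ?_
  rw [h]
  obtain ⟨x, s⟩ := a
  obtain ⟨y, t⟩ := b
  obtain ⟨s0, s3⟩ := unitInterval_bounds (m := 3) (by norm_num) s
  obtain ⟨t0, t3⟩ := unitInterval_bounds (m := 3) (by norm_num) t
  simp only [Nat.cast_ofNat]
  constructor
  · intro he
    obtain ⟨h1, h2⟩ := projectiveFiber_of_stairPoint_eq s0 s3 t0 t3 he
    refine ⟨h1, ?_⟩
    rcases h2 with h2 | ⟨h1, h2⟩ | ⟨h1, h2⟩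
    · exact Or.inl (Subtype.ext (mul_left_cancel₀ (by norm_num) h2))
    · exact Or.inr (Or.inl ⟨three_mul_eq_iff.1.1 h1, three_mul_eq_iff.2.1 h2⟩)
    · exact Or.inr (Or.inr ⟨three_mul_eq_iff.2.1 h1, three_mul_eq_iff.1.1 h2⟩)
  · rintro ⟨h1, h2⟩
    simp only at h1 h2
    have e : ∀ τ, stairPoint 48 3 projectiveLabel (x, τ) = stairPoint 48 3 projectiveLabel (y, τ) := by
      intro τ
      rcases h1 with rfl | rfl
      · rfl
      · exact stairPoint_projectiveLabel_neg y τ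
    rw [e]
    rcases h2 with rfl | ⟨h1, h2⟩ | ⟨h1, h2⟩
    · rfl
    · rw [three_mul_eq_iff.1.2 h1, three_mul_eq_iff.2.2 h2, stairPoint_projectiveLabel_three]
    · rw [three_mul_eq_iff.2.2 h1, three_mul_eq_iff.1.2 h2, stairPoint_projectiveLabel_three]

theorem nonempty_homeomorph_double {X : Type*} [TopologicalSpace X]
    {p : StdSphere 2 × unitInterval → X} (hp : Topology.IsQuotientMap p)
    (h : ∀ a b, p a = p b ↔ DoubleFiber a b) :
    Nonempty (Realization (maskFamily 48 (staircase 2 doubleLabel)) ≃ₜ X) := by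
  refine nonempty_homeomorph_staircase (by norm_num) doubleLabel_lt hp fun a b => ?_
  rw [h]
  obtain ⟨x, s⟩ := a
  obtain ⟨y, t⟩ := b
  obtain ⟨s0, s2⟩ := unitInterval_bounds (m := 2) (by norm_num) s
  obtain ⟨t0, t2⟩ := unitInterval_bounds (m := 2) (by norm_num) t
  simp only [Nat.cast_ofNat]
  constructor
  · intro he
    obtain ⟨h1, h2⟩ := doubleFiber_of_stairPoint_eq s0 s2 t0 t2 he
    obtain rfl : s = t := Subtype.ext (mul_left_cancel₀ (by norm_num) h1)
    rcases h2 with h2 | ⟨h2 | h2, h3⟩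
    · exact Or.inl (Prod.ext h2 rfl)
    · exact Or.inr ⟨rfl, Or.inl (by simpa [Set.Icc.coe_eq_zero] using h2), h3⟩
    · refine Or.inr ⟨rfl, Or.inr ?_, h3⟩
      rw [mul_eq_left₀ (by norm_num)] at h2
      exact Set.Icc.coe_eq_one.1 h2
  · rintro (h1 | ⟨h1, h2, h3⟩)
    · rw [Prod.mk.injEq] at h1
      rw [h1.1, h1.2]
    · simp only at h1 h2 h3
      have k0 := stairPoint_doubleLabel_neg y (i := 0) (Or.inl rfl)
      have k2 := stairPoint_doubleLabel_neg y (i := 2) (Or.inr rfl)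
      push_cast at k0 k2
      subst h1 h3
      rcases h2 with rfl | rfl
      · simpa using k0
      · simpa using k2


/-! ### Flip certificates for the four complexes -/

set_option maxRecDepth 100000
-- Masks of the faces to be removed, in order; triangles, edges and vertices occur. Nothing about
-- the list is assumed, since each flip is tested when it is run.
def twistedFlips : List ℕ :=
  [524298, 12582976, 33556992, 20, 142606336, 16777218, 17661173956608, 1610612736, 2199023256832,
   42949672968, 524298, 524290, 524296, 2176, 524292, 2199023256576, 2199023255808, 2207613190144,
   2097200, 824637915136, 34360393728, 2097184, 34359869440, 549760008192, 274882101248, 2097168,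
   34360262656, 34360000512, 1077936128, 5497625247744, 4398113619968, 1099578736640,
   46179488366592, 135004160, 33563136, 33554944, 10995116277760, 786432, 2199157473280,
   37383395344384, 2199023255552, 134742016, 524288, 33556480, 33562624, 1099561959424, 50331648,
   33554434, 33554432, 137442099200, 5242896, 83887104, 5242880, 4194320, 4456448, 4194304,
   16778240, 67109888, 137440002048, 1028, 137441050624, 8589952000, 35184372090880, 17664,
   67371012, 51539607560, 9380208574464, 274879217664, 146028888128, 269488128, 8396832,
   146029019136, 17592186048768, 70643622084640, 8388676, 549758042112, 17592991350784,
   70368744178178, 4415226642432, 4398046511872, 16779776, 12544, 35184372093184, 687865856,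
   8388620, 553656320, 538976256, 105553116270592, 75866302316544, 35192962024448, 2060,
   9345857224704, 134234112, 268439552, 17592186044672, 68, 2105344, 35184372092928, 550829555712,
   35734127902720, 258, 8396800, 70368744177666, 8724152320, 274877906976, 1280, 8830452760576,
   8388616, 35184372088960, 1073742080, 4398046773248, 584115552256, 268435458, 393216,
   51539607552, 34359738368, 2176, 35184372089856, 1024, 8388640, 17592186048512, 274877907072,
   671088640, 17592454479872, 4352, 545259520, 79164837199872, 1052672, 35184372090880,
   17593259786240, 70643622084608, 4398180728832, 17592722915328, 16781312, 4096, 8388672, 8448,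
   18691697672192, 17660905521152, 17592186044416, 67110916, 67110912, 67108868, 83886080,
   67108864, 262148, 8388612, 805314560, 268443648, 536879104, 268451840, 70437463654432,
   17179869200, 68719476816, 80, 68719476800, 137438953536, 64, 549766299648, 549757911040,
   10485760, 2097152, 9345857224704, 8796101410816, 549764202496, 822083584, 553648128, 805306368,
   285212672, 268435456, 536870914, 134217740, 2176, 134217740, 12, 134217732, 4, 8589934600,
   17179869192, 8, 292058038272, 687731638272, 146029019136, 137975824384, 137439084544,
   292057776128, 146028888064, 137438953472, 35184908959744, 8590065664, 17180131328,
   343597383680, 274877906944, 1100048498688, 536870912, 8519682, 8519680, 131074, 1099511627778,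
   1099528404992, 1090519040, 35253091565584, 70368744177792, 17833984, 16386, 74767864430592,
   1168232153088, 74766790689280, 1099512676352, 74766790688768, 4399120252928, 1099645845504,
   5497558138880, 4398046511104, 70369817919488, 8796093022720, 68720525312, 8796227239936, 2562,
   514, 2560, 8704, 512, 134219778, 70368744185888, 1168231235584, 2050, 70368744177696, 8224,
   1099511758848, 68719607808, 34, 32, 134219776, 8388738, 134217744, 16779520, 2304, 16779264,
   2176, 2048, 16777472, 70368760954880, 70368744185856, 70368744194304, 16640, 70368744177920,
   256, 8796093038592, 71468255805440, 9895604649984, 1099511627776, 8804682956800,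
   70368744194048, 70368744177664, 68719476752, 1056770, 1056768, 8194, 8192, 17179869186,
   150994946, 134217730, 16777218, 2, 8388624, 35210141892608, 9453568, 35802847379456,
   35253091565568, 68719476736, 25769803776, 8589934592, 9437184, 8388608, 16793616, 17180917760,
   43981538852864, 17180000256, 16777360, 16777232, 16528, 35184373137408, 17825920, 16528,
   9345848967168, 16400, 16, 16777344, 16777216, 35184372350976, 43981538852864, 43980465111040,
   9346922577920, 8797166764032, 8796093022208, 1074921472, 549890031616, 18253742080, 1209008128,
   17180917888, 35184506306560, 17180000256, 147456, 1074921472, 35185446092800, 35202625699840,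
   35184372350976, 1179648, 131200, 17180934144, 18253742080, 549890293760, 549890031616,
   35184506306560, 17180000256, 17180917888, 35184506306560, 1074921472, 549890031616,
   35185446092800, 17180000256, 1074921472, 549890031616, 1074921472, 35734128164864, 17180917888,
   17180000256, 549890031616, 35184506306560, 17180917888, 1074921472, 35185446092800,
   35184506306560, 549890031616, 35184372350976, 1209008128, 566935814144, 17180917888,
   1207959552, 35184372350976, 35184506306560, 134496256, 566935814144, 17180917888,
   35184506306560, 17180000256, 131200, 134496256, 17180934144, 35201551974400, 17180917760,
   549890031616, 134479872, 35184506322944, 147584, 409600, 17180917760, 131200, 1207959552,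
   135528448, 35184506322944, 35734128164864, 17180000256, 134479872, 35184506306560, 135266432,
   17180000256, 135266432, 135266304, 134217728]

def productFlips : List ℕ :=
  [75866302316544, 1073742080, 584116076544, 269488128, 42949672968, 34359738376, 549756338176,
   17179869192, 8589934600, 268439552, 1052672, 34360262656, 16781312, 8796093546496, 140, 136,
   687196864512, 1179648, 2207613190656, 9175040, 28672, 131076, 20480, 12288, 43980465111040,
   70368744181760, 4096, 274882363392, 274877907136, 42949673088, 85899345920, 274882101248,
   274878955520, 34359738496, 274878169088, 10995116278272, 2199023256064, 35184372089344,
   8796093022720, 1358954496, 1099511644160, 137442099200, 550292684800, 33556992, 33556480,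
   33554944, 33562624, 11003706212352, 655362, 8390664, 8390656, 655360, 8388616, 2207613190144,
   524296, 8, 786432, 524288, 4398113882112, 1207959552, 34360131584, 2816, 10995250495488,
   9345848836096, 8606711808, 2199157473280, 2199056809984, 10995116277760, 2199560126464,
   2199023255552, 601295421440, 264192, 269500416, 1073750016, 4210752, 4194368, 16448, 8388672,
   137442099200, 4210692, 17179869252, 550292684800, 4194308, 17179869248, 274877907008, 68, 64,
   4398247837696, 4398113619968, 4398180728832, 8796227239936, 52776558133264, 14293651161088,
   13194139534336, 4398046512128, 17592186044432, 262400, 8796093023232, 344671125504,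
   343597383680, 275951648768, 274877906944, 70368744195072, 260, 570556416, 1100652478464,
   83887104, 33685504, 1099578736640, 570425344, 33554432, 67109888, 1140850688, 16778240,
   201326596, 264192, 17179870464, 2097200, 83888128, 8396800, 67110912, 67108868, 67108864,
   17179870208, 17179869188, 17179869312, 1028, 1024, 1078984704, 14293651161088, 268460032,
   268451840, 1077936128, 9895604649984, 268443648, 13194139533312, 1099662622720, 2562,
   89060441849856, 87960930222080, 1099645845504, 514, 71468255805440, 134348800, 8704, 512,
   142606336, 5497558138880, 74766790688768, 4398046511104, 8847632629760, 8813272891392,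
   51539607552, 8839042695168, 42949672960, 8830452760576, 34359738368, 8804682956800,
   8796093022208, 17180133376, 8388740, 17592991350784, 8388736, 8388640, 17592722915328, 264192,
   133120, 17179871232, 8388612, 70385924046848, 17179869184, 70369817919488, 17592454479872,
   2097184, 52776558133248, 17592186044416, 151257088, 150994944, 134479872, 134217728, 262148,
   70918499993600, 384, 822083584, 805306368, 285212672, 268435456, 1074004224, 262400,
   1073742080, 69793218560, 137442099200, 550292684800, 70987219468288, 70918499991552,
   70437463654400, 549755815936, 8781824, 393216, 8519680, 70368744179968, 70368744179712, 2052,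
   70368744177920, 70368744177664, 4, 12845056, 8650752, 8388610, 12582912, 8388608, 4456448,
   4194304, 262160, 1090781184, 17039360, 1090519040, 262146, 262144, 1073741824, 18688, 16777344,
   538976256, 2105344, 2097168, 536879104, 553648128, 1099528404992, 17825792, 16793856, 10240,
   16779266, 2050, 16779264, 2048, 16777472, 16777216, 1099511759104, 131328, 1099511628032,
   8590065664, 137442099200, 550292684800, 538968066, 1179648, 137977921536, 36284420587520, 8240,
   36283883716608, 1179648, 8224, 35184908959744, 2228226, 146028888096, 24832, 146028888064,
   558345748480, 8448, 35184372097024, 137438953504, 68719476768, 16640, 48, 32, 131074, 2097154,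
   3145728, 2097152, 1099511758848, 1100049547264, 687194898432, 8210, 35184908959744,
   68719476738, 8194, 8192, 618475421696, 68719607808, 131072, 35184372089104, 206695301120,
   1064976, 558345748480, 137975824384, 272, 755914244096, 1100049547264, 68719477120, 1048704,
   558345748480, 1100048498688, 35253091565824, 35184372089088, 256, 1099512676354, 8589934722,
   35390530519040, 35184372105216, 206158430208, 137438953472, 1099511627778, 1099511627776]

def projectiveFlips : List ℕ :=
  [103079346176, 262150, 8589934628, 6291456, 8590458880, 8589934596, 5373952, 4325376, 8388740,
   72, 10616832, 549755813890, 51539607568, 2097172, 1048596, 20, 17179869200, 34359738384,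
   2097168, 208, 144, 1572868, 524292, 274882363392, 274882101248, 162, 17179869316, 68727865360,
   68727865344, 72, 8598323200, 4194370, 20, 3145732, 1048580, 2097156, 17179869250, 8589934596,
   2359298, 2097154, 10616832, 549755813920, 68720656384, 1179648, 17179869250, 8589934596,
   10616832, 549755813920, 687196864512, 549757911040, 10485760, 2097184, 2097152, 274879479808,
   146028888192, 12845056, 4456448, 274878431232, 137438953600, 274878955520, 42949673088,
   154618953728, 77309411344, 549755813896, 72, 17180000256, 42949673088, 34359738496, 4194370,
   4194368, 13631488, 12582912, 5242880, 4194304, 283468103680, 17180000256, 283468103680,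
   17179869250, 77309411344, 72, 8590196736, 8589934596, 8589934610, 8589934608, 68719476752,
   549765251072, 584115683328, 137439346688, 8590458880, 137439215616, 9437184, 17179869250,
   8589934596, 8650760, 103079477248, 17179869250, 68719738880, 17179869186, 8650752, 34360000512,
   8388628, 20, 1048624, 1048608, 393224, 1048608, 274878038018, 274877906946, 841813590016,
   262272, 131096, 131080, 131120, 154618953728, 17179869376, 137439084544, 131088, 17179869248,
   274877907076, 549755813954, 77309411392, 549755813952, 17179869248, 274877906952, 283467841540,
   68719476928, 549756338180, 68719476864, 274877906948, 524292, 824633720864, 274877906976,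
   8650760, 524292, 70, 292057776256, 111669149696, 66, 549755813952, 42949672960, 292057907200,
   274878038016, 17180000256, 549755813894, 549755813892, 8650768, 584115552264, 8650760, 524292,
   262160, 17180000256, 343597383808, 9437216, 103079739392, 274877907072, 68719476864,
   17180000256, 131088, 893353197568, 824633720832, 343597383680, 274877906944, 56, 103079739392,
   8650760, 48, 524292, 103079215104, 34359738376, 34359738368, 549764202512, 549755813904,
   8388624, 8589934616, 8589934608, 20, 16, 68721049600, 17179869186, 549756600320, 549756338176,
   68720132096, 655360, 68720001024, 549756076034, 549755813890, 68720525316, 549755813890,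
   262178, 131076, 17188388864, 549755813890, 262178, 262146, 77309673472, 77309411328,
   154619871232, 137440002048, 687194767360, 137438953472, 1572872, 262146, 8912904, 549756862468,
   8388620, 68727865344, 524296, 262272, 8912896, 524288]

def doubleFlips : List ℕ :=
  [274911592448, 33685504, 274911461376, 549789368320, 103347650560, 1610612736, 269484036,
   1358954496, 67108884, 268435460, 67108880, 549755813890, 592705486848, 1073872896, 134873088,
   68719476738, 138, 120259084288, 33554438, 130, 85899345920, 33554436, 160, 51539607552, 144,
   192, 128, 566935683072, 805306376, 2228226, 155155693568, 268435464, 17716740096, 536870920,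
   268435458, 545259520, 163208757248, 1073872896, 154618953728, 17180000256, 292057776128,
   17179869184, 50331712, 824637915136, 755914244096, 549760008192, 536870928, 135266304,
   274882101248, 1077936128, 10616832, 103347650560, 695784701952, 34628173824, 549755813890,
   68987912192, 558345748480, 550024249344, 268435456, 146028888064, 42949672960, 77309411328,
   8589934592, 33554450, 33554448, 50331648, 33554432, 687261876224, 549822922752, 549772591104,
   137506062336, 26, 13631488, 4194322, 1048640, 262160, 24, 16777264, 4194322, 9043968, 67371010,
   68720263168, 2097172, 275951910912, 16777284, 150995008, 584115683328, 5242882, 134742020,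
   618476339200, 538968066, 9175040, 540016640, 16777250, 5242944, 585189294080, 9699328,
   34493956096, 8519680, 549760008192, 34359869440, 1073741828, 538968064, 262160, 35433480192,
   2097168, 103079215104, 34359738368, 275951648768, 18, 75497472, 20, 545259520, 142606336,
   549755813892, 262152, 4194320, 5242880, 4194306, 4194304, 412316860416, 536870928,
   137442099200, 137441050624, 2228224, 3145732, 1048656, 549755944964, 3145728, 142606336,
   10485760, 2097152, 131076, 16777296, 80, 1048592, 16, 8388642, 8388620, 201588736, 8388616,
   549772591104, 67371008, 134217740, 1572864, 218103808, 83886080, 67108866, 67108864, 134217740,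
   549764202498, 150995008, 545259520, 1572864, 524320, 8388642, 134217738, 8388676, 134217736,
   12, 8, 8388610, 8388612, 8912896, 549780979712, 262176, 1207959556, 262176, 9699328,
   549755813952, 9699328, 8650752, 549765251072, 549755944962, 1207959556, 1441792, 137976872960,
   135266308, 549755813894, 17039364, 137975824386, 1310722, 671088642, 549755813922, 262146,
   524352, 137455730688, 549755944960, 9437184, 549764202496, 8388608, 524320, 131136, 1179648,
   262176, 137438953504, 131076, 137440002048, 275548995584, 344671125504, 1073741892, 1179648,
   275012124672, 262146, 275414777856, 824633982976, 1224736768, 618475290628, 68719476740,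
   274878169088, 536870944, 275951648768, 274877906944]

/-- A value `some` certifies that every flip passed its test. The starting complexes have 42
vertices for the two mapping tori, 21 for the projective case and 28 for the double. -/
theorem runFlips_twisted : (runFlips 48 (staircase 3 (torusLabel swapMask)) twistedFlips).map
    (maskVertexCount 48) = some 9 := by decide +kernel

theorem runFlips_product : (runFlips 48 (staircase 3 (torusLabel id)) productFlips).map
    (maskVertexCount 48) = some 10 := by decide +kernel

theorem runFlips_projective : (runFlips 48 (staircase 3 projectiveLabel) projectiveFlips).map
    (maskVertexCount 48) = some 14 := by decide +kernel

theorem runFlips_double : (runFlips 48 (staircase 2 doubleLabel) doubleFlips).map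
    (maskVertexCount 48) = some 15 := by decide +kernel


/-! ### Mapping tori and products with the circle -/

theorem equivalence_torusFiber {X : Type*} {f : X → X} (hf : Function.Injective f) :
    Equivalence (TorusFiber f) where
  refl _ := Or.inl rfl
  symm := by
    rintro a b (rfl | ⟨h1, h2, h3⟩ | ⟨h1, h2, h3⟩)
    · exact Or.inl rfl
    · exact Or.inr (Or.inr ⟨h2, h1, h3⟩)
    · exact Or.inr (Or.inl ⟨h2, h1, h3⟩)
  trans := by
    rintro ⟨x, s⟩ ⟨y, t⟩ ⟨z, u⟩ (h | ⟨h1, h2, h3⟩ | ⟨h1, h2, h3⟩) h'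
    · rwa [h]
    · rcases h' with h' | ⟨k1, k2, k3⟩ | ⟨k1, k2, k3⟩
      · rw [← h']; exact Or.inr (Or.inl ⟨h1, h2, h3⟩)
      · exact absurd (h2.symm.trans k1) zero_ne_one
      · exact Or.inl (Prod.ext (hf (h3.symm.trans k3)) (h1.trans k2.symm))
    · rcases h' with h' | ⟨k1, k2, k3⟩ | ⟨k1, k2, k3⟩
      · rw [← h']; exact Or.inr (Or.inr ⟨h1, h2, h3⟩)
      · exact Or.inl (Prod.ext (h3.trans k3.symm) (h1.trans k2.symm))
      · exact absurd (k1.symm.trans h2) zero_ne_one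

/-- For injective `f` the relation `TorusFiber f` is already an equivalence, so generating one from
the gluing adds no further identifications. -/
theorem mappingTorus_mk_eq_iff {X : Type*} {f : X → X} (hf : Function.Injective f)
    (a b : X × unitInterval) :
    Quot.mk (MappingTorusRel f) a = Quot.mk (MappingTorusRel f) b ↔ TorusFiber f a b := by
  constructor
  · intro h
    rw [← (equivalence_torusFiber hf).eqvGen_iff]
    refine Relation.EqvGen.mono ?_ _ _ (Quot.eqvGen_exact h)
    rintro _ _ ⟨x⟩
    exact Or.inr (Or.inl ⟨rfl, rfl, rfl⟩)
  · have glue : ∀ x, Quot.mk (MappingTorusRel f) (x, 1) = Quot.mk (MappingTorusRel f) (f x, 0) :=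
      fun x => Quot.sound (.glue x)
    obtain ⟨x, s⟩ := a
    obtain ⟨y, t⟩ := b
    rintro (h | ⟨h1, h2, h3⟩ | ⟨h1, h2, h3⟩)
    · rw [h]
    · simp only at h1 h2 h3
      subst h1 h2 h3
      exact glue x
    · simp only at h1 h2 h3
      subst h1 h2 h3
      exact (glue y).symm

theorem injective_sphereMap {n : ℕ} (A : Euc (n + 1) ≃ₗᵢ[ℝ] Euc (n + 1)) :
    Function.Injective (sphereMap A) := fun _ _ h =>
  Subtype.ext (A.injective (congrArg Subtype.val h))

/-- Winding the unit interval around the circle. -/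
noncomputable def wind (s : unitInterval) : Circle := Circle.exp (s * (2 * Real.pi))

theorem continuous_wind : Continuous wind := by unfold wind; fun_prop

theorem wind_eq_iff {s t : unitInterval} :
    wind s = wind t ↔ s = t ∨ (s = 1 ∧ t = 0) ∨ (s = 0 ∧ t = 1) := by
  rw [wind, wind, Circle.exp_eq_exp]
  constructor
  · rintro ⟨k, hk⟩
    have h : (s : ℝ) = t + k := by
      have := Real.pi_pos
      rw [← add_mul] at hk
      exact mul_right_cancel₀ (by positivity) hk
    have hs0 := s.2.1
    have hs1 := s.2.2
    have ht0 := t.2.1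
    have ht1 := t.2.2
    have k1 : k ≤ 1 := by
      have : (k : ℝ) ≤ 1 := by linarith
      exact_mod_cast this
    have k0 : -1 ≤ k := by
      have : (-1 : ℝ) ≤ k := by linarith
      exact_mod_cast this
    obtain rfl | rfl | rfl : k = -1 ∨ k = 0 ∨ k = 1 := by omega
    · push_cast at h
      exact Or.inr (Or.inr ⟨Subtype.ext (show (s : ℝ) = 0 by linarith),
        Subtype.ext (show (t : ℝ) = 1 by linarith)⟩)
    · push_cast at h
      exact Or.inl (Subtype.ext (by linarith))
    · push_cast at h
      exact Or.inr (Or.inl ⟨Subtype.ext (show (s : ℝ) = 1 by linarith),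
        Subtype.ext (show (t : ℝ) = 0 by linarith)⟩)
  · rintro (rfl | ⟨rfl, rfl⟩ | ⟨rfl, rfl⟩)
    · exact ⟨0, by simp⟩
    · exact ⟨1, by simp⟩
    · exact ⟨-1, by simp⟩

theorem wind_surjective : Function.Surjective wind := by
  intro z
  obtain ⟨θ, rfl⟩ := Circle.exp_surjective z
  refine ⟨⟨Int.fract (θ / (2 * Real.pi)), Int.fract_nonneg _, (Int.fract_lt_one _).le⟩, ?_⟩
  rw [wind, Circle.exp_eq_exp]
  refine ⟨-⌊θ / (2 * Real.pi)⌋, ?_⟩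
  have := Real.pi_pos
  simp only [Int.fract, Int.cast_neg]
  field_simp
  ring

theorem exists_isQuotientMap_twisted : ∃ p : StdSphere 2 × unitInterval → TwistedS2S1,
    Topology.IsQuotientMap p ∧ ∀ a b, p a = p b ↔ TorusFiber (sphereMap reflectionR3) a b :=
  ⟨Quot.mk _, isQuotientMap_quot_mk, mappingTorus_mk_eq_iff (injective_sphereMap _)⟩

theorem exists_isQuotientMap_product : ∃ p : StdSphere 2 × unitInterval → StdSphere 2 × Circle,
    Topology.IsQuotientMap p ∧ ∀ a b, p a = p b ↔ TorusFiber id a b := by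
  refine ⟨fun a => (a.1, wind a.2), isQuotientMap_of_compact
    (continuous_fst.prodMk (continuous_wind.comp continuous_snd)) ?_, ?_⟩
  · rintro ⟨x, z⟩
    obtain ⟨s, rfl⟩ := wind_surjective z
    exact ⟨(x, s), rfl⟩
  · rintro ⟨x, s⟩ ⟨y, t⟩
    rw [Prod.mk.injEq, wind_eq_iff, TorusFiber, Prod.mk.injEq]
    simp only [id]
    have := eq_comm (a := x) (b := y)
    tauto

theorem isOpenQuotientMap_antipodal (n : ℕ) : IsOpenQuotientMap (Quotient.mk (antipodalSetoid n)) := by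
  refine ⟨Quotient.mk_surjective, continuous_quot_mk, fun U hU => ?_⟩
  have : Quotient.mk (antipodalSetoid n) ⁻¹' (Quotient.mk (antipodalSetoid n) '' U) = U ∪ (fun x => -x) ⁻¹' U := by
    ext x
    constructor
    · rintro ⟨y, hy, h⟩
      rcases Quotient.exact h with h | h
      · exact Or.inl (h ▸ hy)
      · refine Or.inr ?_
        rw [Set.mem_preimage, ← h]
        exact hy
    · rintro (h | h)
      · exact ⟨x, h, rfl⟩
      · exact ⟨-x, h, Quotient.sound (Or.inr rfl)⟩
  have h : IsOpen (Quotient.mk (antipodalSetoid n) ⁻¹' (Quotient.mk (antipodalSetoid n) '' U)) := by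
    rw [this]
    exact hU.union (hU.preimage continuous_neg)
  exact isQuotientMap_quot_mk.isOpen_preimage.1 h

/-- The antipodal quotient map is open, and its relation is the union of two closed graphs. -/
instance instT2SpaceRP (n : ℕ) : T2Space (RP n) := by
  rw [t2Space_iff_of_isOpenQuotientMap (isOpenQuotientMap_antipodal n)]
  have : {q : StdSphere n × StdSphere n | Quotient.mk (antipodalSetoid n) q.1 =
      Quotient.mk (antipodalSetoid n) q.2} = {q | q.1 = q.2} ∪ {q | q.1 = -q.2} := by
    ext q
    exact Quotient.eq (r := antipodalSetoid n)
  rw [this]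
  exact (isClosed_eq continuous_fst continuous_snd).union
    (isClosed_eq continuous_fst continuous_snd.neg)

theorem exists_isQuotientMap_projective : ∃ p : StdSphere 2 × unitInterval → RP 2 × Circle,
    Topology.IsQuotientMap p ∧ ∀ a b, p a = p b ↔ ProjectiveFiber a b := by
  refine ⟨fun a => (Quotient.mk (antipodalSetoid 2) a.1, wind a.2), isQuotientMap_of_compact
    ((continuous_quot_mk.comp continuous_fst).prodMk (continuous_wind.comp continuous_snd)) ?_, ?_⟩
  · rintro ⟨x, z⟩
    obtain ⟨s, rfl⟩ := wind_surjective z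
    obtain ⟨x, rfl⟩ := Quotient.mk_surjective x
    exact ⟨(x, s), rfl⟩
  · intro a b
    rw [Prod.mk.injEq, wind_eq_iff, Quotient.eq]
    rfl


/-! ### The connected sum of two projective spaces -/

/-- The vector `(s, v₁, …, vₙ)`. -/
noncomputable def consVec {n : ℕ} (s : ℝ) (v : Euc n) : Euc (n + 1) :=
  WithLp.toLp 2 (Fin.cons s fun i => v i)

section Cone

variable {n : ℕ}

theorem consVec_ext {s t : ℝ} {v w : Euc n} (h : consVec s v = consVec t w) : s = t ∧ v = w := by
  constructor
  · simpa [consVec] using congrArg (fun u : Euc (n + 1) => u 0) h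
  · ext i
    simpa [consVec] using congrArg (fun u : Euc (n + 1) => u i.succ) h

theorem smul_consVec (c s : ℝ) (v : Euc n) : c • consVec s v = consVec (c * s) (c • v) := by
  ext i
  refine Fin.cases ?_ (fun j => ?_) i <;> simp [consVec]

theorem continuous_consVec : Continuous fun p : ℝ × Euc n => consVec p.1 p.2 := by
  refine (PiLp.continuous_toLp 2 _).comp (continuous_pi fun i => ?_)
  refine Fin.cases ?_ (fun j => ?_) i
  · exact continuous_fst
  · simp only [Fin.cons_succ]
    fun_prop

theorem consVec_ne_zero (s : ℝ) (u : StdSphere n) : consVec s (u : Euc (n + 1)) ≠ 0 := fun h => by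
  have h0 : consVec s (u : Euc (n + 1)) = consVec 0 0 := by
    rw [h]
    ext i
    refine Fin.cases ?_ (fun j => ?_) i <;> simp [consVec]
  exact ne_zero_of_mem_unit_sphere u (consVec_ext h0).2

/-- The point of the sphere in the direction of a nonzero vector. -/
noncomputable def direction (w : Euc (n + 1)) (hw : w ≠ 0) : StdSphere n :=
  ⟨‖w‖⁻¹ • w, by simp [norm_smul, hw]⟩

theorem mk_direction_eq_iff {v w : Euc (n + 1)} (hv : v ≠ 0) (hw : w ≠ 0) :
    Quotient.mk (antipodalSetoid n) (direction v hv) =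
      Quotient.mk (antipodalSetoid n) (direction w hw) ↔ ∃ c : ℝ, v = c • w := by
  rw [Quotient.eq]
  have hv' : ‖v‖ ≠ 0 := norm_ne_zero_iff.2 hv
  have hw' : ‖w‖ ≠ 0 := norm_ne_zero_iff.2 hw
  constructor
  · rintro (h | h)
    · have := congrArg (fun x : StdSphere n => ‖v‖ • (x : Euc (n + 1))) h
      simp only [direction, smul_smul, mul_inv_cancel₀ hv', one_smul] at this
      exact ⟨_, this⟩
    · have := congrArg (fun x : StdSphere n => ‖v‖ • (x : Euc (n + 1))) h
      simp only [direction, smul_smul, mul_inv_cancel₀ hv', one_smul] at this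
      rw [show ((-⟨‖w‖⁻¹ • w, _⟩ : StdSphere n) : Euc (n + 1)) = -(‖w‖⁻¹ • w) from rfl, ← smul_neg,
        smul_smul, smul_neg, ← neg_smul] at this
      exact ⟨_, this⟩
  · rintro ⟨c, rfl⟩
    have hc : c ≠ 0 := fun h => hv (by rw [h, zero_smul])
    rcases hc.lt_or_gt with h | h
    · right
      refine Subtype.ext ?_
      change ‖c • w‖⁻¹ • c • w = -(‖w‖⁻¹ • w)
      rw [norm_smul, Real.norm_eq_abs, abs_of_neg h, smul_smul, ← neg_smul]
      congr 1
      field_simp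
    · left
      refine Subtype.ext ?_
      change ‖c • w‖⁻¹ • c • w = ‖w‖⁻¹ • w
      rw [norm_smul, Real.norm_eq_abs, abs_of_pos h, smul_smul]
      congr 1
      field_simp

theorem mk_direction_self (w : StdSphere n) : direction (w : Euc (n + 1))
    (ne_zero_of_mem_unit_sphere w) = w := Subtype.ext (by simp [direction])

theorem affineChart_eq (y : Euc n) :
    affineChart y = Quotient.mk (antipodalSetoid n) (direction (oneCons y) (oneCons_ne_zero y)) := rfl

theorem oneCons_eq (y : Euc n) : oneCons y = consVec 1 y := rfl

/-- The point `[s : u]` of projective space. -/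
noncomputable def projPoint (p : StdSphere n × ℝ) : RP (n + 1) :=
  Quotient.mk (antipodalSetoid (n + 1)) (direction (consVec p.2 p.1) (consVec_ne_zero p.2 p.1))

theorem continuous_projPoint : Continuous (projPoint (n := n)) := by
  have h : Continuous fun p : StdSphere n × ℝ => consVec p.2 (p.1 : Euc (n + 1)) :=
    continuous_consVec.comp (continuous_snd.prodMk (continuous_subtype_val.comp continuous_fst))
  refine continuous_quot_mk.comp (Continuous.subtype_mk ?_ _)
  exact (h.norm.inv₀ fun p => norm_ne_zero_iff.2 (consVec_ne_zero p.2 p.1)).smul h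

/-- Proportional vectors whose spherical parts have norm one differ by a sign, and the sign `-1` is
compatible with two nonnegative first coordinates only if both vanish. -/
theorem projPoint_eq_iff {u v : StdSphere n} {s t : ℝ} (hs : 0 ≤ s) (ht : 0 ≤ t) :
    projPoint (u, s) = projPoint (v, t) ↔ s = t ∧ (u = v ∨ (s = 0 ∧ u = -v)) := by
  rw [projPoint, projPoint, mk_direction_eq_iff]
  constructor
  · rintro ⟨c, hc⟩
    rw [smul_consVec] at hc
    obtain ⟨h1, h2⟩ := consVec_ext hc
    have hn := congrArg norm h2
    simp only [norm_smul, norm_eq_of_mem_sphere, mul_one, Real.norm_eq_abs] at hn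
    rcases abs_eq (zero_le_one (α := ℝ)) |>.1 hn.symm with rfl | rfl
    · rw [one_smul] at h2
      exact ⟨by linarith, Or.inl (Subtype.ext h2)⟩
    · rw [neg_one_smul] at h2
      simp only at h1
      exact ⟨by linarith, Or.inr ⟨by linarith, Subtype.ext h2⟩⟩
  · rintro ⟨rfl, rfl | ⟨rfl, rfl⟩⟩
    · exact ⟨1, by simp⟩
    · refine ⟨-1, ?_⟩
      rw [smul_consVec]
      simp

/-- For `s > 0` the point `[s : u]` has affine coordinate `u / s`, of norm at least one; for `s = 0`
it lies at infinity. -/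
theorem projPoint_notMem {u : StdSphere n} {s : ℝ} (hs0 : 0 ≤ s) (hs1 : s ≤ 1) :
    projPoint (u, s) ∈ (affineChart '' Metric.ball (0 : Euc (n + 1)) 1)ᶜ := by
  rintro ⟨y, hy, h⟩
  rw [affineChart_eq, projPoint, mk_direction_eq_iff, oneCons_eq] at h
  obtain ⟨c, hc⟩ := h
  rw [smul_consVec] at hc
  obtain ⟨h1, h2⟩ := consVec_ext hc
  simp only at h1 h2
  rw [mem_ball_zero_iff, h2, norm_smul, norm_eq_of_mem_sphere, mul_one, Real.norm_eq_abs] at hy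
  have hc0 : 0 < c := by
    by_contra hn
    nlinarith [not_lt.1 hn]
  rw [abs_of_pos hc0] at hy
  nlinarith

theorem exists_projPoint_eq {z : RP (n + 1)}
    (hz : z ∈ (affineChart '' Metric.ball (0 : Euc (n + 1)) 1)ᶜ) :
    ∃ (u : StdSphere n) (s : ℝ), 0 ≤ s ∧ s ≤ 1 ∧ projPoint (u, s) = z := by
  obtain ⟨w, rfl⟩ := Quotient.mk_surjective z
  set v : Euc (n + 1) := WithLp.toLp 2 fun i => (w : Euc (n + 2)) i.succ with hv
  set r : ℝ := (w : Euc (n + 2)) 0 with hr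
  have hw : (w : Euc (n + 2)) = consVec r v := by
    ext i
    refine Fin.cases ?_ (fun j => ?_) i <;> simp [consVec, hr, hv]
  have hchart : ∀ c : ℝ, ∀ y, ‖y‖ < 1 → oneCons y ≠ c • (w : Euc (n + 2)) := fun c y hy h => hz
    ⟨y, mem_ball_zero_iff.2 hy, by
      rw [affineChart_eq, ← mk_direction_self w, mk_direction_eq_iff]; exact ⟨c, h⟩⟩
  have hle : |r| ≤ ‖v‖ := by
    by_contra hn
    rw [not_le] at hn
    have hr0 : r ≠ 0 := fun h => by
      rw [h, abs_zero] at hn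
      exact absurd hn (not_lt.2 (norm_nonneg v))
    refine hchart r⁻¹ (r⁻¹ • v) ?_ ?_
    · rw [norm_smul, norm_inv, Real.norm_eq_abs, inv_mul_eq_div, div_lt_one (abs_pos.2 hr0)]
      exact hn
    · rw [hw, smul_consVec, inv_mul_cancel₀ hr0, oneCons_eq]
  have hv0 : v ≠ 0 := fun h => by
    rw [h, norm_zero, abs_nonpos_iff] at hle
    refine ne_zero_of_mem_unit_sphere w ?_
    rw [hw, h, hle]
    ext i
    refine Fin.cases ?_ (fun j => ?_) i <;> simp [consVec]
  have hvn : 0 < ‖v‖ := norm_pos_iff.2 hv0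
  -- Homogeneous coordinates are divided by the norm of `v`, with the sign `ε` chosen to make the
  -- first coordinate nonnegative.
  have key : ∀ ε : ℝ, ε * ε = 1 → 0 ≤ ε * r → ∃ (u : StdSphere n) (s : ℝ), 0 ≤ s ∧ s ≤ 1 ∧
      projPoint (u, s) = Quotient.mk (antipodalSetoid (n + 1)) w := by
    intro ε hε hεr
    have hε1 : |ε| = 1 := by
      rcases mul_self_eq_one_iff.1 hε with rfl | rfl <;> simp
    refine ⟨⟨(ε * ‖v‖⁻¹) • v, ?_⟩, ε * r / ‖v‖, div_nonneg hεr hvn.le, ?_, ?_⟩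
    · simp [norm_smul, hε1, hvn.ne']
    · rw [div_le_one hvn]
      refine (le_abs_self _).trans ?_
      rwa [abs_mul, hε1, one_mul]
    · rw [← mk_direction_self w, projPoint, mk_direction_eq_iff]
      refine ⟨ε * ‖v‖⁻¹, ?_⟩
      rw [hw, smul_consVec]
      congr 1
      ring
  rcases le_total 0 r with h | h
  · exact key 1 (by norm_num) (by linarith)
  · exact key (-1) (by norm_num) (by linarith)

end Cone

/-- The complement of the open unit ball of the standard chart of `ℝP³`. -/
abbrev PuncturedRP : Type := ↥(affineChart '' Metric.ball (0 : Euc 3) 1 : Set (RP 3))ᶜ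

/-- The point `[s : u]` as a point of the complement of a ball. -/
noncomputable def puncturedPoint (a : StdSphere 2 × unitInterval) : PuncturedRP :=
  ⟨projPoint (a.1, a.2), projPoint_notMem a.2.2.1 a.2.2.2⟩

theorem isQuotientMap_puncturedPoint_sum :
    Topology.IsQuotientMap (Sum.map puncturedPoint puncturedPoint) := by
  have hc : Continuous puncturedPoint :=
    (continuous_projPoint.comp (continuous_fst.prodMk
      (continuous_subtype_val.comp continuous_snd))).subtype_mk _
  have hs : Function.Surjective puncturedPoint := by
    rintro ⟨z, hz⟩
    obtain ⟨u, s, h0, h1, rfl⟩ := exists_projPoint_eq hz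
    exact ⟨(u, ⟨s, h0, h1⟩), rfl⟩
  exact isQuotientMap_of_compact (hc.sumMap hc) (hs.sumMap hs)

/-- The points of the sphere along which the two punctured projective spaces are glued. -/
def OnRim (c : PuncturedRP) : Prop := ∃ x : Euc 3, ‖x‖ = 1 ∧ c.1 = affineChart x

theorem onRim_puncturedPoint (u : StdSphere 2) (s : unitInterval) :
    OnRim (puncturedPoint (u, s)) ↔ s = 1 := by
  constructor
  · rintro ⟨x, hx, h⟩
    have : affineChart x = projPoint (⟨x, by simpa using hx⟩, 1) := rfl
    rw [this] at h
    exact Subtype.ext ((projPoint_eq_iff s.2.1 zero_le_one).1 h).1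
  · rintro rfl
    exact ⟨u, norm_eq_of_mem_sphere u, rfl⟩

/-- The relation generated by gluing along the rim. -/
def RimRel (z w : PuncturedRP ⊕ PuncturedRP) : Prop :=
  z = w ∨ (Sum.elim id id z = Sum.elim id id w ∧ OnRim (Sum.elim id id z))

theorem equivalence_rimRel : Equivalence RimRel where
  refl _ := Or.inl rfl
  symm := by
    rintro z w (rfl | ⟨h1, h2⟩)
    · exact Or.inl rfl
    · exact Or.inr ⟨h1.symm, h1 ▸ h2⟩
  trans := by
    rintro x y z (rfl | ⟨h1, h2⟩) (rfl | ⟨h3, h4⟩)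
    · exact Or.inl rfl
    · exact Or.inr ⟨h3, h4⟩
    · exact Or.inr ⟨h1, h2⟩
    · exact Or.inr ⟨h1.trans h3, h2⟩

/-- Both summands use the same chart, so the gluing identifies the two copies of each rim point and
`RimRel` is already transitive. -/
theorem connectedSum_mk_eq_iff (z w : PuncturedRP ⊕ PuncturedRP) :
    Quot.mk (ConnectedSumRel (affineChart (n := 3)) (affineChart (n := 3))) z = Quot.mk _ w ↔
      RimRel z w := by
  constructor
  · intro h
    rw [← equivalence_rimRel.eqvGen_iff]
    refine Relation.EqvGen.mono ?_ _ _ (Quot.eqvGen_exact h)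
    rintro _ _ ⟨x, hx, a, b, ha, hb⟩
    exact Or.inr ⟨Subtype.ext (ha.trans hb.symm), x, hx, ha⟩
  · have glue : ∀ c : PuncturedRP, OnRim c →
        Quot.mk (ConnectedSumRel (affineChart (n := 3)) (affineChart (n := 3))) (Sum.inl c) =
          Quot.mk _ (Sum.inr c) := by
      rintro c ⟨x, hx, hc⟩
      exact Quot.sound (.glue x hx c c hc hc)
    rintro (rfl | ⟨h1, h2⟩)
    · rfl
    · rcases z with z | z <;> rcases w with w | w <;> simp only [Sum.elim_inl, Sum.elim_inr, id] at h1 h2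
      · rw [h1]
      · rw [← h1]; exact glue z h2
      · rw [← h1]; exact (glue z h2).symm
      · rw [h1]

/-- The distance from the nearer end of the unit interval, scaled to reach `1` in the middle. -/
noncomputable def tent (s : unitInterval) : unitInterval :=
  ⟨min (2 * s) (2 - 2 * s), le_min (by linarith [s.2.1]) (by linarith [s.2.2]), by
    rcases le_total (2 * (s : ℝ)) 1 with h | h
    · exact (min_le_left _ _).trans h
    · exact (min_le_right _ _).trans (by linarith)⟩

open Classical in
/-- The two halves of `S² × [0, 1]`, mapped to the two punctured projective spaces. -/
noncomputable def halves (a : StdSphere 2 × unitInterval) : PuncturedRP ⊕ PuncturedRP :=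
  if 2 * (a.2 : ℝ) ≤ 1 then Sum.inl (puncturedPoint (a.1, tent a.2))
  else Sum.inr (puncturedPoint (a.1, tent a.2))

theorem elim_halves (a : StdSphere 2 × unitInterval) :
    Sum.elim id id (halves a) = puncturedPoint (a.1, tent a.2) := by
  unfold halves
  split_ifs <;> rfl

theorem puncturedPoint_eq_iff {u v : StdSphere 2} {s t : unitInterval} :
    puncturedPoint (u, s) = puncturedPoint (v, t) ↔ s = t ∧ (u = v ∨ (s = 0 ∧ u = -v)) := by
  rw [Subtype.ext_iff, puncturedPoint, puncturedPoint]
  simp only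
  rw [projPoint_eq_iff s.2.1 t.2.1]
  simp only [Subtype.ext_iff, Set.Icc.coe_zero]

theorem halves_eq_iff {u v : StdSphere 2} {s t : unitInterval} :
    halves (u, s) = halves (v, t) ↔ (2 * (s : ℝ) ≤ 1 ↔ 2 * (t : ℝ) ≤ 1) ∧ tent s = tent t ∧
      (u = v ∨ (tent s = 0 ∧ u = -v)) := by
  unfold halves
  by_cases hs : 2 * (s : ℝ) ≤ 1 <;> by_cases ht : 2 * (t : ℝ) ≤ 1 <;>
    simp [hs, ht, puncturedPoint_eq_iff]

theorem tent_eq_zero_iff {s : unitInterval} : tent s = 0 ↔ s = 0 ∨ s = 1 := by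
  rw [Subtype.ext_iff, Subtype.ext_iff, Subtype.ext_iff]
  simp only [tent, Set.Icc.coe_zero, Set.Icc.coe_one]
  have h0 := s.2.1
  have h1 := s.2.2
  rcases le_total (2 * (s : ℝ)) (2 - 2 * s) with h | h
  · rw [min_eq_left h]
    constructor
    · intro h; left; linarith
    · rintro (h | h) <;> linarith
  · rw [min_eq_right h]
    constructor
    · intro h; right; linarith
    · rintro (h | h) <;> linarith

theorem tent_eq_one_iff {s : unitInterval} : tent s = 1 ↔ 2 * (s : ℝ) = 1 := by
  rw [Subtype.ext_iff]
  simp only [tent, Set.Icc.coe_one]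
  rcases le_total (2 * (s : ℝ)) (2 - 2 * s) with h | h
  · rw [min_eq_left h]
  · rw [min_eq_right h]
    constructor <;> intro h <;> linarith

theorem eq_of_tent_eq {s t : unitInterval} (h : 2 * (s : ℝ) ≤ 1 ↔ 2 * (t : ℝ) ≤ 1)
    (h' : tent s = tent t) : s = t := by
  rw [Subtype.ext_iff] at h' ⊢
  simp only [tent] at h'
  rcases le_or_gt (2 * (s : ℝ)) 1 with hs | hs
  · have ht := h.1 hs
    rw [min_eq_left (by linarith), min_eq_left (by linarith)] at h'
    linarith
  · have ht : 1 < 2 * (t : ℝ) := not_le.1 fun ht => not_le.2 hs (h.2 ht)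
    rw [min_eq_right (by linarith), min_eq_right (by linarith)] at h'
    linarith

theorem exists_isQuotientMap_double : ∃ p : StdSphere 2 × unitInterval → RP3SumRP3,
    Topology.IsQuotientMap p ∧ ∀ a b, p a = p b ↔ DoubleFiber a b := by
  set R := ConnectedSumRel (affineChart (n := 3)) (affineChart (n := 3)) with hR
  refine ⟨fun a => Quot.mk R (halves a), ?_, ?_⟩
  -- `halves` jumps between the summands at the middle, so its continuity is not available. Instead
  -- the product is covered by two copies of itself, one for each half, and the composite with this
  -- cover is visibly a quotient map.
  · set e : (StdSphere 2 × unitInterval) ⊕ (StdSphere 2 × unitInterval) →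
        StdSphere 2 × unitInterval := Sum.elim
      (fun a => (a.1, ⟨a.2 / 2, by linarith [a.2.2.1], by linarith [a.2.2.2]⟩))
      (fun a => (a.1, ⟨1 - a.2 / 2, by linarith [a.2.2.2], by linarith [a.2.2.1]⟩)) with he
    have hec : Continuous e := by
      refine Continuous.sumElim ?_ ?_
      · exact continuous_fst.prodMk (Continuous.subtype_mk (by fun_prop) _)
      · exact continuous_fst.prodMk (Continuous.subtype_mk (by fun_prop) _)
    have hes : Function.Surjective e := by
      rintro ⟨u, s⟩
      rcases le_total (2 * (s : ℝ)) 1 with h | h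
      · exact ⟨Sum.inl (u, ⟨2 * s, by linarith [s.2.1], h⟩), Prod.ext rfl (Subtype.ext
          (show 2 * (s : ℝ) / 2 = s by ring))⟩
      · exact ⟨Sum.inr (u, ⟨2 - 2 * s, by linarith [s.2.2], by linarith⟩), Prod.ext rfl
          (Subtype.ext (show 1 - (2 - 2 * (s : ℝ)) / 2 = s by ring))⟩
    refine (isQuotientMap_of_compact hec hes).of_comp_isQuotientMap ?_
    have : (fun a => Quot.mk R (halves a)) ∘ e =
        Quot.mk R ∘ Sum.map puncturedPoint puncturedPoint := by
      funext z
      simp only [Function.comp_apply]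
      rw [connectedSum_mk_eq_iff]
      rcases z with ⟨u, s⟩ | ⟨u, s⟩
      · left
        have h1 : 2 * ((s : ℝ) / 2) ≤ 1 := by linarith [s.2.2]
        simp only [he, Sum.elim_inl, Sum.map_inl, halves, h1, if_true]
        congr 3
        refine Subtype.ext ?_
        simp only [tent]
        rw [min_eq_left (by linarith)]
        ring
      · have ht : tent ⟨1 - (s : ℝ) / 2, by linarith [s.2.2], by linarith [s.2.1]⟩ = s := by
          refine Subtype.ext ?_
          simp only [tent]
          rw [min_eq_right (by linarith [s.2.2])]
          ring
        -- At the middle, `halves` chooses the left copy while the cover gives the right one; the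
        -- rim identification reconciles them.
        by_cases h1 : 2 * (1 - (s : ℝ) / 2) ≤ 1
        · right
          have hs : s = 1 := Subtype.ext (le_antisymm s.2.2 (by simp; linarith))
          rw [elim_halves]
          simp only [he, Sum.elim_inr, Sum.map_inr, ht, id, true_and]
          exact (onRim_puncturedPoint u s).2 hs
        · left
          simp only [he, Sum.elim_inr, Sum.map_inr, halves, h1, if_false, ht]
    rw [this]
    exact isQuotientMap_quot_mk.comp isQuotientMap_puncturedPoint_sum
  · rintro ⟨u, s⟩ ⟨v, t⟩
    rw [connectedSum_mk_eq_iff, RimRel, elim_halves, elim_halves, onRim_puncturedPoint,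
      halves_eq_iff, puncturedPoint_eq_iff]
    constructor
    · rintro (⟨h1, h2, h3⟩ | ⟨⟨h1, h2⟩, h3⟩)
      · obtain rfl := eq_of_tent_eq h1 h2
        rcases h3 with rfl | ⟨h3, h4⟩
        · exact Or.inl rfl
        · exact Or.inr ⟨rfl, tent_eq_zero_iff.1 h3, h4⟩
      · simp only at h1 h2 h3
        have h4 : 2 * (s : ℝ) = 1 := tent_eq_one_iff.1 h3
        have h5 : 2 * (t : ℝ) = 1 := tent_eq_one_iff.1 (h1.symm.trans h3)
        have hst : s = t := Subtype.ext (by linarith)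
        rcases h2 with rfl | ⟨h2, -⟩
        · exact Or.inl (by rw [hst])
        · exact absurd (h3.symm.trans h2) one_ne_zero
    · rintro (h | ⟨h1, h2, h3⟩)
      · obtain ⟨rfl, rfl⟩ := Prod.mk.inj h
        exact Or.inl ⟨Iff.rfl, rfl, Or.inl rfl⟩
      · simp only at h1 h2 h3
        subst h1
        exact Or.inl ⟨Iff.rfl, rfl, Or.inr ⟨tent_eq_zero_iff.2 h2, h3⟩⟩


/-! ### Paths and fixed points of orthogonal maps -/

/-- The two isometries are joined by a continuous path of linear isometries. -/
def IsometryPath (A B : Euc 3 ≃ₗᵢ[ℝ] Euc 3) : Prop :=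
  ∃ H : unitInterval → (Euc 3 ≃ₗᵢ[ℝ] Euc 3),
    Continuous (fun p : unitInterval × Euc 3 => H p.1 p.2) ∧ H 0 = A ∧ H 1 = B

theorem IsometryPath.refl (A : Euc 3 ≃ₗᵢ[ℝ] Euc 3) : IsometryPath A A :=
  ⟨fun _ => A, A.continuous.comp continuous_snd, rfl, rfl⟩

theorem IsometryPath.mul {A B C D : Euc 3 ≃ₗᵢ[ℝ] Euc 3} (h : IsometryPath A B)
    (h' : IsometryPath C D) : IsometryPath (A * C) (B * D) := by
  obtain ⟨H, hc, rfl, rfl⟩ := h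
  obtain ⟨K, kc, rfl, rfl⟩ := h'
  exact ⟨fun s => H s * K s, hc.comp (continuous_fst.prodMk kc), rfl, rfl⟩

theorem reflection_orthogonal_singleton_apply (v x : Euc 3) :
    (ℝ ∙ v)ᗮ.reflection x = x - (2 * (inner ℝ v x / ‖v‖ ^ 2)) • v := by
  rw [Submodule.reflection_orthogonal_apply, Submodule.reflection_singleton_apply, neg_sub,
    mul_smul, two_smul, two_smul]
  rfl

theorem reflectionR3_mul_self : reflectionR3 * reflectionR3 = 1 :=
  Submodule.reflection_mul_reflection _

/-- The normal vector moves along a segment to `v`. If the segment meets zero, the two normals are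
parallel and the reflections coincide. -/
theorem isometryPath_reflection {v : Euc 3} (hv : v ≠ 0) :
    IsometryPath reflectionR3 (ℝ ∙ v)ᗮ.reflection := by
  set w : Euc 3 := EuclideanSpace.single 0 1 with hw
  have hw0 : w ≠ 0 := by simp [hw]
  by_cases h : ∃ t : unitInterval, (1 - t : ℝ) • w + (t : ℝ) • v = 0
  · obtain ⟨t, ht⟩ := h
    have ht1 : (1 - t : ℝ) ≠ 0 := fun h0 => by
      rw [h0, zero_smul, zero_add, smul_eq_zero] at ht
      rcases ht with h | h
      · linarith
      · exact hv h
    have ht0 : (t : ℝ) ≠ 0 := fun h0 => by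
      rw [h0, zero_smul, add_zero, sub_zero, one_smul] at ht
      exact hw0 ht
    have hspan : (ℝ ∙ v) = ℝ ∙ w := by
      rw [← Submodule.span_singleton_smul_eq (IsUnit.mk0 _ ht0) v,
        ← Submodule.span_singleton_smul_eq (IsUnit.mk0 _ ht1) w, eq_neg_of_add_eq_zero_left ht,
        ← Set.neg_singleton, Submodule.span_neg]
    have : (ℝ ∙ v)ᗮ.reflection = reflectionR3 := by
      simp only [hspan]
      rfl
    rw [this]
    exact IsometryPath.refl _
  · push Not at h
    refine ⟨fun t => (ℝ ∙ ((1 - t : ℝ) • w + (t : ℝ) • v))ᗮ.reflection, ?_, ?_, ?_⟩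
    · simp only [reflection_orthogonal_singleton_apply]
      have h1 : Continuous fun p : unitInterval × Euc 3 => (1 - p.1 : ℝ) • w + (p.1 : ℝ) • v := by
        fun_prop
      refine continuous_snd.sub ((continuous_const.mul ((h1.inner continuous_snd).div
        (h1.norm.pow 2) fun p => ?_)).smul h1)
      exact pow_ne_zero _ (norm_ne_zero_iff.2 (h p.1))
    · simp only [Set.Icc.coe_zero, sub_zero, one_smul, zero_smul, add_zero]
      rfl
    · simp only [Set.Icc.coe_one, sub_self, one_smul, zero_smul, zero_add]

/-- Every orthogonal map is a product of reflections. Each factor can be moved to the fixed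
reflection, whose powers alternate between two elements. That the two alternatives exclude each
other is not needed. -/
theorem isometryPath_one_or_reflectionR3 (A : Euc 3 ≃ₗᵢ[ℝ] Euc 3) :
    IsometryPath 1 A ∨ IsometryPath reflectionR3 A := by
  obtain ⟨l, -, rfl⟩ := A.reflections_generate_dim
  induction l with
  | nil => exact Or.inl (IsometryPath.refl _)
  | cons v l ih =>
    rw [List.map_cons, List.prod_cons]
    by_cases hv : v = 0
    · have : (ℝ ∙ v)ᗮ.reflection = 1 := by
        ext1 x
        rw [reflection_orthogonal_singleton_apply, hv, smul_zero, sub_zero]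
        rfl
      rwa [this, one_mul]
    · rcases ih with ih | ih
      · exact Or.inr (mul_one reflectionR3 ▸ (isometryPath_reflection hv).mul ih)
      · exact Or.inl (reflectionR3_mul_self ▸ (isometryPath_reflection hv).mul ih)

/-- The antipodal map of `ℝ³`. -/
noncomputable def antipode : Euc 3 ≃ₗᵢ[ℝ] Euc 3 := LinearIsometryEquiv.neg ℝ

theorem antipode_apply (x : Euc 3) : antipode x = -x := rfl

theorem antipode_mul_self : antipode * antipode = 1 := by
  ext1 x
  exact neg_neg x

theorem antipode_mul_comm (A : Euc 3 ≃ₗᵢ[ℝ] Euc 3) : antipode * A = A * antipode := by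
  ext1 x
  exact (map_neg A x).symm

/-- The antipodal map is the product of three coordinate reflections, and two of the three copies of
the fixed reflection cancel. -/
theorem isometryPath_antipode : IsometryPath reflectionR3 antipode := by
  have key : antipode = (ℝ ∙ (EuclideanSpace.single 0 1 : Euc 3))ᗮ.reflection *
      ((ℝ ∙ (EuclideanSpace.single 1 1 : Euc 3))ᗮ.reflection *
        (ℝ ∙ (EuclideanSpace.single 2 1 : Euc 3))ᗮ.reflection) := by
    ext x i
    simp only [LinearIsometryEquiv.coe_mul, Function.comp_apply,
      reflection_orthogonal_singleton_apply, antipode_apply]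
    fin_cases i <;> simp [EuclideanSpace.inner_single_left] <;> ring
  rw [key]
  have h := (isometryPath_reflection (v := EuclideanSpace.single 0 1) (by simp)).mul
    ((isometryPath_reflection (v := EuclideanSpace.single 1 1) (by simp)).mul
      (isometryPath_reflection (v := EuclideanSpace.single 2 1) (by simp)))
  rwa [reflectionR3_mul_self, mul_one] at h

theorem isometryPath_antipode_mul {A : Euc 3 ≃ₗᵢ[ℝ] Euc 3} (h : IsometryPath reflectionR3 A) :
    IsometryPath 1 (antipode * A) :=
  reflectionR3_mul_self ▸ isometryPath_antipode.mul h

theorem Polynomial.exists_isRoot_of_monic_of_odd {f : Polynomial ℝ} (hf : f.Monic)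
    (h : Odd f.natDegree) : ∃ c, f.IsRoot c := by
  have h0 : 0 < f.degree := Polynomial.natDegree_pos_iff_degree_pos.1 h.pos
  have hodd : (f.comp (-Polynomial.X)).leadingCoeff = -1 := by
    rw [Polynomial.leadingCoeff_comp (by simp), hf.leadingCoeff, Polynomial.leadingCoeff_neg,
      Polynomial.leadingCoeff_X, h.neg_one_pow, one_mul]
  have hdeg : 0 < (f.comp (-Polynomial.X)).degree := by
    refine Polynomial.natDegree_pos_iff_degree_pos.1 ?_
    rw [Polynomial.natDegree_comp, Polynomial.natDegree_neg, Polynomial.natDegree_X, mul_one]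
    exact h.pos
  have h1 := f.tendsto_atTop_of_leadingCoeff_nonneg h0 (by rw [hf.leadingCoeff]; norm_num)
  have h2 := (f.comp (-Polynomial.X)).tendsto_atBot_of_leadingCoeff_nonpos hdeg
    (by rw [hodd]; norm_num)
  obtain ⟨b, hb⟩ := (h1.eventually_ge_atTop 0).exists
  obtain ⟨a, ha⟩ := (h2.eventually_le_atBot 0).exists
  rw [Polynomial.eval_comp] at ha
  exact mem_range_of_exists_le_of_exists_ge f.continuous ⟨_, ha⟩ ⟨b, hb⟩

/-- The characteristic polynomial has odd degree and thus a real root. It has absolute value one, so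
the square of `A` fixes its eigenvector. -/
theorem exists_sphere_fixed (A : Euc 3 ≃ₗᵢ[ℝ] Euc 3) : ∃ x : StdSphere 2, A (A x) = x := by
  obtain ⟨c, hc⟩ := Polynomial.exists_isRoot_of_monic_of_odd
    (A.toLinearEquiv : Euc 3 →ₗ[ℝ] Euc 3).charpoly_monic (by
      rw [LinearMap.charpoly_natDegree, finrank_euclideanSpace_fin]
      decide)
  have hev := (Module.End.hasEigenvalue_iff_isRoot_charpoly _ _).2 hc
  obtain ⟨v, hv⟩ := hev.exists_hasEigenvector
  have h0 := hv.2
  have h1 : A v = c • v := hv.apply_eq_smul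
  have h2 : |c| = 1 := by
    have := congrArg norm h1
    rw [A.norm_map, norm_smul, Real.norm_eq_abs] at this
    exact (mul_right_cancel₀ (norm_ne_zero_iff.2 h0) (by rw [one_mul]; exact this)).symm
  have h3 : c * c = 1 := by rw [← abs_mul_abs_self, h2, one_mul]
  refine ⟨direction v h0, ?_⟩
  simp only [direction, map_smul, h1, smul_smul, mul_assoc, h3, mul_one]

/-- For an involution, `x + A x` is fixed; if it were nonzero, its direction would be a fixed point
of the sphere. -/
theorem eq_antipode_of_fixed_free {A : Euc 3 ≃ₗᵢ[ℝ] Euc 3} (h : A * A = 1)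
    (hA : ∀ x : StdSphere 2, A x ≠ x) : A = antipode := by
  ext1 x
  have h1 : A (A x) = x := congrArg (fun B : Euc 3 ≃ₗᵢ[ℝ] Euc 3 => B x) h
  have h2 : A (x + A x) = x + A x := by rw [map_add, h1, add_comm]
  by_cases h0 : x + A x = 0
  · rw [antipode_apply]
    exact eq_neg_of_add_eq_zero_right h0
  · refine absurd ?_ (hA (direction _ h0))
    simp only [direction, map_smul, h2]


/-! ### Orbit spaces as quotients of a compact cylinder -/

/-- The orbit space of a group of isometries of `S² × ℝ`. -/
abbrev OrbitSpace (Γ : Subgroup IsomS2R) : Type := MulAction.orbitRel.Quotient Γ (StdSphere 2 × ℝ)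

theorem continuous_sphereMap {n : ℕ} (A : Euc (n + 1) ≃ₗᵢ[ℝ] Euc (n + 1)) :
    Continuous (sphereMap A) :=
  (A.continuous.comp continuous_subtype_val).subtype_mk _

theorem IsomS2R.smul_def (g : IsomS2R) (p : StdSphere 2 × ℝ) :
    g • p = (sphereMap g.1 p.1, g.2 p.2) := rfl

instance instContinuousConstSMulS2R (Γ : Subgroup IsomS2R) :
    ContinuousConstSMul Γ (StdSphere 2 × ℝ) where
  continuous_const_smul γ := ((continuous_sphereMap γ.1.1).comp continuous_fst).prodMk
    (γ.1.2.continuous.comp continuous_snd)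

theorem orbitSpace_mk_eq_iff {Γ : Subgroup IsomS2R} (p q : StdSphere 2 × ℝ) :
    (Quotient.mk _ p : OrbitSpace Γ) = Quotient.mk _ q ↔ ∃ g ∈ Γ, g • p = q := by
  rw [eq_comm, Quotient.eq, MulAction.orbitRel_apply]
  constructor
  · rintro ⟨γ, h⟩
    exact ⟨γ.1, γ.2, h⟩
  · rintro ⟨g, hg, h⟩
    exact ⟨⟨g, hg⟩, h⟩

/-- A group of isometries of `S² × ℝ` acts properly discontinuously if and only if only finitely
many of its elements move the origin of `ℝ` by a bounded amount. -/
theorem properlyDiscontinuous_iff (Γ : Subgroup IsomS2R) :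
    ProperlyDiscontinuousSMul Γ (StdSphere 2 × ℝ) ↔
      ∀ R : ℝ, {γ : Γ | |γ.1.2 0| ≤ R}.Finite := by
  constructor
  · intro h R
    have hK : IsCompact ((Set.univ : Set (StdSphere 2)) ×ˢ Set.Icc (-|R|) |R|) :=
      isCompact_univ.prod isCompact_Icc
    refine (h.finite_disjoint_inter_image hK hK).subset fun γ hγ => ?_
    -- Only a point of the sphere is wanted here.
    obtain ⟨x, -⟩ := exists_sphere_fixed 1
    refine ⟨γ • (x, 0), ⟨(x, 0), ⟨trivial, ?_⟩, rfl⟩, trivial, ?_⟩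
    · simp
    · exact abs_le.1 (le_trans hγ (le_abs_self R))
  · intro h
    refine ⟨fun {K L} hK hL => ?_⟩
    obtain ⟨a, ha⟩ := (hK.image continuous_snd).isBounded.exists_norm_le
    obtain ⟨b, hb⟩ := (hL.image continuous_snd).isBounded.exists_norm_le
    refine (h (a + b)).subset ?_
    rintro γ ⟨-, ⟨p, hp, rfl⟩, hq⟩
    have h1 := ha _ ⟨p, hp, rfl⟩
    have h2 := hb _ ⟨_, hq, rfl⟩
    have h3 : dist (γ.1.2 0) (γ.1.2 p.2) = dist 0 p.2 := γ.1.2.dist_eq _ _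
    rw [dist_zero_left, Real.dist_eq] at h3
    have h4 : ‖γ.1.2 p.2‖ ≤ b := h2
    rw [Real.norm_eq_abs] at h4
    have h5 := abs_add_le (γ.1.2 0 - γ.1.2 p.2) (γ.1.2 p.2)
    rw [sub_add_cancel] at h5
    change |γ.1.2 0| ≤ a + b
    linarith

/-- Proper discontinuity makes the orbit space Hausdorff, so a continuous map of the compact
cylinder that meets every orbit induces a quotient map. -/
theorem exists_isQuotientMap_orbitSpace (Γ : Subgroup IsomS2R)
    [ProperlyDiscontinuousSMul Γ (StdSphere 2 × ℝ)]
    {f : StdSphere 2 × unitInterval → StdSphere 2 × ℝ} (hf : Continuous f)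
    (hs : ∀ p, ∃ g ∈ Γ, ∃ a, g • p = f a) {F : StdSphere 2 × unitInterval →
      StdSphere 2 × unitInterval → Prop} (hF : ∀ a b, (∃ g ∈ Γ, g • f a = f b) ↔ F a b) :
    ∃ p : StdSphere 2 × unitInterval → OrbitSpace Γ,
      Topology.IsQuotientMap p ∧ ∀ a b, p a = p b ↔ F a b := by
  have : T2Space (OrbitSpace Γ) := t2Space_of_properlyDiscontinuousSMul_of_t2Space
  refine ⟨fun a => Quotient.mk _ (f a), isQuotientMap_of_compact (continuous_quot_mk.comp hf) ?_,
    fun a b => (orbitSpace_mk_eq_iff _ _).trans (hF a b)⟩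
  intro z
  obtain ⟨p, rfl⟩ := Quotient.mk_surjective z
  obtain ⟨g, hg, a, h⟩ := hs p
  exact ⟨a, ((orbitSpace_mk_eq_iff _ _).2 ⟨g, hg, h⟩).symm⟩

/-- The translation `x ↦ x + t`. -/
def translation (t : ℝ) : ℝ ≃ᵢ ℝ := IsometryEquiv.addRight t

theorem translation_apply (t x : ℝ) : translation t x = x + t := rfl

/-- The reflection `x ↦ c - x`. -/
def pointReflection (c : ℝ) : ℝ ≃ᵢ ℝ := IsometryEquiv.subLeft c

theorem pointReflection_apply (c x : ℝ) : pointReflection c x = c - x := rfl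

theorem translation_zero : translation 0 = 1 := by
  ext x
  exact add_zero x

theorem translation_mul (s t : ℝ) : translation s * translation t = translation (s + t) := by
  ext x
  change x + t + s = x + (s + t)
  ring

theorem translation_inv (t : ℝ) : (translation t)⁻¹ = translation (-t) := by
  rw [inv_eq_iff_mul_eq_one, translation_mul, add_neg_cancel, translation_zero]

theorem translation_zpow (t : ℝ) (k : ℤ) : translation t ^ k = translation (k * t) := by
  induction k with
  | zero => simp [translation_zero]
  | succ n ih => rw [zpow_add_one, ih, translation_mul]; push_cast; congr 1; ring
  | pred n ih => rw [zpow_sub_one, ih, translation_inv, translation_mul]; push_cast; congr 1; ring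

theorem pointReflection_mul (c d : ℝ) :
    pointReflection c * pointReflection d = translation (c - d) := by
  ext x
  change c - (d - x) = x + (c - d)
  ring

theorem pointReflection_mul_translation (c t : ℝ) :
    pointReflection c * translation t = pointReflection (c - t) := by
  ext x
  change c - (x + t) = c - t - x
  ring

theorem translation_mul_pointReflection (t c : ℝ) :
    translation t * pointReflection c = pointReflection (c + t) := by
  ext x
  change c - x + t = c + t - x
  ring

/-- The displacement from `e 0` to `e 1` is `1` or `-1`. Distances to these two values then
determine every other value. -/
theorem isometryEquiv_real (e : ℝ ≃ᵢ ℝ) :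
    (∃ t, e = translation t) ∨ ∃ c, e = pointReflection c := by
  have key : ∀ x y, (e x - e y) ^ 2 = (x - y) ^ 2 := fun x y => by
    rw [← sq_abs, ← sq_abs (x - y), ← Real.dist_eq, ← Real.dist_eq, e.dist_eq]
  have h1 : (e 1 - e 0 - 1) * (e 1 - e 0 + 1) = 0 := by linear_combination key 1 0
  rcases mul_eq_zero.1 h1 with h | h
  · refine Or.inl ⟨e 0, IsometryEquiv.ext fun x => ?_⟩
    have h2 := key x 1
    have h3 := key x 0
    rw [translation_apply]
    rw [show e 1 = e 0 + 1 by linarith] at h2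
    linear_combination (1 / 2 : ℝ) * h3 - (1 / 2 : ℝ) * h2
  · refine Or.inr ⟨e 0, IsometryEquiv.ext fun x => ?_⟩
    have h2 := key x 1
    have h3 := key x 0
    rw [pointReflection_apply]
    rw [show e 1 = e 0 - 1 by linarith] at h2
    linear_combination (1 / 2 : ℝ) * h2 - (1 / 2 : ℝ) * h3

theorem sphereMap_mul_apply (A B : Euc 3 ≃ₗᵢ[ℝ] Euc 3) (x : StdSphere 2) :
    sphereMap (A * B) x = sphereMap A (sphereMap B x) := rfl

/-- Every real number differs by a multiple of `T` from a number in `[0, T]`. -/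
theorem exists_unitInterval_eq {T : ℝ} (hT : 0 < T) (t : ℝ) :
    ∃ (k : ℤ) (s : unitInterval), t + k * T = s * T := by
  refine ⟨-⌊t / T⌋, ⟨Int.fract (t / T), Int.fract_nonneg _, (Int.fract_lt_one _).le⟩, ?_⟩
  simp only [Int.fract, Int.cast_neg]
  field_simp
  ring

theorem unitInterval_add_int {T : ℝ} (hT : 0 < T) {s t : unitInterval} {k : ℤ} :
    (s : ℝ) * T + k * T = t * T ↔ (k = 0 ∧ s = t) ∨ (k = 1 ∧ s = 0 ∧ t = 1) ∨
      (k = -1 ∧ s = 1 ∧ t = 0) := by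
  rw [← add_mul, mul_left_inj' hT.ne', Subtype.ext_iff, Subtype.ext_iff, Subtype.ext_iff,
    Subtype.ext_iff, Subtype.ext_iff]
  simp only [Set.Icc.coe_zero, Set.Icc.coe_one]
  have hs0 := s.2.1
  have hs1 := s.2.2
  have ht0 := t.2.1
  have ht1 := t.2.2
  constructor
  · intro h
    have k1 : k ≤ 1 := by
      have : (k : ℝ) ≤ 1 := by linarith
      exact_mod_cast this
    have k0 : -1 ≤ k := by
      have : (-1 : ℝ) ≤ k := by linarith
      exact_mod_cast this
    obtain rfl | rfl | rfl : k = -1 ∨ k = 0 ∨ k = 1 := by omega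
    · push_cast at h
      exact Or.inr (Or.inr ⟨rfl, by linarith, by linarith⟩)
    · push_cast at h
      exact Or.inl ⟨rfl, by linarith⟩
    · push_cast at h
      exact Or.inr (Or.inl ⟨rfl, by linarith, by linarith⟩)
  · rintro (⟨rfl, h⟩ | ⟨rfl, h, h'⟩ | ⟨rfl, h, h'⟩) <;> push_cast <;> linarith

/-- The orbit space of the group generated by `(A, T)` is the mapping torus of `B`, for every
involution `B` that is joined to `A`. -/
theorem exists_isQuotientMap_torus (Γ : Subgroup IsomS2R)
    [ProperlyDiscontinuousSMul Γ (StdSphere 2 × ℝ)] {A B : Euc 3 ≃ₗᵢ[ℝ] Euc 3} {T : ℝ} (hT : 0 < T)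
    (hΓ : ∀ g, g ∈ Γ ↔ ∃ k : ℤ, g = (A ^ k, translation (k * T))) (h : IsometryPath B A)
    (hB : B * B = 1) : ∃ p : StdSphere 2 × unitInterval → OrbitSpace Γ,
      Topology.IsQuotientMap p ∧ ∀ a b, p a = p b ↔ TorusFiber (sphereMap B) a b := by
  obtain ⟨H, hH, h0, h1⟩ := h
  have hBB : ∀ x, sphereMap B (sphereMap B x) = x := fun x => by
    rw [← sphereMap_mul_apply, hB]
    rfl
  -- The slice at height `s * T` is parametrized through `H s`. The path starts at `B` and ends at
  -- `A`, so the ends are glued by the inverse of `B`, which is `B`.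
  refine exists_isQuotientMap_orbitSpace Γ
    (f := fun a => (sphereMap (H a.2) a.1, (a.2 : ℝ) * T)) ?_ ?_ ?_
  · refine Continuous.prodMk (Continuous.subtype_mk ?_ _) (by fun_prop)
    exact hH.comp (continuous_snd.prodMk (continuous_subtype_val.comp continuous_fst))
  · rintro ⟨x, t⟩
    obtain ⟨k, s, hs⟩ := exists_unitInterval_eq hT t
    refine ⟨_, (hΓ _).2 ⟨k, rfl⟩, (sphereMap (H s)⁻¹ (sphereMap (A ^ k) x), s), Prod.ext ?_ hs⟩
    simp only [IsomS2R.smul_def]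
    rw [← sphereMap_mul_apply, mul_inv_cancel]
    rfl
  · rintro ⟨x, s⟩ ⟨y, t⟩
    simp only [hΓ, TorusFiber, Prod.mk.injEq]
    constructor
    · rintro ⟨_, ⟨k, rfl⟩, hg⟩
      obtain ⟨hx, ht⟩ := Prod.mk.inj hg
      rcases (unitInterval_add_int hT).1 ht with ⟨rfl, rfl⟩ | ⟨rfl, rfl, rfl⟩ | ⟨rfl, rfl, rfl⟩
      · rw [zpow_zero] at hx
        exact Or.inl ⟨injective_sphereMap _ hx, rfl⟩
      · rw [zpow_one, h0, h1] at hx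
        have := injective_sphereMap _ hx
        exact Or.inr (Or.inr ⟨rfl, rfl, by rw [← this, hBB]⟩)
      · rw [zpow_neg_one, h0, h1, ← sphereMap_mul_apply, inv_mul_cancel] at hx
        exact Or.inr (Or.inl ⟨rfl, rfl, by rw [← hBB y, ← hx]; rfl⟩)
    · rintro (⟨rfl, rfl⟩ | ⟨rfl, rfl, rfl⟩ | ⟨rfl, rfl, rfl⟩)
      · exact ⟨_, ⟨0, rfl⟩, Prod.ext rfl ((unitInterval_add_int hT).2 (Or.inl ⟨rfl, rfl⟩))⟩
      · refine ⟨_, ⟨-1, rfl⟩, Prod.ext ?_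
          ((unitInterval_add_int hT).2 (Or.inr (Or.inr ⟨rfl, rfl, rfl⟩)))⟩
        simp only [IsomS2R.smul_def]
        rw [zpow_neg_one, h0, h1, ← sphereMap_mul_apply, inv_mul_cancel, hBB]
        rfl
      · refine ⟨_, ⟨1, rfl⟩, Prod.ext ?_
          ((unitInterval_add_int hT).2 (Or.inr (Or.inl ⟨rfl, rfl, rfl⟩)))⟩
        simp only [IsomS2R.smul_def]
        rw [zpow_one, h0, h1, hBB]

/-- The path from the identity to `A` straightens the screw motion to a plain translation. It
consists of linear maps, so it respects antipodal pairs throughout. -/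
theorem exists_isQuotientMap_projective_orbit (Γ : Subgroup IsomS2R)
    [ProperlyDiscontinuousSMul Γ (StdSphere 2 × ℝ)] {A : Euc 3 ≃ₗᵢ[ℝ] Euc 3} {T : ℝ} (hT : 0 < T)
    (hΓ : ∀ g, g ∈ Γ ↔ ∃ k : ℤ, g = (A ^ k, translation (k * T)) ∨
      g = (antipode * A ^ k, translation (k * T))) (h : IsometryPath 1 A) :
    ∃ p : StdSphere 2 × unitInterval → OrbitSpace Γ,
      Topology.IsQuotientMap p ∧ ∀ a b, p a = p b ↔ ProjectiveFiber a b := by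
  obtain ⟨H, hH, h0, h1⟩ := h
  refine exists_isQuotientMap_orbitSpace Γ
    (f := fun a => (sphereMap (H a.2) a.1, (a.2 : ℝ) * T)) ?_ ?_ ?_
  · refine Continuous.prodMk (Continuous.subtype_mk ?_ _) (by fun_prop)
    exact hH.comp (continuous_snd.prodMk (continuous_subtype_val.comp continuous_fst))
  · rintro ⟨x, t⟩
    obtain ⟨k, s, hs⟩ := exists_unitInterval_eq hT t
    refine ⟨_, (hΓ _).2 ⟨k, Or.inl rfl⟩, (sphereMap (H s)⁻¹ (sphereMap (A ^ k) x), s),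
      Prod.ext ?_ hs⟩
    simp only [IsomS2R.smul_def]
    rw [← sphereMap_mul_apply, mul_inv_cancel]
    rfl
  · have key : ∀ (k : ℤ) (x y : StdSphere 2) (s t : unitInterval),
        (s : ℝ) * T + k * T = t * T → (sphereMap (A ^ k) (sphereMap (H s) x) = sphereMap (H t) y ↔
          x = y) := by
      intro k x y s t hk
      rcases (unitInterval_add_int hT).1 hk with ⟨rfl, rfl⟩ | ⟨rfl, rfl, rfl⟩ | ⟨rfl, rfl, rfl⟩
      · rw [zpow_zero]
        exact (injective_sphereMap (H s)).eq_iff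
      · rw [zpow_one, h0, h1]
        exact (injective_sphereMap A).eq_iff
      · rw [zpow_neg_one, h0, h1, ← sphereMap_mul_apply, inv_mul_cancel]
        exact (injective_sphereMap 1).eq_iff
    have hanti : ∀ (k : ℤ) (x : StdSphere 2) (s : unitInterval),
        sphereMap (antipode * A ^ k) (sphereMap (H s) x) =
          sphereMap (A ^ k) (sphereMap (H s) (-x)) := fun k x s => by
      rw [antipode_mul_comm, sphereMap_mul_apply, ← sphereMap_mul_apply antipode,
        antipode_mul_comm]
      rfl
    rintro ⟨x, s⟩ ⟨y, t⟩
    simp only [hΓ, ProjectiveFiber]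
    constructor
    · rintro ⟨_, ⟨k, rfl | rfl⟩, hg⟩ <;> obtain ⟨hx, ht⟩ := Prod.mk.inj hg
      · refine ⟨Or.inl ((key k x y s t ht).1 hx), ?_⟩
        rcases (unitInterval_add_int hT).1 ht with ⟨-, h⟩ | ⟨-, h⟩ | ⟨-, h⟩
        · exact Or.inl h
        · exact Or.inr (Or.inr h)
        · exact Or.inr (Or.inl h)
      · refine ⟨Or.inr ?_, ?_⟩
        · rw [← (key k (-x) y s t ht).1 ((hanti k x s).symm.trans hx), neg_neg]
        rcases (unitInterval_add_int hT).1 ht with ⟨-, h⟩ | ⟨-, h⟩ | ⟨-, h⟩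
        · exact Or.inl h
        · exact Or.inr (Or.inr h)
        · exact Or.inr (Or.inl h)
    · rintro ⟨hx, hst⟩
      obtain ⟨k, hk⟩ : ∃ k : ℤ, (s : ℝ) * T + k * T = t * T := by
        rcases hst with h | h | h
        · exact ⟨0, (unitInterval_add_int hT).2 (Or.inl ⟨rfl, h⟩)⟩
        · exact ⟨-1, (unitInterval_add_int hT).2 (Or.inr (Or.inr ⟨rfl, h⟩))⟩
        · exact ⟨1, (unitInterval_add_int hT).2 (Or.inr (Or.inl ⟨rfl, h⟩))⟩
      rcases hx with rfl | rfl
      · exact ⟨_, ⟨k, Or.inl rfl⟩, Prod.ext ((key k x x s t hk).2 rfl) hk⟩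
      · refine ⟨_, ⟨k, Or.inr rfl⟩, Prod.ext ((hanti k _ s).trans ?_) hk⟩
        rw [neg_neg]
        exact (key k y y s t hk).2 rfl

/-- Half a period starting at `c / 2` is a fundamental interval. Its endpoints are the centers of
two reflections in the group, each combined with the antipodal map, which yields the identifications
at the ends. -/
theorem exists_isQuotientMap_dihedral (Γ : Subgroup IsomS2R)
    [ProperlyDiscontinuousSMul Γ (StdSphere 2 × ℝ)] {c T : ℝ} (hT : 0 < T)
    (hΓ : ∀ g, g ∈ Γ ↔ ∃ k : ℤ, g = (1, translation (k * T)) ∨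
      g = (antipode, pointReflection (c + k * T))) :
    ∃ p : StdSphere 2 × unitInterval → OrbitSpace Γ,
      Topology.IsQuotientMap p ∧ ∀ a b, p a = p b ↔ DoubleFiber a b := by
  refine exists_isQuotientMap_orbitSpace Γ
    (f := fun a => (a.1, c / 2 + (a.2 : ℝ) * T / 2)) ?_ ?_ ?_
  · fun_prop
  · rintro ⟨x, t⟩
    obtain ⟨k, s, hs⟩ := exists_unitInterval_eq hT (t - c / 2)
    -- After translation into one period, a point of the first half is in place and one of the
    -- second half is reflected back.
    rcases le_total (2 * (s : ℝ)) 1 with h | h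
    · refine ⟨_, (hΓ _).2 ⟨k, Or.inl rfl⟩, (x, ⟨2 * s, by linarith [s.2.1], h⟩), Prod.ext rfl ?_⟩
      change t + k * T = c / 2 + 2 * (s : ℝ) * T / 2
      linear_combination hs
    · refine ⟨_, (hΓ _).2 ⟨1 - k, Or.inr rfl⟩, (-x, ⟨2 - 2 * s, by linarith [s.2.2], by linarith⟩),
        Prod.ext rfl ?_⟩
      change c + ((1 - k : ℤ) : ℝ) * T - t = c / 2 + (2 - 2 * (s : ℝ)) * T / 2
      push_cast
      linear_combination -hs
  · rintro ⟨x, s⟩ ⟨y, t⟩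
    simp only [hΓ, DoubleFiber, Prod.mk.injEq]
    have hs0 := s.2.1
    have hs1 := s.2.2
    have ht0 := t.2.1
    have ht1 := t.2.2
    constructor
    · rintro ⟨_, ⟨k, rfl | rfl⟩, hg⟩ <;> obtain ⟨hx, ht⟩ := Prod.mk.inj hg
      · left
        change c / 2 + (s : ℝ) * T / 2 + k * T = c / 2 + (t : ℝ) * T / 2 at ht
        have h : (s : ℝ) + 2 * k = t := mul_right_cancel₀ hT.ne' (by linear_combination 2 * ht)
        have k1 : k < 1 := by
          have : (k : ℝ) < 1 := by linarith
          exact_mod_cast this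
        have k0 : -1 < k := by
          have : (-1 : ℝ) < k := by linarith
          exact_mod_cast this
        obtain rfl : k = 0 := by omega
        exact ⟨hx, Subtype.ext (by push_cast at h; linarith)⟩
      · right
        change c + k * T - (c / 2 + (s : ℝ) * T / 2) = c / 2 + (t : ℝ) * T / 2 at ht
        have h : (s : ℝ) + t = 2 * k := mul_right_cancel₀ hT.ne' (by linear_combination -2 * ht)
        have k1 : k ≤ 1 := by
          have : (k : ℝ) ≤ 1 := by linarith
          exact_mod_cast this
        have k0 : 0 ≤ k := by
          have : (0 : ℝ) ≤ k := by linarith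
          exact_mod_cast this
        have hx' : x = -y := by rw [← hx]; exact (neg_neg x).symm
        obtain rfl | rfl : k = 0 ∨ k = 1 := by omega
        · push_cast at h
          exact ⟨Subtype.ext (by linarith), Or.inl (Subtype.ext (show (s : ℝ) = 0 by linarith)), hx'⟩
        · push_cast at h
          exact ⟨Subtype.ext (by linarith), Or.inr (Subtype.ext (show (s : ℝ) = 1 by linarith)), hx'⟩
    · rintro (⟨rfl, rfl⟩ | ⟨rfl, rfl | rfl, rfl⟩)
      · refine ⟨_, ⟨0, Or.inl rfl⟩, Prod.ext rfl ?_⟩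
        simp [IsomS2R.smul_def, translation_apply]
      · refine ⟨_, ⟨0, Or.inr rfl⟩, Prod.ext (neg_neg y) ?_⟩
        simp only [IsomS2R.smul_def, pointReflection_apply, Set.Icc.coe_zero]
        push_cast
        ring
      · refine ⟨_, ⟨1, Or.inr rfl⟩, Prod.ext (neg_neg y) ?_⟩
        simp only [IsomS2R.smul_def, pointReflection_apply, Set.Icc.coe_one]
        push_cast
        ring


/-! ### Classification of the groups -/

/-- The space is the quotient of `S² × [0, 1]` by the relation `F`. -/
def IsQuotientBy (X : Type*) [TopologicalSpace X]
    (F : StdSphere 2 × unitInterval → StdSphere 2 × unitInterval → Prop) : Prop :=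
  ∃ p : StdSphere 2 × unitInterval → X, Topology.IsQuotientMap p ∧ ∀ a b, p a = p b ↔ F a b

theorem IsQuotientBy.nonempty_homeomorph {X Y : Type*} [TopologicalSpace X] [TopologicalSpace Y]
    {F : StdSphere 2 × unitInterval → StdSphere 2 × unitInterval → Prop}
    (h : IsQuotientBy X F) (h' : IsQuotientBy Y F) : Nonempty (X ≃ₜ Y) := by
  obtain ⟨p, hp, hpF⟩ := h
  obtain ⟨q, hq, hqF⟩ := h'
  exact nonempty_homeomorph_of_fibers hp hq fun a b => (hpF a b).trans (hqF a b).symm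

theorem IsQuotientBy.of_homeomorph {X Y : Type*} [TopologicalSpace X] [TopologicalSpace Y]
    {F : StdSphere 2 × unitInterval → StdSphere 2 × unitInterval → Prop}
    (h : IsQuotientBy X F) (e : X ≃ₜ Y) : IsQuotientBy Y F := by
  obtain ⟨p, hp, hF⟩ := h
  exact ⟨e ∘ p, e.isQuotientMap.comp hp, fun a b => e.injective.eq_iff.trans (hF a b)⟩

theorem IsQuotientBy.compactSpace {X : Type*} [TopologicalSpace X]
    {F : StdSphere 2 × unitInterval → StdSphere 2 × unitInterval → Prop}
    (h : IsQuotientBy X F) : CompactSpace X := by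
  obtain ⟨p, hp, -⟩ := h
  exact ⟨by rw [← hp.surjective.range_eq]; exact isCompact_range hp.continuous⟩

section Classification

variable {Γ : Subgroup IsomS2R}

/-- The images of the open slabs of growing radius cover the compact orbit space, so one of them
does. -/
theorem exists_norm_orbit_le [CompactSpace (OrbitSpace Γ)] :
    ∃ R : ℝ, ∀ t, ∃ g ∈ Γ, |g.2 t| ≤ R := by
  have hopen : IsOpenMap (Quotient.mk _ : StdSphere 2 × ℝ → OrbitSpace Γ) :=
    MulAction.isOpenQuotientMap_quotientMk.isOpenMap
  set U : ℕ → Set (OrbitSpace Γ) := fun n =>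
    Quotient.mk _ '' ((Set.univ : Set (StdSphere 2)) ×ˢ Metric.ball (0 : ℝ) n) with hU
  obtain ⟨n, hn⟩ := isCompact_univ.elim_directed_cover U
    (fun n => hopen _ (isOpen_univ.prod Metric.isOpen_ball))
    (fun z _ => by
      obtain ⟨p, rfl⟩ := Quotient.mk_surjective z
      obtain ⟨n, hn⟩ := exists_nat_gt |p.2|
      exact Set.mem_iUnion.2 ⟨n, p, ⟨trivial, by simpa using hn⟩, rfl⟩)
    (Monotone.directed_le fun m n h => Set.image_mono (Set.prod_mono_right
      (Metric.ball_subset_ball (Nat.cast_le.2 h))))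
  refine ⟨n, fun t => ?_⟩
  obtain ⟨x, -⟩ := exists_sphere_fixed 1
  obtain ⟨q, ⟨-, hq⟩, h⟩ := hn (Set.mem_univ (Quotient.mk _ (x, t)))
  obtain ⟨g, hg, h⟩ := (orbitSpace_mk_eq_iff _ _).1 h.symm
  refine ⟨g, hg, ?_⟩
  rw [← h] at hq
  exact le_of_lt (mem_ball_zero_iff.1 hq)

theorem exists_translation_ne_zero [CompactSpace (OrbitSpace Γ)] :
    ∃ (A : Euc 3 ≃ₗᵢ[ℝ] Euc 3) (t : ℝ), t ≠ 0 ∧ (A, translation t) ∈ Γ := by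
  obtain ⟨R, hR⟩ := exists_norm_orbit_le (Γ := Γ)
  by_cases hρ : ∃ B c, (B, pointReflection c) ∈ Γ
  · obtain ⟨B, c, hρ⟩ := hρ
    -- This height is so large that neither the trivial translation nor the reflection with
    -- parameter `c` brings it within `R` of the origin. A different reflection composes with the
    -- given one to a nontrivial translation.
    obtain ⟨⟨A, τ⟩, hg, h⟩ := hR (|c| + R + 1)
    rcases isometryEquiv_real τ with ⟨t, rfl⟩ | ⟨d, rfl⟩
    · refine ⟨A, t, ?_, hg⟩
      rintro rfl
      rw [translation_apply] at h
      linarith [le_abs_self (|c| + R + 1 + 0), abs_nonneg c]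
    · refine ⟨A * B, d - c, ?_, ?_⟩
      · intro h0
        obtain rfl : d = c := by linarith
        rw [pointReflection_apply] at h
        linarith [neg_abs_le (d - (|d| + R + 1)), le_abs_self d]
      · rw [← pointReflection_mul]
        exact Γ.mul_mem hg hρ
  · obtain ⟨⟨A, τ⟩, hg, h⟩ := hR (R + 1)
    rcases isometryEquiv_real τ with ⟨t, rfl⟩ | ⟨d, rfl⟩
    · refine ⟨A, t, ?_, hg⟩
      rintro rfl
      rw [translation_apply] at h
      linarith [le_abs_self (R + 1 + 0)]
    · exact absurd ⟨A, d, hg⟩ hρ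

/-- The translation parts form a subgroup of `ℝ` with finitely many elements in each bounded
interval, hence a cyclic one generated by its least positive element. -/
theorem exists_translation_generator [ProperlyDiscontinuousSMul Γ (StdSphere 2 × ℝ)]
    [CompactSpace (OrbitSpace Γ)] :
    ∃ (A : Euc 3 ≃ₗᵢ[ℝ] Euc 3) (T : ℝ), 0 < T ∧ (A, translation T) ∈ Γ ∧
      ∀ B t, (B, translation t) ∈ Γ → ∃ k : ℤ, t = k * T := by
  let G : AddSubgroup ℝ :=
    { carrier := {t | ∃ A, (A, translation t) ∈ Γ}
      add_mem' := by
        rintro s t ⟨A, hA⟩ ⟨B, hB⟩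
        exact ⟨A * B, by rw [← translation_mul]; exact Γ.mul_mem hA hB⟩
      zero_mem' := ⟨1, by rw [translation_zero]; exact Γ.one_mem⟩
      neg_mem' := by
        rintro t ⟨A, hA⟩
        exact ⟨A⁻¹, by rw [← translation_inv]; exact Γ.inv_mem hA⟩ }
  obtain ⟨t, ht0, htG⟩ : ∃ t, 0 < t ∧ t ∈ G := by
    obtain ⟨A, t, ht, hA⟩ := exists_translation_ne_zero (Γ := Γ)
    have hG : t ∈ G := ⟨A, hA⟩
    rcases ht.lt_or_gt with h | h
    · exact ⟨-t, by linarith, G.neg_mem hG⟩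
    · exact ⟨t, h, hG⟩
  have hfin : {s | s ∈ G ∧ 0 < s ∧ s ≤ t}.Finite := by
    refine (((properlyDiscontinuous_iff Γ).1 inferInstance t).image fun γ => γ.1.2 0).subset ?_
    rintro s ⟨⟨A, hA⟩, hs0, hst⟩
    refine ⟨⟨_, hA⟩, ?_, zero_add s⟩
    change |0 + s| ≤ t
    rwa [zero_add, abs_of_pos hs0]
  obtain ⟨T, ⟨hTG, hT0, hTt⟩, hmin⟩ := hfin.exists_minimal ⟨t, htG, ht0, le_rfl⟩
  have hleast : IsLeast {g | g ∈ G ∧ 0 < g} T := by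
    refine ⟨⟨hTG, hT0⟩, fun s hs => ?_⟩
    rcases le_total s T with h | h
    · exact hmin ⟨hs.1, hs.2, h.trans hTt⟩ h
    · exact h
  obtain ⟨A, hA⟩ := hTG
  refine ⟨A, T, hT0, hA, fun B s hs => ?_⟩
  have : s ∈ G := ⟨B, hs⟩
  rw [AddSubgroup.cyclic_of_min hleast, AddSubgroup.mem_closure_singleton] at this
  obtain ⟨k, hk⟩ := this
  exact ⟨k, by rw [← hk, zsmul_eq_mul]⟩

theorem antipode_ne_one : antipode ≠ 1 := fun h => by
  have := congrArg (fun A : Euc 3 ≃ₗᵢ[ℝ] Euc 3 => A (EuclideanSpace.single 0 1) 0) h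
  norm_num [antipode_apply] at this

theorem pointReflection_ne_one (c : ℝ) : pointReflection c ≠ 1 := fun h => by
  have h0 : c - 0 = 0 := congrArg (fun e : ℝ ≃ᵢ ℝ => e 0) h
  have h1 : c - 1 = 1 := congrArg (fun e : ℝ ≃ᵢ ℝ => e 1) h
  linarith

/-- The square of the element fixes a point over the height `c`, so it is trivial by freeness. Then
`A` is an involution, and a fixed point of `A` on the sphere would give one of the nontrivial
element. -/
theorem eq_antipode_of_free (hfree : ∀ (γ : Γ) (p : StdSphere 2 × ℝ), γ • p = p → γ = 1)
    {A : Euc 3 ≃ₗᵢ[ℝ] Euc 3} {τ : ℝ ≃ᵢ ℝ} (hg : (A, τ) ∈ Γ) (h1 : (A, τ) ≠ 1) (hτ : τ * τ = 1)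
    {c : ℝ} (hc : τ c = c) : A = antipode := by
  have hfree' : ∀ g ∈ Γ, ∀ p : StdSphere 2 × ℝ, g • p = p → g = 1 := fun g hg p h =>
    congrArg Subtype.val (hfree ⟨g, hg⟩ p h)
  obtain ⟨y, hy⟩ := exists_sphere_fixed A
  refine eq_antipode_of_fixed_free ?_ fun x hx => h1 (hfree' _ hg (x, c)
    (Prod.ext (Subtype.ext hx) hc))
  refine congrArg Prod.fst (hfree' _ (Γ.mul_mem hg hg) (y, c) (Prod.ext (Subtype.ext hy) ?_))
  exact congrArg (fun e : ℝ ≃ᵢ ℝ => e c) hτ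

theorem eq_one_or_antipode (hfree : ∀ (γ : Γ) (p : StdSphere 2 × ℝ), γ • p = p → γ = 1)
    {A : Euc 3 ≃ₗᵢ[ℝ] Euc 3} (hg : (A, 1) ∈ Γ) : A = 1 ∨ A = antipode := by
  by_cases h : A = 1
  · exact Or.inl h
  · exact Or.inr (eq_antipode_of_free hfree hg (fun h' => h (congrArg Prod.fst h')) (one_mul 1)
      (c := 0) rfl)

theorem prod_translation_zpow (A : Euc 3 ≃ₗᵢ[ℝ] Euc 3) (T : ℝ) (k : ℤ) :
    ((A, translation T) : IsomS2R) ^ k = (A ^ k, translation (k * T)) := by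
  rw [← translation_zpow]
  rfl

theorem mul_zpow_inv_mem {A B : Euc 3 ≃ₗᵢ[ℝ] Euc 3} {T : ℝ} {k : ℤ} (hA : (A, translation T) ∈ Γ)
    (hB : (B, translation (k * T)) ∈ Γ) : (B * (A ^ k)⁻¹, 1) ∈ Γ := by
  have h := Γ.mul_mem hB (Γ.inv_mem (Γ.zpow_mem hA k))
  rw [prod_translation_zpow] at h
  have h1 : translation (k * T) * (translation (k * T))⁻¹ = 1 := mul_inv_cancel _
  rw [← h1]
  exact h

/-- The cases are whether `Γ` reflects the line, whether it contains `(antipode, 1)`, and whether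
the spherical part of a generator can be joined to the identity or to the reflection. -/
theorem orbitSpace_isQuotientBy [ProperlyDiscontinuousSMul Γ (StdSphere 2 × ℝ)]
    [CompactSpace (OrbitSpace Γ)]
    (hfree : ∀ (γ : Γ) (p : StdSphere 2 × ℝ), γ • p = p → γ = 1) :
    IsQuotientBy (OrbitSpace Γ) (TorusFiber (sphereMap reflectionR3)) ∨
      IsQuotientBy (OrbitSpace Γ) (TorusFiber id) ∨ IsQuotientBy (OrbitSpace Γ) ProjectiveFiber ∨
      IsQuotientBy (OrbitSpace Γ) DoubleFiber := by
  obtain ⟨A, T, hT, hA, hgen⟩ := exists_translation_generator (Γ := Γ)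
  by_cases hρ : ∃ B c, (B, pointReflection c) ∈ Γ
  · obtain ⟨B, c, hρ⟩ := hρ
    have hrefl : ∀ B c, (B, pointReflection c) ∈ Γ → B = antipode := fun B c h =>
      eq_antipode_of_free hfree h (fun h' => pointReflection_ne_one c (congrArg Prod.snd h'))
        (by rw [pointReflection_mul, sub_self, translation_zero])
        (c := c / 2) (by rw [pointReflection_apply]; ring)
    obtain rfl := hrefl B c hρ
    -- Composing `(antipode, 1)` with a reflecting element would give one with trivial spherical
    -- part, although all reflecting elements act antipodally on the sphere.
    have htriv : ∀ B, (B, 1) ∈ Γ → B = 1 := fun B hB => by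
      refine (eq_one_or_antipode hfree hB).resolve_right ?_
      rintro rfl
      have h : (antipode * antipode, pointReflection c) ∈ Γ := Γ.mul_mem hB hρ
      rw [antipode_mul_self] at h
      exact antipode_ne_one (hrefl _ _ h).symm
    have hA1 : A = 1 := by
      have h : (antipode * A, pointReflection c * translation T) ∈ Γ := Γ.mul_mem hρ hA
      rw [pointReflection_mul_translation] at h
      exact mul_eq_left.1 (hrefl _ _ h)
    subst hA1
    have hpow : ∀ k : ℤ, (1, translation (k * T)) ∈ Γ := fun k => by
      have h := Γ.zpow_mem hA k
      rwa [prod_translation_zpow, one_zpow] at h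
    refine Or.inr (Or.inr (Or.inr (exists_isQuotientMap_dihedral Γ (c := c) hT ?_)))
    rintro ⟨B, τ⟩
    constructor
    · intro hg
      rcases isometryEquiv_real τ with ⟨t, rfl⟩ | ⟨d, rfl⟩
      · obtain ⟨k, rfl⟩ := hgen B t hg
        have h := htriv _ (mul_zpow_inv_mem hA hg)
        rw [one_zpow, inv_one, mul_one] at h
        exact ⟨k, Or.inl (by rw [h])⟩
      · have h : (B * antipode, pointReflection d * pointReflection c) ∈ Γ := Γ.mul_mem hg hρ
        rw [pointReflection_mul] at h
        obtain ⟨k, hk⟩ := hgen _ _ h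
        refine ⟨k, Or.inr ?_⟩
        rw [hrefl _ _ hg, ← hk, add_sub_cancel]
    · rintro ⟨k, h | h⟩
      · rw [h]
        exact hpow k
      · rw [h, ← translation_mul_pointReflection]
        exact Γ.mul_mem (hpow k) hρ
  · have htrans : ∀ B τ, (B, τ) ∈ Γ → ∃ k : ℤ, τ = translation (k * T) := fun B τ hg => by
      rcases isometryEquiv_real τ with ⟨t, rfl⟩ | ⟨d, rfl⟩
      · obtain ⟨k, rfl⟩ := hgen B t hg
        exact ⟨k, rfl⟩
      · exact absurd ⟨B, d, hg⟩ hρ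
    by_cases hanti : (antipode, 1) ∈ Γ
    -- In the presence of `(antipode, 1)` the generator may be replaced by its antipodal multiple,
    -- which lies over the same translation and lets the path start at the identity.
    · obtain ⟨A', hA', hpath⟩ : ∃ A', (A', translation T) ∈ Γ ∧ IsometryPath 1 A' := by
        rcases isometryPath_one_or_reflectionR3 A with h | h
        · exact ⟨A, hA, h⟩
        · exact ⟨_, Γ.mul_mem hanti hA, isometryPath_antipode_mul h⟩
      refine Or.inr (Or.inr (Or.inl (exists_isQuotientMap_projective_orbit Γ hT ?_ hpath)))
      rintro ⟨B, τ⟩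
      constructor
      · intro hg
        obtain ⟨k, rfl⟩ := htrans B τ hg
        refine ⟨k, ?_⟩
        rcases eq_one_or_antipode hfree (mul_zpow_inv_mem hA' hg) with h | h
        · exact Or.inl (by rw [mul_inv_eq_one.1 h])
        · exact Or.inr (by rw [mul_inv_eq_iff_eq_mul.1 h])
      · rintro ⟨k, h | h⟩
        · rw [h, ← prod_translation_zpow]
          exact Γ.zpow_mem hA' k
        · have h' := Γ.mul_mem hanti (Γ.zpow_mem hA' k)
          rw [prod_translation_zpow] at h'
          rw [h]
          exact h'
    · have hΓ : ∀ g, g ∈ Γ ↔ ∃ k : ℤ, g = (A ^ k, translation (k * T)) := by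
        rintro ⟨B, τ⟩
        constructor
        · intro hg
          obtain ⟨k, rfl⟩ := htrans B τ hg
          have h := mul_zpow_inv_mem hA hg
          refine ⟨k, ?_⟩
          rcases eq_one_or_antipode hfree h with h' | h'
          · rw [mul_inv_eq_one.1 h']
          · exact absurd (h' ▸ h) hanti
        · rintro ⟨k, h⟩
          rw [h, ← prod_translation_zpow]
          exact Γ.zpow_mem hA k
      rcases isometryPath_one_or_reflectionR3 A with h | h
      · exact Or.inr (Or.inl (exists_isQuotientMap_torus Γ hT hΓ h (one_mul 1)))
      · exact Or.inl (exists_isQuotientMap_torus Γ hT hΓ h reflectionR3_mul_self)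

end Classification


/-! ### Explicit groups for the four manifolds, and the conclusion -/

theorem isS2RSpace_of_isQuotientBy {M : Type*} [TopologicalSpace M] {Γ : Subgroup IsomS2R}
    (hΓ : ProperlyDiscontinuousSMul Γ (StdSphere 2 × ℝ))
    (hfree : ∀ g ∈ Γ, ∀ p : StdSphere 2 × ℝ, g • p = p → g = 1)
    {F : StdSphere 2 × unitInterval → StdSphere 2 × unitInterval → Prop}
    (h : IsQuotientBy (OrbitSpace Γ) F) (hM : IsQuotientBy M F) : IsS2RSpace M :=
  ⟨hM.compactSpace, Γ, hΓ, fun γ p hp => Subtype.ext (hfree γ.1 γ.2 p hp),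
    hM.nonempty_homeomorph h⟩

/-- Each integer displacement of the origin is attained by at most two elements, distinguished by
the Boolean, so bounded displacement leaves finitely many. -/
theorem properlyDiscontinuous_of_integral {Γ : Subgroup IsomS2R} {F : ℤ → Bool → IsomS2R}
    (h : ∀ g ∈ Γ, ∃ k b, g = F k b) (hF : ∀ k b, (F k b).2 0 = k) :
    ProperlyDiscontinuousSMul Γ (StdSphere 2 × ℝ) := by
  refine (properlyDiscontinuous_iff Γ).2 fun R => ?_
  refine Set.Finite.of_finite_image (f := Subtype.val) ?_ Subtype.val_injective.injOn
  refine (((Set.finite_Icc (-⌈R⌉) ⌈R⌉).prod (Set.finite_univ (α := Bool))).image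
    fun q => F q.1 q.2).subset ?_
  rintro _ ⟨⟨g, hg⟩, hR, rfl⟩
  obtain ⟨k, b, rfl⟩ := h g hg
  change |(F k b).2 0| ≤ R at hR
  rw [hF] at hR
  have h1 : |(k : ℝ)| ≤ ⌈R⌉ := hR.trans (Int.le_ceil R)
  refine ⟨(k, b), ⟨abs_le.1 ?_, trivial⟩, rfl⟩
  exact_mod_cast h1

theorem eq_zero_of_translation_fixed {k : ℤ} {t : ℝ} (h : translation (k * 1) t = t) : k = 0 := by
  rw [translation_apply, mul_one] at h
  have : (k : ℝ) = 0 := by linarith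
  exact_mod_cast this

theorem neg_ne_self_of_sphere (x : StdSphere 2) : -x ≠ x := fun h => by
  have h1 : -(x : Euc 3) = x := congrArg Subtype.val h
  have h2 : (2 : ℝ) • (x : Euc 3) = 0 := by
    rw [two_smul]
    nth_rewrite 1 [← h1]
    exact neg_add_cancel _
  exact ne_zero_of_mem_unit_sphere x ((smul_eq_zero.1 h2).resolve_left two_ne_zero)

theorem isS2RSpace_torus {M : Type*} [TopologicalSpace M] {B : Euc 3 ≃ₗᵢ[ℝ] Euc 3}
    (hB : B * B = 1) (hM : IsQuotientBy M (TorusFiber (sphereMap B))) : IsS2RSpace M := by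
  set Γ : Subgroup IsomS2R := Subgroup.zpowers (B, translation 1) with hΓdef
  have hΓ : ∀ g, g ∈ Γ ↔ ∃ k : ℤ, g = (B ^ k, translation (k * 1)) := fun g => by
    rw [hΓdef, Subgroup.mem_zpowers_iff]
    simp only [prod_translation_zpow, eq_comm]
  have hpd : ProperlyDiscontinuousSMul Γ (StdSphere 2 × ℝ) := by
    refine properlyDiscontinuous_of_integral (F := fun k _ => (B ^ k, translation (k * 1)))
      (fun g hg => ?_) fun k _ => ?_
    · obtain ⟨k, hk⟩ := (hΓ g).1 hg
      exact ⟨k, true, hk⟩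
    · rw [translation_apply, zero_add, mul_one]
  refine isS2RSpace_of_isQuotientBy hpd ?_
    (exists_isQuotientMap_torus Γ one_pos hΓ (IsometryPath.refl B) hB) hM
  rintro g hg p hp
  obtain ⟨k, rfl⟩ := (hΓ g).1 hg
  obtain rfl := eq_zero_of_translation_fixed (congrArg Prod.snd hp)
  rw [zpow_zero, Int.cast_zero, zero_mul, translation_zero]
  rfl

theorem isS2RSpace_projective {M : Type*} [TopologicalSpace M]
    (hM : IsQuotientBy M ProjectiveFiber) : IsS2RSpace M := by
  let Γ : Subgroup IsomS2R :=
    (Subgroup.zpowers antipode).prod (Subgroup.zpowers (translation 1))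
  have hanti : ∀ A, A ∈ Subgroup.zpowers antipode ↔ A = 1 ∨ A = antipode := fun A => by
    rw [Subgroup.mem_zpowers_iff]
    have h2 : antipode ^ (2 : ℤ) = 1 := (zpow_two _).trans antipode_mul_self
    constructor
    · rintro ⟨k, rfl⟩
      rcases Int.even_or_odd' k with ⟨m, rfl | rfl⟩
      · exact Or.inl (by rw [zpow_mul, h2, one_zpow])
      · exact Or.inr (by rw [zpow_add_one, zpow_mul, h2, one_zpow, one_mul])
    · rintro (rfl | rfl)
      · exact ⟨0, zpow_zero _⟩
      · exact ⟨1, zpow_one _⟩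
  have hΓ : ∀ g, g ∈ Γ ↔ ∃ k : ℤ, g = ((1 : Euc 3 ≃ₗᵢ[ℝ] Euc 3) ^ k, translation (k * 1)) ∨
      g = (antipode * 1 ^ k, translation (k * 1)) := by
    rintro ⟨A, τ⟩
    simp only [one_zpow, mul_one, Prod.mk.injEq, ← or_and_right]
    rw [Subgroup.mem_prod, hanti, Subgroup.mem_zpowers_iff]
    simp only [translation_zpow, mul_one, exists_and_left, eq_comm (a := τ)]
  have hpd : ProperlyDiscontinuousSMul Γ (StdSphere 2 × ℝ) := by
    refine properlyDiscontinuous_of_integral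
      (F := fun k b => (if b then 1 else antipode, translation (k * 1)))
      (fun g hg => ?_) fun k _ => ?_
    · obtain ⟨k, rfl | rfl⟩ := (hΓ g).1 hg
      · exact ⟨k, true, by simp⟩
      · exact ⟨k, false, by simp⟩
    · rw [translation_apply, zero_add, mul_one]
  refine isS2RSpace_of_isQuotientBy hpd ?_
    (exists_isQuotientMap_projective_orbit Γ one_pos hΓ (IsometryPath.refl 1)) hM
  rintro g hg ⟨x, t⟩ hp
  obtain ⟨k, rfl | rfl⟩ := (hΓ g).1 hg
  · obtain rfl := eq_zero_of_translation_fixed (congrArg Prod.snd hp)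
    rw [zpow_zero, Int.cast_zero, zero_mul, translation_zero]
    rfl
  · rw [one_zpow, mul_one] at hp
    exact absurd (congrArg Prod.fst hp) (neg_ne_self_of_sphere x)

/-- The infinite dihedral group generated by the unit translation and the antipodal map combined
with a point reflection. -/
def dihedralIsometries : Subgroup IsomS2R where
  carrier := {g | ∃ k : ℤ, g = (1, translation k) ∨ g = (antipode, pointReflection k)}
  mul_mem' := by
    rintro _ _ ⟨k, rfl | rfl⟩ ⟨l, rfl | rfl⟩
    · refine ⟨k + l, Or.inl (Prod.ext (one_mul 1) ?_)⟩
      rw [Int.cast_add, ← translation_mul]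
      rfl
    · refine ⟨l + k, Or.inr (Prod.ext (one_mul _) ?_)⟩
      rw [Int.cast_add, ← translation_mul_pointReflection]
      rfl
    · refine ⟨k - l, Or.inr (Prod.ext (mul_one _) ?_)⟩
      rw [Int.cast_sub, ← pointReflection_mul_translation]
      rfl
    · refine ⟨k - l, Or.inl (Prod.ext antipode_mul_self ?_)⟩
      rw [Int.cast_sub, ← pointReflection_mul]
      rfl
  one_mem' := ⟨0, Or.inl (by rw [Int.cast_zero, translation_zero]; rfl)⟩
  inv_mem' := by
    rintro _ ⟨k, rfl | rfl⟩
    · refine ⟨-k, Or.inl (Prod.ext inv_one ?_)⟩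
      rw [Int.cast_neg, ← translation_inv]
      rfl
    · refine ⟨k, Or.inr (Prod.ext (inv_eq_of_mul_eq_one_right antipode_mul_self)
        (inv_eq_of_mul_eq_one_right ?_))⟩
      rw [pointReflection_mul, sub_self, translation_zero]

theorem isS2RSpace_dihedral {M : Type*} [TopologicalSpace M]
    (hM : IsQuotientBy M DoubleFiber) : IsS2RSpace M := by
  have hpd : ProperlyDiscontinuousSMul dihedralIsometries (StdSphere 2 × ℝ) := by
    refine properlyDiscontinuous_of_integral
      (F := fun k b => if b then (1, translation k) else (antipode, pointReflection k))
      (fun g hg => ?_) fun k b => ?_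
    · obtain ⟨k, h | h⟩ := hg
      · exact ⟨k, true, h⟩
      · exact ⟨k, false, h⟩
    · cases b
      · exact sub_zero _
      · exact zero_add _
  refine isS2RSpace_of_isQuotientBy hpd ?_
    (exists_isQuotientMap_dihedral dihedralIsometries (c := 0) one_pos fun g => ?_) hM
  · rintro _ ⟨k, rfl | rfl⟩ ⟨x, t⟩ hp
    · rw [← mul_one (k : ℝ)] at hp
      obtain rfl := eq_zero_of_translation_fixed (congrArg Prod.snd hp)
      rw [Int.cast_zero, translation_zero]
      rfl
    · exact absurd (congrArg Prod.fst hp) (neg_ne_self_of_sphere x)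
  · simp only [mul_one, zero_add]
    rfl

theorem IsQuotientBy.hasTriangulation_twisted {X : Type*} [TopologicalSpace X]
    (h : IsQuotientBy X (TorusFiber (sphereMap reflectionR3))) : HasTriangulation X 9 := by
  obtain ⟨p, hp, hF⟩ := h
  exact hasTriangulation_of_runFlips twistedFlips (nonempty_homeomorph_twisted hp hF)
    runFlips_twisted

theorem IsQuotientBy.hasTriangulation_product {X : Type*} [TopologicalSpace X]
    (h : IsQuotientBy X (TorusFiber id)) : HasTriangulation X 10 := by
  obtain ⟨p, hp, hF⟩ := h
  exact hasTriangulation_of_runFlips productFlips (nonempty_homeomorph_product hp hF)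
    runFlips_product

theorem IsQuotientBy.hasTriangulation_projective {X : Type*} [TopologicalSpace X]
    (h : IsQuotientBy X ProjectiveFiber) : HasTriangulation X 14 := by
  obtain ⟨p, hp, hF⟩ := h
  exact hasTriangulation_of_runFlips projectiveFlips (nonempty_homeomorph_projective hp hF)
    runFlips_projective

theorem IsQuotientBy.hasTriangulation_double {X : Type*} [TopologicalSpace X]
    (h : IsQuotientBy X DoubleFiber) : HasTriangulation X 15 := by
  obtain ⟨p, hp, hF⟩ := h
  exact hasTriangulation_of_runFlips doubleFlips (nonempty_homeomorph_double hp hF)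
    runFlips_double

theorem isS2RSpace_iff_isQuotientBy {M : Type*} [TopologicalSpace M] : IsS2RSpace M ↔
    IsQuotientBy M (TorusFiber (sphereMap reflectionR3)) ∨ IsQuotientBy M (TorusFiber id) ∨
      IsQuotientBy M ProjectiveFiber ∨ IsQuotientBy M DoubleFiber := by
  constructor
  · rintro ⟨hM, Γ, hΓ, hfree, ⟨e⟩⟩
    have : CompactSpace (OrbitSpace Γ) := e.compactSpace
    rcases orbitSpace_isQuotientBy hfree with h | h | h | h
    · exact Or.inl (h.of_homeomorph e.symm)
    · exact Or.inr (Or.inl (h.of_homeomorph e.symm))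
    · exact Or.inr (Or.inr (Or.inl (h.of_homeomorph e.symm)))
    · exact Or.inr (Or.inr (Or.inr (h.of_homeomorph e.symm)))
  · rintro (h | h | h | h)
    · exact isS2RSpace_torus reflectionR3_mul_self h
    · exact isS2RSpace_torus (B := 1) (one_mul 1) h
    · exact isS2RSpace_projective h
    · exact isS2RSpace_dihedral h

theorem isQuotientBy_iff_homeomorph {X M : Type*} [TopologicalSpace X] [TopologicalSpace M]
    {F : StdSphere 2 × unitInterval → StdSphere 2 × unitInterval → Prop}
    (hX : IsQuotientBy X F) : IsQuotientBy M F ↔ Nonempty (M ≃ₜ X) :=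
  ⟨fun h => h.nonempty_homeomorph hX, fun ⟨e⟩ => hX.of_homeomorph e.symm⟩

theorem mainTheorem5 :
    (∀ (M : Type*) [TopologicalSpace M], IsS2RSpace M →
      ∃ n : ℕ, n ≤ 15 ∧ HasTriangulation M n) ∧
    (∀ (M : Type*) [TopologicalSpace M], IsS2RSpace M ↔
      Nonempty (M ≃ₜ TwistedS2S1) ∨ Nonempty (M ≃ₜ StdSphere 2 × Circle) ∨
      Nonempty (M ≃ₜ RP 2 × Circle) ∨ Nonempty (M ≃ₜ RP3SumRP3)) ∧
    HasTriangulation TwistedS2S1 9 ∧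
    HasTriangulation (StdSphere 2 × Circle) 10 ∧
    HasTriangulation (RP 2 × Circle) 14 ∧
    HasTriangulation RP3SumRP3 15 := by
  have h1 : IsQuotientBy TwistedS2S1 _ := exists_isQuotientMap_twisted
  have h2 : IsQuotientBy (StdSphere 2 × Circle) _ := exists_isQuotientMap_product
  have h3 : IsQuotientBy (RP 2 × Circle) _ := exists_isQuotientMap_projective
  have h4 : IsQuotientBy RP3SumRP3 _ := exists_isQuotientMap_double
  refine ⟨fun M _ hM => ?_, fun M _ => ?_, h1.hasTriangulation_twisted,
    h2.hasTriangulation_product, h3.hasTriangulation_projective, h4.hasTriangulation_double⟩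
  · rcases isS2RSpace_iff_isQuotientBy.1 hM with h | h | h | h
    · exact ⟨9, by norm_num, h.hasTriangulation_twisted⟩
    · exact ⟨10, by norm_num, h.hasTriangulation_product⟩
    · exact ⟨14, by norm_num, h.hasTriangulation_projective⟩
    · exact ⟨15, le_rfl, h.hasTriangulation_double⟩
  · rw [isS2RSpace_iff_isQuotientBy, isQuotientBy_iff_homeomorph h1,
      isQuotientBy_iff_homeomorph h2, isQuotientBy_iff_homeomorph h3,
      isQuotientBy_iff_homeomorph h4]
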